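/- **Theorem (Local Universal Property).** Let $A\to X$ be a Lie algebroid with anchor $\sharp$, let $\mathcal G\rightrightarrows X$ be a Lie groupoid with source $s$ and target $t$ which integrates $A$ (that is, $A$ is identified with the Lie algebroid $\ker ds|_{X}$ of $\mathcal G$, with anchor $dt$ and the bracket of right invariant vector fields), and let $\omega_{MC}(\xi)=dR_{g^{-1}}(\xi)\in A_{t(g)}$, $\xi\in\ker d_gs$, be its right invariant Maurer–Cartan form. Let $h:M\to X$ be a smooth map and let $\theta:TM\to A$ be a smooth $A$-valued $1$-form over $h$, i.e. a smooth bundle map covering $h$ with $\sharp\circ\theta=dh$. Assume that $\theta$ satisfies the generalized Maurer–Cartan equation $d_\nabla\theta+\tfrac12[\theta,\theta]_\nabla=0$, where $\nabla$ is a connection on $A$, $d_\nabla\theta(\xi_1,\xi_2)=\nabla_{\xi_1}\theta(\xi_2)-\nabla_{\xi_2}\theta(\xi_1)-\theta([\xi_1,\xi_2])$ (with the pullback connection on $h^*A$), $[\theta,\theta]_\nabla(\xi_1,\xi_2)=-2\,T_\nabla(\theta(\xi_1),\theta(\xi_2))$, and $T_\nabla(\alpha,\beta)=\nabla_{\sharp\alpha}\beta-\nabla_{\sharp\beta}\alpha-[\alpha,\beta]$.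 Let $p_0\in M$ and $g_0\in\mathcal G$ with $h(p_0)=t(g_0)$. Then there are an open neighbourhood $U$ of $p_0$ and a smooth map $\phi:U\to s^{-1}(s(g_0))$ with $$\phi(p_0)=g_0,\qquad \phi^*\omega_{MC}=\theta|_U ,$$ where $\phi^*\omega_{MC}=\theta$ is an equality of bundle maps $TU\to A$ and so includes $t\circ\phi=h$ on $U$. The map $\phi$ is unique as a locally defined map: any other smooth map from an open neighbourhood of $p_0$ to $s^{-1}(s(g_0))$ with these two properties agrees with $\phi$ near $p_0$. Moreover, $\phi$ is a local diffeomorphism wherever $\theta$ is a fibrewise isomorphism: if $p\in U$ and $\theta_p:T_pM\to A_{h(p)}$ is bijective, then $\phi$ restricts to a diffeomorphism from an open neighbourhood of $p$ onto an open subset of $s^{-1}(s(g_0))$. In particular, if $\theta$ is a coframe (a fibrewise isomorphism), then $\phi$ is a local diffeomorphism. -/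

import Mathlib

open Set Bundle Topology
open scoped Manifold ContDiff Bundle

noncomputable section

section Definitions

variable {EX EG EM F : Type*}
  [NormedAddCommGroup EX] [NormedSpace ℝ EX]
  [NormedAddCommGroup EG] [NormedSpace ℝ EG]
  [NormedAddCommGroup EM] [NormedSpace ℝ EM]
  [NormedAddCommGroup F] [NormedSpace ℝ F]
  {X : Type*} [TopologicalSpace X] [ChartedSpace EX X]
  {G : Type*} [TopologicalSpace G] [ChartedSpace EG G]
  {M : Type*} [TopologicalSpace M] [ChartedSpace EM M]
  {V : X → Type*} [∀ x, AddCommGroup (V x)] [∀ x, Module ℝ (V x)]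
  [∀ x, TopologicalSpace (V x)] [∀ x, IsTopologicalAddGroup (V x)]
  [∀ x, ContinuousSMul ℝ (V x)] [TopologicalSpace (TotalSpace F V)]
  [FiberBundle F V]

/-! ### Lie algebroids -/

/-- The product of a smooth function and a smooth section. -/
def smoothSMul [VectorBundle ℝ F V] (f : C^∞⟮𝓘(ℝ, EX), X; ℝ⟯) (α : Cₛ^∞⟮𝓘(ℝ, EX); F, V⟯) :
    Cₛ^∞⟮𝓘(ℝ, EX); F, V⟯ where
  toFun x := f x • α x
  contMDiff_toFun := ContMDiff.smul_section f.contMDiff α.contMDiff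

variable (EX F V) in
/-- A Lie algebroid structure on the smooth vector bundle `V` over `X`: a smooth bundle map
`V → TX` (the anchor) and a Lie bracket on the space of smooth sections with the Leibniz rule. -/
structure LieAlgebroid [VectorBundle ℝ F V] [IsManifold 𝓘(ℝ, EX) ∞ X] where
  anchor : ∀ x : X, V x →L[ℝ] TangentSpace 𝓘(ℝ, EX) x
  contMDiff_anchor : ContMDiff (𝓘(ℝ, EX).prod 𝓘(ℝ, F)) 𝓘(ℝ, EX).tangent ∞
    (fun a : TotalSpace F V ↦ (⟨a.proj, anchor a.proj a.snd⟩ : TangentBundle 𝓘(ℝ, EX) X))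
  bracket : Cₛ^∞⟮𝓘(ℝ, EX); F, V⟯ →ₗ[ℝ] Cₛ^∞⟮𝓘(ℝ, EX); F, V⟯ →ₗ[ℝ] Cₛ^∞⟮𝓘(ℝ, EX); F, V⟯
  bracket_self : ∀ α, bracket α α = 0
  jacobi : ∀ α β γ, bracket α (bracket β γ) + bracket β (bracket γ α)
    + bracket γ (bracket α β) = 0
  leibniz : ∀ (f : C^∞⟮𝓘(ℝ, EX), X; ℝ⟯) (α β : Cₛ^∞⟮𝓘(ℝ, EX); F, V⟯) (x : X),
    bracket α (smoothSMul f β) x =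
      f x • bracket α β x + (mvfderiv 𝓘(ℝ, EX) f x (anchor x (α x))) • β x

/-- Every vector in a fibre of a smooth vector bundle is the value of a global smooth section. -/
theorem exists_smooth_section_through [VectorBundle ℝ F V] [FiniteDimensional ℝ EX] [T2Space X]
    [IsManifold 𝓘(ℝ, EX) ∞ X] [ContMDiffVectorBundle ∞ F V 𝓘(ℝ, EX)] (x : X) (a : V x) :
    ∃ α : Cₛ^∞⟮𝓘(ℝ, EX); F, V⟯, α x = a := by
  set e := trivializationAt F V x with he
  have hx : x ∈ e.baseSet := FiberBundle.mem_baseSet_trivializationAt' x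
  obtain ⟨ψ, -, hψ⟩ := (SmoothBumpFunction.nhds_basis_tsupport (I := 𝓘(ℝ, EX)) x).mem_iff.1
    (e.open_baseSet.mem_nhds hx)
  have hs : ContMDiffOn 𝓘(ℝ, EX) (𝓘(ℝ, EX).prod 𝓘(ℝ, F)) ∞
      (fun y ↦ TotalSpace.mk' F y (FiberBundle.extend F a y)) e.baseSet := by
    rw [e.contMDiffOn_section_baseSet_iff]
    refine (contMDiffOn_const (c := (e ⟨x, a⟩).2)).congr fun y hy ↦ ?_
    simp [FiberBundle.extend, ← he, hy]
  refine ⟨⟨fun y ↦ ψ y • FiberBundle.extend F a y, ?_⟩, ?_⟩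
  · exact ContMDiffOn.smul_section_of_tsupport ψ.contMDiff.contMDiffOn e.open_baseSet hψ hs
  · simp

/-- A global smooth section with the prescribed value `a` at `x`. -/
def sectionThrough [VectorBundle ℝ F V] [FiniteDimensional ℝ EX] [T2Space X]
    [IsManifold 𝓘(ℝ, EX) ∞ X] [ContMDiffVectorBundle ∞ F V 𝓘(ℝ, EX)] {x : X} (a : V x) :
    Cₛ^∞⟮𝓘(ℝ, EX); F, V⟯ :=
  Classical.choose (exists_smooth_section_through x a)

/-! ### Connections, torsion and the generalized Maurer–Cartan equation -/

/-- The torsion `∇_{♯α} β - ∇_{♯β} α - [α, β]` of a connection `∇` on a Lie algebroid, evaluated on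
two sections. -/
def LieAlgebroid.sectionTorsion [VectorBundle ℝ F V] [IsManifold 𝓘(ℝ, EX) ∞ X]
    (A : LieAlgebroid EX F V) (D : CovariantDerivative 𝓘(ℝ, EX) F V)
    (α β : Cₛ^∞⟮𝓘(ℝ, EX); F, V⟯) (x : X) : V x :=
  D β x (A.anchor x (α x)) - D α x (A.anchor x (β x)) - A.bracket α β x

/-- The torsion tensor `T_∇` of a connection on a Lie algebroid. It is tensorial, so its value on
`a, b ∈ V x` can be computed with any two sections through `a` and `b`. -/
def LieAlgebroid.torsion [VectorBundle ℝ F V] [FiniteDimensional ℝ EX] [T2Space X]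
    [IsManifold 𝓘(ℝ, EX) ∞ X]
    [ContMDiffVectorBundle ∞ F V 𝓘(ℝ, EX)]
    (A : LieAlgebroid EX F V) (D : CovariantDerivative 𝓘(ℝ, EX) F V) (x : X) (a b : V x) : V x :=
  A.sectionTorsion D (sectionThrough a) (sectionThrough b) x

/-- The pullback connection on `h^* V`, applied to a section `σ` of `V` along `h` at the point `p`
in the direction `v`. In the trivialization `e` of `V` around `h p`, write `σ = ∑ᵢ σⁱ (eᵢ ∘ h)` for
the frame `eᵢ` of `e`. The first term is `∑ᵢ dσⁱ(v) eᵢ` and the second term is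
`∑ᵢ σⁱ(p) ∇_{dh(v)} eᵢ`: here `FiberBundle.extend F (σ p)` is the section `∑ᵢ σⁱ(p) eᵢ`, which is
constant in the trivialization `e`. -/
def pullbackConnection [VectorBundle ℝ F V] (D : CovariantDerivative 𝓘(ℝ, EX) F V) (h : M → X)
    (σ : ∀ p : M, V (h p)) (p : M) (v : TangentSpace 𝓘(ℝ, EM) p) : V (h p) :=
  let e := trivializationAt F V (h p)
  e.symm (h p) (mvfderiv 𝓘(ℝ, EM) (fun q ↦ (e ⟨h q, σ q⟩).2) p v)
    + D (FiberBundle.extend F (σ p)) (h p) (mfderiv 𝓘(ℝ, EM) 𝓘(ℝ, EX) h p v)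

/-- A smooth 1-form on `M` over `h : M → X` with values in the Lie algebroid `A`: a smooth bundle
map `TM → A` covering `h` which is compatible with the anchors. -/
structure LieAlgebroid.OneForm [VectorBundle ℝ F V] [IsManifold 𝓘(ℝ, EX) ∞ X]
    [IsManifold 𝓘(ℝ, EM) ∞ M] (A : LieAlgebroid EX F V) (h : M → X) where
  toFun : ∀ p : M, TangentSpace 𝓘(ℝ, EM) p →L[ℝ] V (h p)
  contMDiff_base : ContMDiff 𝓘(ℝ, EM) 𝓘(ℝ, EX) ∞ h
  contMDiff_toFun : ContMDiff 𝓘(ℝ, EM).tangent (𝓘(ℝ, EX).prod 𝓘(ℝ, F)) ∞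
    (fun w : TangentBundle 𝓘(ℝ, EM) M ↦ (⟨h w.proj, toFun w.proj w.snd⟩ : TotalSpace F V))
  anchor_comp : ∀ (p : M) (v : TangentSpace 𝓘(ℝ, EM) p),
    A.anchor (h p) (toFun p v) = mfderiv 𝓘(ℝ, EM) 𝓘(ℝ, EX) h p v

namespace LieAlgebroid.OneForm

variable [VectorBundle ℝ F V] [IsManifold 𝓘(ℝ, EX) ∞ X] [IsManifold 𝓘(ℝ, EM) ∞ M]
  {A : LieAlgebroid EX F V} {h : M → X}

/-- `d_∇ θ (ξ₁, ξ₂) = ∇_{ξ₁} θ(ξ₂) - ∇_{ξ₂} θ(ξ₁) - θ([ξ₁, ξ₂])`, with the pullback connection. -/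
def dNabla (θ : A.OneForm (EM := EM) h) (D : CovariantDerivative 𝓘(ℝ, EX) F V)
    (ξ₁ ξ₂ : ∀ p : M, TangentSpace 𝓘(ℝ, EM) p) (p : M) : V (h p) :=
  pullbackConnection D h (fun q ↦ θ.toFun q (ξ₂ q)) p (ξ₁ p)
    - pullbackConnection D h (fun q ↦ θ.toFun q (ξ₁ q)) p (ξ₂ p)
    - θ.toFun p (VectorField.mlieBracket 𝓘(ℝ, EM) ξ₁ ξ₂ p)

variable [FiniteDimensional ℝ EX] [T2Space X]
  [ContMDiffVectorBundle ∞ F V 𝓘(ℝ, EX)]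

/-- `[θ, η]_∇ (ξ₁, ξ₂) = -(T_∇(θ(ξ₁), η(ξ₂)) + T_∇(η(ξ₁), θ(ξ₂)))`. -/
def bracketNabla (θ η : A.OneForm (EM := EM) h) (D : CovariantDerivative 𝓘(ℝ, EX) F V)
    (ξ₁ ξ₂ : ∀ p : M, TangentSpace 𝓘(ℝ, EM) p) (p : M) : V (h p) :=
  -(A.torsion D (h p) (θ.toFun p (ξ₁ p)) (η.toFun p (ξ₂ p))
    + A.torsion D (h p) (η.toFun p (ξ₁ p)) (θ.toFun p (ξ₂ p)))

/-- The generalized Maurer–Cartan equation `d_∇ θ + ½ [θ, θ]_∇ = 0`. -/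
def MaurerCartanEquation (θ : A.OneForm (EM := EM) h) (D : CovariantDerivative 𝓘(ℝ, EX) F V) :
    Prop :=
  ∀ ξ₁ ξ₂ : Cₛ^∞⟮𝓘(ℝ, EM); EM, (TangentSpace 𝓘(ℝ, EM) : M → Type _)⟯, ∀ p : M,
    θ.dNabla D ξ₁ ξ₂ p + (1 / 2 : ℝ) • bracketNabla θ θ D ξ₁ ξ₂ p = 0

end LieAlgebroid.OneForm

/-! ### Lie groupoids -/

variable (EX EG X G) in
/-- A Lie groupoid with manifold of arrows `G` and manifold of objects `X`. Arrows go from right to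
left: `mul g k` is the product `g k`, which is meaningful only if `src g = tgt k`; the values of
`mul` on other pairs are irrelevant, and no condition involves them. Since `src` is a submersion,
the set of composable pairs is an embedded submanifold of `G × G`, and smoothness of a map on an
embedded submanifold is `ContMDiffOn`. -/
structure LieGroupoid where
  src : G → X
  tgt : G → X
  unit : X → G
  inv : G → G
  mul : G → G → G
  src_unit : ∀ x, src (unit x) = x
  tgt_unit : ∀ x, tgt (unit x) = x
  src_mul : ∀ g k, src g = tgt k → src (mul g k) = src k
  tgt_mul : ∀ g k, src g = tgt k → tgt (mul g k) = tgt g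
  mul_assoc : ∀ g k l, src g = tgt k → src k = tgt l → mul (mul g k) l = mul g (mul k l)
  mul_unit : ∀ g, mul g (unit (src g)) = g
  unit_mul : ∀ g, mul (unit (tgt g)) g = g
  src_inv : ∀ g, src (inv g) = tgt g
  tgt_inv : ∀ g, tgt (inv g) = src g
  mul_inv : ∀ g, mul g (inv g) = unit (tgt g)
  inv_mul : ∀ g, mul (inv g) g = unit (src g)
  contMDiff_src : ContMDiff 𝓘(ℝ, EG) 𝓘(ℝ, EX) ∞ src
  contMDiff_tgt : ContMDiff 𝓘(ℝ, EG) 𝓘(ℝ, EX) ∞ tgt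
  contMDiff_unit : ContMDiff 𝓘(ℝ, EX) 𝓘(ℝ, EG) ∞ unit
  contMDiff_inv : ContMDiff 𝓘(ℝ, EG) 𝓘(ℝ, EG) ∞ inv
  contMDiffOn_mul : ContMDiffOn (𝓘(ℝ, EG).prod 𝓘(ℝ, EG)) 𝓘(ℝ, EG) ∞
    (fun q : G × G ↦ mul q.1 q.2) {q | src q.1 = tgt q.2}
  src_submersion : ∀ g, Function.Surjective (mfderiv 𝓘(ℝ, EG) 𝓘(ℝ, EX) src g)

namespace LieGroupoid

variable (𝒢 : LieGroupoid EX EG X G)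

/-- The `s`-fibre over `x`, an embedded submanifold of `G` with tangent space `ker ds` at each of
its points. -/
def srcFiber (x : X) : Set G := {g | 𝒢.src g = x}

/-- The differential at `k` of the right translation `R_g : s⁻¹(t(g)) → s⁻¹(s(g))`, `k ↦ k g`, on
vectors tangent to the `s`-fibre `s⁻¹(t(g))`, that is, on `ker d_k s`. -/
def dRight (g k : G) (ξ : TangentSpace 𝓘(ℝ, EG) k) : TangentSpace 𝓘(ℝ, EG) (𝒢.mul k g) :=
  mfderivWithin 𝓘(ℝ, EG) 𝓘(ℝ, EG) (fun k' ↦ 𝒢.mul k' g) (𝒢.srcFiber (𝒢.tgt g)) k ξ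

/-- The right invariant vector field on `G` which corresponds to the section `α` of `V`, where the
fibre `V x` is identified with `ker ds` at the unit `1ₓ` by means of `ι`. The value at `g` is
`dR_g (ι (α (t g)))`, a tangent vector at `1_{t(g)} g = g`. -/
def rightInvariantField (ι : ∀ x : X, V x →L[ℝ] TangentSpace 𝓘(ℝ, EG) (𝒢.unit x))
    (α : ∀ x, V x) (g : G) : TangentSpace 𝓘(ℝ, EG) g :=
  𝒢.unit_mul g ▸ 𝒢.dRight g (𝒢.unit (𝒢.tgt g)) (ι (𝒢.tgt g) (α (𝒢.tgt g)))

/-- The Lie groupoid `𝒢` integrates the Lie algebroid `A`, by means of `ι`: `ι` is an isomorphism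
of Lie algebroids from `A` to the Lie algebroid of `𝒢`. The latter is the bundle with fibre
`ker ds` at `1ₓ` over `x`, its anchor is `dt`, and its bracket is the commutator of right
invariant vector fields. -/
structure Integrates [VectorBundle ℝ F V] [IsManifold 𝓘(ℝ, EX) ∞ X] [IsManifold 𝓘(ℝ, EG) ∞ G]
    (A : LieAlgebroid EX F V) (ι : ∀ x : X, V x →L[ℝ] TangentSpace 𝓘(ℝ, EG) (𝒢.unit x)) :
    Prop where
  contMDiff : ContMDiff (𝓘(ℝ, EX).prod 𝓘(ℝ, F)) 𝓘(ℝ, EG).tangent ∞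
    (fun a : TotalSpace F V ↦ (⟨𝒢.unit a.proj, ι a.proj a.snd⟩ : TangentBundle 𝓘(ℝ, EG) G))
  injective : ∀ x, Function.Injective (ι x)
  range_eq : ∀ x, Set.range (ι x) = {ξ | mfderiv 𝓘(ℝ, EG) 𝓘(ℝ, EX) 𝒢.src (𝒢.unit x) ξ = 0}
  anchor : ∀ (x : X) (a : V x), (⟨x, A.anchor x a⟩ : TangentBundle 𝓘(ℝ, EX) X) =
    ⟨𝒢.tgt (𝒢.unit x), mfderiv 𝓘(ℝ, EG) 𝓘(ℝ, EX) 𝒢.tgt (𝒢.unit x) (ι x a)⟩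
  bracket : ∀ (α β : Cₛ^∞⟮𝓘(ℝ, EX); F, V⟯) (g : G),
    VectorField.mlieBracket 𝓘(ℝ, EG) (𝒢.rightInvariantField ι α) (𝒢.rightInvariantField ι β) g =
      𝒢.rightInvariantField ι (A.bracket α β) g

/-- The Maurer–Cartan form of `𝒢` with values in `A`, where `𝒢` integrates `A` by means of `ι`.
For `ξ` tangent to the `s`-fibre through `g`, it is `dR_{g⁻¹} ξ`, a vector in `ker ds` at
`g g⁻¹ = 1_{t(g)}`, read as an element of the fibre `V (t g)`: it is the unique `a` with
`ι a = dR_{g⁻¹} ξ`. (The value on `ξ ∉ ker ds` has no meaning and is not used.) -/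
def maurerCartan (ι : ∀ x : X, V x →L[ℝ] TangentSpace 𝓘(ℝ, EG) (𝒢.unit x)) (g : G)
    (ξ : TangentSpace 𝓘(ℝ, EG) g) : V (𝒢.tgt g) :=
  Function.invFun (ι (𝒢.tgt g)) (𝒢.mul_inv g ▸ 𝒢.dRight (𝒢.inv g) g ξ)

/-- `φ` is defined and smooth on the open set `U`, takes values in the `s`-fibre over `x`, and
satisfies `φ^* ω_MC = θ` on `U`. The last condition is the equality of the bundle maps
`ω_MC ∘ dφ` and `θ` from `TU` to `A`, so it includes `t ∘ φ = h` on `U`. -/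
structure IsSolutionOn [VectorBundle ℝ F V] [IsManifold 𝓘(ℝ, EX) ∞ X] [IsManifold 𝓘(ℝ, EM) ∞ M]
    {A : LieAlgebroid EX F V} {h : M → X} (θ : A.OneForm (EM := EM) h)
    (ι : ∀ x : X, V x →L[ℝ] TangentSpace 𝓘(ℝ, EG) (𝒢.unit x)) (x : X) (U : Set M) (φ : M → G) :
    Prop where
  isOpen : IsOpen U
  contMDiffOn : ContMDiffOn 𝓘(ℝ, EM) 𝓘(ℝ, EG) ∞ φ U
  mapsTo : MapsTo φ U (𝒢.srcFiber x)
  pullback_eq : ∀ p ∈ U, ∀ v : TangentSpace 𝓘(ℝ, EM) p,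
    (⟨𝒢.tgt (φ p), 𝒢.maurerCartan ι (φ p) (mfderiv 𝓘(ℝ, EM) 𝓘(ℝ, EG) φ p v)⟩ : TotalSpace F V) =
      ⟨h p, θ.toFun p v⟩

variable (EM) in
/-- `φ` restricts to a diffeomorphism from the open set `U` of `M` onto an open subset of the
`s`-fibre over `x`. The fibre is an embedded submanifold of `G`, so its open subsets are the sets
`𝒢.srcFiber x ∩ W` with `W` open in `G`, and smoothness of the inverse map on such a set is
`ContMDiffOn`. -/
def IsDiffeoOntoOpenOfSrcFiber (x : X) (U : Set M) (φ : M → G) : Prop :=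
  IsOpen U ∧ ContMDiffOn 𝓘(ℝ, EM) 𝓘(ℝ, EG) ∞ φ U ∧
    (∃ W : Set G, IsOpen W ∧ φ '' U = 𝒢.srcFiber x ∩ W) ∧
    ∃ ψ : G → M, ContMDiffOn 𝓘(ℝ, EG) 𝓘(ℝ, EM) ∞ ψ (φ '' U) ∧ LeftInvOn ψ φ U

end LieGroupoid

end Definitions

end

set_option linter.unusedSectionVars false

/-! The equation φ^*ω_MC = θ says that dφ at p is the right translate of θ_p to φ(p). In charts of M
and G and a trivialization of V it becomes a total differential equation dφ = R(φ) ∘ Θ: the columns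
of R are the right invariant fields of the sections that are constant in the trivialization
(`rightCoord`), and Θ is θ in coordinates (`OneForm.coord`). The intrinsic equation makes sense only
where t ∘ φ = h; the trivialization extends it to all nearby values of φ.

The Frobenius condition of this system is R'(RΘv)Θw − R'(RΘw)Θv + R(dΘ(v, w)) = 0. Right invariant
fields are closed under commutators, with the bracket of A, so the first two terms are R applied to
the bracket of the constant sections Θv and Θw. Since ♯ ∘ θ = dh, the connection drops out of the
generalized Maurer–Cartan equation, which becomes dΘ(v, w) + [Θv, Θw] = 0. Hence the condition holds
(`Integrates.integrability`), but only at pairs with t(y) = h(z).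

This is enough. Solve the system along rays from p₀. Along a ray, t of the trajectory and h satisfy
the same ordinary differential equation, given by the anchor, so they agree and the trajectory stays
where integrability is known (`exists_ray_trajectory`). The endpoints of the trajectories define φ.
Its derivative in all directions is found by a Grönwall estimate whose first-order error is the
integrability expression (`hasFDerivAt_ray_endpoint`, `exists_hasFDerivAt_comp`). Smoothness follows
by bootstrapping, and s ∘ φ is constant because ds ∘ R = 0.

Uniqueness is uniqueness for ordinary differential equations on rays. For the last claim, right
translation is an isomorphism from the fibre of A at t(g) onto ker ds at g. So if θ_p is bijective,
dφ_p is an isomorphism onto the tangent space of the s-fibre, and the inverse function theorem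
applies (`ContDiffAt.exists_leftInverse_on_fiber`).

Multiplication is smooth only on composable pairs, so differentials of right translations are
computed on curves inside s-fibres. Smooth retractions onto these fibres provide such curves, and
smooth families of them, which make R smooth (`Integrates.contDiffAt_rightTangent`). -/

noncomputable section

/-! ### Total differential equations dφ = R(φ) ∘ Θ in normed spaces -/

section LocalSystem

open scoped NNReal
open Metric

/-- A Picard–Lindelöf solution which stays in the ball on which the vector field is controlled. -/
theorem IsPicardLindelof.exists_solution_mem_closedBall {E : Type*} [NormedAddCommGroup E]
    [NormedSpace ℝ E] [CompleteSpace E] {f : ℝ → E → E} {tmin tmax : ℝ} {t₀ : Icc tmin tmax}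
    {x₀ x : E} {a r L K : ℝ≥0} (hf : IsPicardLindelof f t₀ x₀ a r L K) (hx : x ∈ closedBall x₀ r) :
    ∃ α : ℝ → E, α t₀ = x ∧ (∀ t, α t ∈ closedBall x₀ a) ∧
      ∀ t ∈ Icc tmin tmax, HasDerivWithinAt α (f t (α t)) (Icc tmin tmax) t := by
  obtain ⟨α, hα⟩ := ODE.FunSpace.exists_isFixedPt_next hf hx
  -- `compProj` extends a curve constantly beyond the interval, so the ball bound that `mul_max_le`
  -- gives for curves of the Picard space holds at all times.
  refine ⟨α.compProj, by rw [ODE.FunSpace.compProj_val, ← hα, ODE.FunSpace.next_apply₀],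
    fun t ↦ α.compProj_mem_closedBall hf.mul_max_le, fun t ht ↦ ?_⟩
  apply ODE.hasDerivWithinAt_picard_Icc t₀.2 hf.continuousOn_uncurry
    α.continuous_compProj.continuousOn (fun _ ht' ↦ α.compProj_mem_closedBall hf.mul_max_le)
    x ht |>.congr_of_mem _ ht
  intro t' ht'
  nth_rw 1 [← hα]
  rw [ODE.FunSpace.compProj_of_mem ht', ODE.FunSpace.next_apply]

/-- First-order Taylor expansion in the second variable, uniformly for the first variable in a
compact set. -/
theorem IsCompact.eventually_forall_norm_sub_fderiv_le {P W E : Type*}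
    [NormedAddCommGroup P] [NormedSpace ℝ P] [NormedAddCommGroup W] [NormedSpace ℝ W]
    [NormedAddCommGroup E] [NormedSpace ℝ E] {q : P × W → E} {K : Set P} (hK : IsCompact K)
    (hq : ∀ k ∈ K, ContDiffAt ℝ 1 q (k, 0)) {ε : ℝ} (hε : 0 < ε) :
    ∀ᶠ δ in 𝓝 (0 : W), ∀ k ∈ K,
      ‖q (k, δ) - q (k, 0) - fderiv ℝ q (k, 0) (0, δ)‖ ≤ ε * ‖δ‖ := by
  -- Compactness makes the claim local at `k₀`. Strict differentiability there gives the estimate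
  -- with the derivative taken at `k₀`; continuity of the derivative moves it to the nearby point.
  -- Each costs ε/2.
  refine hK.eventually_forall_of_forall_eventually fun k₀ hk₀ ↦ ?_
  have h1 := ((hq k₀ hk₀).hasStrictFDerivAt one_ne_zero).isLittleO.def (half_pos hε)
  have h2 : Filter.Tendsto (fun z : W × P ↦ ((z.2, z.1), (z.2, (0 : W)))) (𝓝 (0, k₀))
      (𝓝 ((k₀, 0), (k₀, 0))) := by
    refine Continuous.tendsto' (by fun_prop) _ _ rfl
  have h3 : ContinuousAt (fderiv ℝ q) (k₀, 0) :=
    ((hq k₀ hk₀).fderiv_right (m := 0) (by norm_num)).continuousAt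
  have h4 : Filter.Tendsto (fun z : W × P ↦ (z.2, (0 : W))) (𝓝 (0, k₀)) (𝓝 (k₀, 0)) :=
    Continuous.tendsto' (by fun_prop) _ _ rfl
  have h5 := (h3.tendsto.comp h4).eventually (ball_mem_nhds _ (half_pos hε))
  filter_upwards [h2.eventually h1, h5] with z hz1 hz2
  simp only [Prod.mk_sub_mk, sub_self, sub_zero] at hz1
  have hz3 : ‖fderiv ℝ q (z.2, 0) - fderiv ℝ q (k₀, 0)‖ ≤ ε / 2 := by
    simpa [dist_eq_norm] using (mem_ball.1 hz2).le
  have hn : ‖((0 : P), z.1)‖ = ‖z.1‖ := by simp [Prod.norm_def]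
  rw [hn] at hz1
  calc _ = ‖(q (z.2, z.1) - q (z.2, 0) - fderiv ℝ q (k₀, 0) (0, z.1))
        - (fderiv ℝ q (z.2, 0) - fderiv ℝ q (k₀, 0)) (0, z.1)‖ := by
        congr 1; simp
    _ ≤ ε / 2 * ‖z.1‖ + ε / 2 * ‖z.1‖ := by
        refine (norm_sub_le _ _).trans (add_le_add hz1 ?_)
        refine (ContinuousLinearMap.le_opNorm _ _).trans ?_
        rw [hn]; gcongr
    _ = ε * ‖z.1‖ := by ring

variable {E W F Y : Type*} [NormedAddCommGroup E] [NormedSpace ℝ E]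
  [NormedAddCommGroup W] [NormedSpace ℝ W] [NormedAddCommGroup F] [NormedSpace ℝ F]
  [NormedAddCommGroup Y] [NormedSpace ℝ Y]

/-- A solution of `dφ = R(φ) ∘ Θ` with smooth coefficients is smooth. -/
theorem contDiffOn_of_hasFDerivAt_comp {R : E → F →L[ℝ] E} {Θ : W → W →L[ℝ] F} {O : Set E}
    {U : Set W} (hU : IsOpen U) (hR : ContDiffOn ℝ ∞ R O) (hΘ : ContDiffOn ℝ ∞ Θ U) {φ : W → E}
    (hφO : MapsTo φ U O) (hφ : ∀ p ∈ U, HasFDerivAt φ ((R (φ p)).comp (Θ p)) p) :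
    ContDiffOn ℝ ∞ φ U := by
  refine contDiffOn_infty.2 fun n ↦ ?_
  induction n with
  | zero => exact contDiffOn_zero.2 fun p hp ↦ (hφ p hp).continuousAt.continuousWithinAt
  | succ n ih =>
    push_cast
    -- The equation expresses `fderiv φ` through φ itself, so each order of smoothness of φ passes
    -- to its derivative.
    refine (contDiffOn_succ_iff_fderiv_of_isOpen hU).2
      ⟨fun p hp ↦ (hφ p hp).differentiableAt.differentiableWithinAt, by simp, ?_⟩
    refine ContDiffOn.congr ?_ fun p hp ↦ (hφ p hp).fderiv
    exact ((hR.of_le (mod_cast le_top)).comp ih hφO).clm_comp (hΘ.of_le (mod_cast le_top))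

/-- Two solutions of `dφ = R(φ) ∘ Θ` with the same value at `p₀` agree near `p₀`. -/
theorem eventuallyEq_of_hasFDerivAt_comp {R : E → F →L[ℝ] E} {Θ : W → W →L[ℝ] F} {p₀ : W}
    {φ φ' : W → E} (hR : ContDiffAt ℝ 1 R (φ p₀)) (hΘ : ContinuousAt Θ p₀)
    (hφ : ∀ᶠ p in 𝓝 p₀, HasFDerivAt φ ((R (φ p)).comp (Θ p)) p)
    (hφ' : ∀ᶠ p in 𝓝 p₀, HasFDerivAt φ' ((R (φ' p)).comp (Θ p)) p)
    (h₀ : φ' p₀ = φ p₀) : φ' =ᶠ[𝓝 p₀] φ := by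
  obtain ⟨K, T, hT, hK⟩ := hR.exists_lipschitzOnWith
  have c1 := hφ.self_of_nhds.continuousAt.preimage_mem_nhds hT
  have c2 : φ' ⁻¹' T ∈ 𝓝 p₀ := hφ'.self_of_nhds.continuousAt.preimage_mem_nhds (h₀ ▸ hT)
  have c3 : ∀ᶠ p in 𝓝 p₀, ‖Θ p‖ < ‖Θ p₀‖ + 1 :=
    hΘ.norm.eventually (gt_mem_nhds (lt_add_one _))
  obtain ⟨r, hr, hball⟩ := Metric.mem_nhds_iff.1
    (Filter.inter_mem (Filter.inter_mem c1 c2) (hφ.and (hφ'.and c3)))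
  filter_upwards [ball_mem_nhds p₀ hr] with p hp
  have hmem : ∀ τ ∈ Icc (0 : ℝ) 1, p₀ + τ • (p - p₀) ∈ ball p₀ r := fun τ hτ ↦ by
    have := (convex_ball p₀ r).add_smul_sub_mem (mem_ball_self hr) hp hτ
    exact this
  have hline : ∀ τ : ℝ, HasDerivAt (fun τ : ℝ ↦ p₀ + τ • (p - p₀)) (p - p₀) τ := fun τ ↦ by
    simpa using ((hasDerivAt_id τ).smul_const (p - p₀)).const_add p₀
  -- On the segment from `p₀` to `p` every solution satisfies one ordinary differential equation,
  -- whose right-hand side is Lipschitz on `T`.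
  have key : ∀ ψ : W → E, (∀ q ∈ ball p₀ r, HasFDerivAt ψ ((R (ψ q)).comp (Θ q)) q) →
      ∀ τ ∈ Icc (0 : ℝ) 1, HasDerivAt (fun τ : ℝ ↦ ψ (p₀ + τ • (p - p₀)))
        (R (ψ (p₀ + τ • (p - p₀))) (Θ (p₀ + τ • (p - p₀)) (p - p₀))) τ := fun ψ hψ τ hτ ↦
    HasFDerivAt.comp_hasDerivAt (f := fun τ : ℝ ↦ p₀ + τ • (p - p₀)) τ (hψ _ (hmem τ hτ)) (hline τ)
  have k1 := key φ fun q hq ↦ (hball hq).2.1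
  have k2 := key φ' fun q hq ↦ (hball hq).2.2.1
  have := ODE_solution_unique_of_mem_Icc_right (a := 0) (b := 1)
    (K := K * (‖Θ p₀‖₊ + 1) * ‖p - p₀‖₊)
    (v := fun τ y ↦ R y (Θ (p₀ + τ • (p - p₀)) (p - p₀))) (s := fun _ ↦ T)
    (f := fun τ : ℝ ↦ φ' (p₀ + τ • (p - p₀))) (g := fun τ : ℝ ↦ φ (p₀ + τ • (p - p₀)))
    ?_ (fun τ hτ ↦ (k2 τ hτ).continuousAt.continuousWithinAt)
    (fun τ hτ ↦ (k2 τ (Ico_subset_Icc_self hτ)).hasDerivWithinAt)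
    (fun τ hτ ↦ (hball (hmem τ (Ico_subset_Icc_self hτ))).1.2)
    (fun τ hτ ↦ (k1 τ hτ).continuousAt.continuousWithinAt)
    (fun τ hτ ↦ (k1 τ (Ico_subset_Icc_self hτ)).hasDerivWithinAt)
    (fun τ hτ ↦ (hball (hmem τ (Ico_subset_Icc_self hτ))).1.1)
    (by simpa using h₀) (right_mem_Icc.2 zero_le_one)
  · simpa using this
  · intro τ hτ
    refine LipschitzOnWith.of_dist_le_mul fun y hy z hz ↦ ?_
    have hb := (hball (hmem τ (Ico_subset_Icc_self hτ))).2.2.2.le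
    rw [dist_eq_norm, ← sub_apply]
    refine (ContinuousLinearMap.le_opNorm _ _).trans ?_
    have h1 := hK.norm_sub_le hy hz
    have h2 := (Θ (p₀ + τ • (p - p₀))).le_of_opNorm_le hb (p - p₀)
    rw [dist_eq_norm]
    push_cast
    calc _ ≤ (K * ‖y - z‖) * ((‖Θ p₀‖ + 1) * ‖p - p₀‖) := by gcongr
      _ = _ := by ring

/-- Trajectories along rays of the system `dφ = R(φ) ∘ Θ`, together with the first integral `t`
which they follow. -/
theorem exists_ray_trajectory [CompleteSpace E] {R : E → F →L[ℝ] E} {Θ : W → W →L[ℝ] F}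
    {t : E → Y} {h : W → Y} {ρ : Y → F →L[ℝ] Y} {p₀ v : W} {y₀ : E} {a K C C' Kρ : ℝ≥0} {T : Set Y}
    (hK : LipschitzOnWith K R (closedBall y₀ a)) (hC : ∀ y ∈ closedBall y₀ a, ‖R y‖ ≤ C)
    (hΘ : ∀ τ ∈ Icc (0 : ℝ) 1, ContinuousAt Θ (p₀ + τ • v))
    (hC' : ∀ τ ∈ Icc (0 : ℝ) 1, ‖Θ (p₀ + τ • v)‖ ≤ C') (hv : C * (C' * ‖v‖) ≤ a)
    (hKρ : LipschitzOnWith Kρ ρ T)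
    (ht : ∀ y ∈ closedBall y₀ a, t y ∈ T ∧
      ∃ t' : E →L[ℝ] Y, HasFDerivAt t t' y ∧ ∀ f, t' (R y f) = ρ (t y) f)
    (hh : ∀ τ ∈ Icc (0 : ℝ) 1, h (p₀ + τ • v) ∈ T ∧
      HasFDerivAt h ((ρ (h (p₀ + τ • v))).comp (Θ (p₀ + τ • v))) (p₀ + τ • v))
    (h₀ : h p₀ = t y₀) :
    ∃ α : ℝ → E, α 0 = y₀ ∧ (∀ τ, α τ ∈ closedBall y₀ a) ∧ ContinuousOn α (Icc 0 1) ∧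
      (∀ τ ∈ Ico (0 : ℝ) 1, HasDerivWithinAt α (R (α τ) (Θ (p₀ + τ • v) v)) (Ici τ) τ) ∧
      ∀ τ ∈ Icc (0 : ℝ) 1, t (α τ) = h (p₀ + τ • v) := by
  have hline : ∀ τ : ℝ, HasDerivAt (fun τ : ℝ ↦ p₀ + τ • v) v τ := fun τ ↦ by
    simpa using ((hasDerivAt_id τ).smul_const v).const_add p₀
  -- The speed is at most C·C'·‖v‖ and the time interval has length 1, so `hv` is what keeps the
  -- solution in the ball of radius `a` up to time 1.
  have hpl : IsPicardLindelof (fun τ y ↦ R y (Θ (p₀ + τ • v) v)) (tmin := 0) (tmax := 1)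
      ⟨0, by simp⟩ y₀ a 0 (C * (C' * ‖v‖₊)) (K * (C' * ‖v‖₊)) :=
    { lipschitzOnWith := fun τ hτ ↦ by
        refine LipschitzOnWith.of_dist_le_mul fun y hy z hz ↦ ?_
        rw [dist_eq_norm, ← sub_apply]
        refine (ContinuousLinearMap.le_opNorm _ _).trans ?_
        have h1 := hK.norm_sub_le hy hz
        have h2 := (Θ (p₀ + τ • v)).le_of_opNorm_le (hC' τ hτ) v
        rw [dist_eq_norm]
        push_cast
        calc _ ≤ (K * ‖y - z‖) * (C' * ‖v‖) := by gcongr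
          _ = _ := by ring
      continuousOn := fun y hy τ hτ ↦ by
        have : ContinuousAt (fun τ : ℝ ↦ Θ (p₀ + τ • v)) τ :=
          ContinuousAt.comp (f := fun τ : ℝ ↦ p₀ + τ • v) (hΘ τ hτ) (hline τ).continuousAt
        exact (continuousAt_const.clm_apply (this.clm_apply
          continuousAt_const)).continuousWithinAt
      norm_le := fun τ hτ y hy ↦ by
        refine (ContinuousLinearMap.le_opNorm _ _).trans ?_
        have h2 := (Θ (p₀ + τ • v)).le_of_opNorm_le (hC' τ hτ) v
        push_cast
        gcongr
        exact hC y hy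
      mul_max_le := by simpa using hv }
  obtain ⟨α, hα0, hαm, hα⟩ := hpl.exists_solution_mem_closedBall (x := y₀) (by simp)
  have hαc : ContinuousOn α (Icc 0 1) := fun τ hτ ↦ (hα τ hτ).continuousWithinAt
  have hα' : ∀ τ ∈ Ico (0 : ℝ) 1, HasDerivWithinAt α (R (α τ) (Θ (p₀ + τ • v) v)) (Ici τ) τ :=
    fun τ hτ ↦ (hα τ (Ico_subset_Icc_self hτ)).mono_of_mem_nhdsWithin (Icc_mem_nhdsGE_of_mem hτ)
  refine ⟨α, hα0, hαm, hαc, hα', ?_⟩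
  -- Both t ∘ α and h on the ray solve z' = ρ(z)(Θ v): the former because dt ∘ R = ρ ∘ t, the latter
  -- by `hh`.
  refine ODE_solution_unique_of_mem_Icc_right (K := Kρ * (C' * ‖v‖₊))
    (v := fun τ z ↦ ρ z (Θ (p₀ + τ • v) v)) (s := fun _ ↦ T)
    (f := fun τ : ℝ ↦ t (α τ)) (g := fun τ : ℝ ↦ h (p₀ + τ • v)) ?_ ?_ ?_
    (fun τ hτ ↦ (ht _ (hαm τ)).1) ?_ ?_ (fun τ hτ ↦ (hh τ (Ico_subset_Icc_self hτ)).1)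
    (by simp only [zero_smul, add_zero]; rw [show α 0 = y₀ from hα0, h₀])
  · intro τ hτ
    refine LipschitzOnWith.of_dist_le_mul fun y hy z hz ↦ ?_
    rw [dist_eq_norm, ← sub_apply]
    refine (ContinuousLinearMap.le_opNorm _ _).trans ?_
    have h1 := hKρ.norm_sub_le hy hz
    have h2 := (Θ (p₀ + τ • v)).le_of_opNorm_le (hC' τ (Ico_subset_Icc_self hτ)) v
    rw [dist_eq_norm]
    push_cast
    calc _ ≤ (Kρ * ‖y - z‖) * (C' * ‖v‖) := by gcongr
      _ = _ := by ring
  · intro τ hτ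
    obtain ⟨-, t', ht', -⟩ := ht _ (hαm τ)
    exact ht'.continuousAt.comp_continuousWithinAt (hαc τ hτ)
  · intro τ hτ
    obtain ⟨-, t', ht', hR⟩ := ht _ (hαm τ)
    have := ht'.comp_hasDerivWithinAt τ (hα' τ hτ)
    rw [hR] at this
    exact this
  · intro τ hτ
    exact (ContinuousAt.comp (f := fun τ : ℝ ↦ p₀ + τ • v) (hh τ hτ).2.continuousAt
      (hline τ).continuousAt).continuousWithinAt
  · intro τ hτ
    exact (HasFDerivAt.comp_hasDerivAt (f := fun τ : ℝ ↦ p₀ + τ • v) τ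
      (hh τ (Ico_subset_Icc_self hτ)).2 (hline τ)).hasDerivWithinAt

/-- Linearity in the defect turns a defect of order o(‖δ‖) into a distance of order o(‖δ‖) between
endpoints. -/
theorem gronwallBound_zero_mul (K ε x : ℝ) :
    gronwallBound 0 K ε x = ε * gronwallBound 0 K 1 x := by
  unfold gronwallBound
  split_ifs <;> ring

/-- The endpoints of the ray trajectories depend differentiably on the ray, with the derivative
prescribed by the system, if the integrability condition holds along the ray. -/
theorem hasFDerivAt_ray_endpoint {R : E → F →L[ℝ] E} {Θ : W → W →L[ℝ] F} {p₀ v : W} {y₀ : E}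
    {O : Set E} {r : ℝ} {a K C C' : ℝ≥0} (ha : 0 < a)
    (hK : LipschitzOnWith K R (closedBall y₀ (2 * a))) (hO : IsOpen O) (haO : closedBall y₀ a ⊆ O)
    (hR : ContDiffOn ℝ 1 R O)
    (hC : ∀ y ∈ closedBall y₀ a, ‖R y‖ ≤ C) (hΘ : ContDiffOn ℝ 1 Θ (ball p₀ r))
    (hC' : ∀ p ∈ ball p₀ r, ‖Θ p‖ ≤ C') (hv : v ∈ ball (0 : W) r) {α : W → ℝ → E}
    (hα₀ : ∀ w ∈ ball (0 : W) r, α w 0 = y₀)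
    (hαm : ∀ w ∈ ball (0 : W) r, ∀ τ, α w τ ∈ closedBall y₀ a)
    (hαc : ∀ w ∈ ball (0 : W) r, ContinuousOn (α w) (Icc 0 1))
    (hα : ∀ w ∈ ball (0 : W) r, ∀ τ ∈ Ico (0 : ℝ) 1,
      HasDerivWithinAt (α w) (R (α w τ) (Θ (p₀ + τ • w) w)) (Ici τ) τ)
    (hinv : ∀ τ ∈ Ico (0 : ℝ) 1, ∀ w,
      fderiv ℝ R (α v τ) (R (α v τ) (Θ (p₀ + τ • v) v)) (Θ (p₀ + τ • v) w)
        - fderiv ℝ R (α v τ) (R (α v τ) (Θ (p₀ + τ • v) w)) (Θ (p₀ + τ • v) v)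
        + R (α v τ) (fderiv ℝ Θ (p₀ + τ • v) v w - fderiv ℝ Θ (p₀ + τ • v) w v) = 0) :
    HasFDerivAt (fun w ↦ α w 1) ((R (α v 1)).comp (Θ (p₀ + v))) v := by
  have hline : ∀ (w : W) (τ : ℝ), HasDerivAt (fun τ : ℝ ↦ p₀ + τ • w) w τ := fun w τ ↦ by
    simpa using ((hasDerivAt_id τ).smul_const w).const_add p₀
  have hmem : ∀ w ∈ ball (0 : W) r, ∀ τ ∈ Icc (0 : ℝ) 1, p₀ + τ • w ∈ ball p₀ r := by
    intro w hw τ hτ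
    have h1 : ‖w‖ < r := by simpa using hw
    have : ‖τ • w‖ < r := by
      rw [norm_smul, Real.norm_of_nonneg hτ.1]
      nlinarith [norm_nonneg w, hτ.2, hτ.1]
    simpa [dist_eq_norm] using this
  -- The right-hand side of the equation for the ray `v + δ`, evaluated at the guess ψ introduced
  -- below for its trajectory. It is expanded to first order in δ, uniformly over the compact graph
  -- `S` of the trajectory of `v`.
  set q : (ℝ × E) × W → E := fun z ↦
    R (z.1.2 + R z.1.2 (Θ (p₀ + z.1.1 • v) (z.1.1 • z.2)))
      (Θ (p₀ + z.1.1 • (v + z.2)) (v + z.2)) with hq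
  have hRat : ∀ y ∈ closedBall y₀ a, ContDiffAt ℝ 1 R y := fun y hy ↦
    hR.contDiffAt (hO.mem_nhds (haO hy))
  have hΘat : ∀ p ∈ ball p₀ r, ContDiffAt ℝ 1 Θ p := fun p hp ↦
    hΘ.contDiffAt (isOpen_ball.mem_nhds hp)
  set S : Set (ℝ × E) := (fun τ : ℝ ↦ (τ, α v τ)) '' Icc 0 1 with hS
  have hScpt : IsCompact S :=
    isCompact_Icc.image_of_continuousOn (continuousOn_id.prodMk (hαc v hv))
  have hqat : ∀ k ∈ S, ContDiffAt ℝ 1 q (k, 0) := by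
    rintro _ ⟨τ, hτ, rfl⟩
    have e1 : ContDiffAt ℝ 1 (fun z : (ℝ × E) × W ↦ R z.1.2) ((τ, α v τ), 0) :=
      (hRat _ (hαm v hv τ)).comp ((τ, α v τ), (0 : W)) (f := fun z : (ℝ × E) × W ↦ z.1.2)
        (by fun_prop)
    have e2 : ContDiffAt ℝ 1 (fun z : (ℝ × E) × W ↦ Θ (p₀ + z.1.1 • v)) ((τ, α v τ), 0) :=
      (hΘat _ (hmem v hv τ hτ)).comp ((τ, α v τ), (0 : W))
        (f := fun z : (ℝ × E) × W ↦ p₀ + z.1.1 • v) (by fun_prop)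
    have e3 : ContDiffAt ℝ 1 (fun z : (ℝ × E) × W ↦ Θ (p₀ + z.1.1 • (v + z.2)))
        ((τ, α v τ), 0) := by
      refine ContDiffAt.comp (g := Θ) ((τ, α v τ), (0 : W))
        (f := fun z : (ℝ × E) × W ↦ p₀ + z.1.1 • (v + z.2)) ?_ (by fun_prop)
      simpa using hΘat _ (hmem v hv τ hτ)
    have e4 : ContDiffAt ℝ 1 (fun z : (ℝ × E) × W ↦
        z.1.2 + R z.1.2 (Θ (p₀ + z.1.1 • v) (z.1.1 • z.2))) ((τ, α v τ), 0) :=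
      ContDiffAt.add (by fun_prop) (e1.clm_apply (e2.clm_apply (by fun_prop)))
    refine ContDiffAt.clm_apply ?_ (e3.clm_apply (by fun_prop))
    refine ContDiffAt.comp (g := R) ((τ, α v τ), (0 : W)) ?_ e4
    simpa using hRat _ (hαm v hv τ)
  have hqder : ∀ τ ∈ Icc (0 : ℝ) 1, ∀ δ : W, fderiv ℝ q ((τ, α v τ), 0) (0, δ) =
      fderiv ℝ R (α v τ) (R (α v τ) (Θ (p₀ + τ • v) (τ • δ))) (Θ (p₀ + τ • v) v)
        + R (α v τ) (fderiv ℝ Θ (p₀ + τ • v) (τ • δ) v + Θ (p₀ + τ • v) δ) := by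
    intro τ hτ δ
    have d0 : HasDerivAt (fun s : ℝ ↦ (((τ, α v τ), s • δ) : (ℝ × E) × W)) (0, δ) 0 :=
      (hasDerivAt_const _ _).prodMk (by simpa using (hasDerivAt_id (0 : ℝ)).smul_const δ)
    have d1 : HasDerivAt (fun s : ℝ ↦ q ((τ, α v τ), s • δ))
        (fderiv ℝ q ((τ, α v τ), 0) (0, δ)) 0 := by
      refine HasFDerivAt.comp_hasDerivAt (l := q)
        (f := fun s : ℝ ↦ (((τ, α v τ), s • δ) : (ℝ × E) × W)) 0 ?_ d0
      simpa using ((hqat _ ⟨τ, hτ, rfl⟩).differentiableAt one_ne_zero).hasFDerivAt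
    have s0 : HasDerivAt (fun s : ℝ ↦ s • δ) δ 0 := by
      simpa using (hasDerivAt_id (0 : ℝ)).smul_const δ
    have s1 : HasDerivAt (fun s : ℝ ↦ α v τ + R (α v τ) (Θ (p₀ + τ • v) (τ • s • δ)))
        (R (α v τ) (Θ (p₀ + τ • v) (τ • δ))) 0 :=
      (((R (α v τ)).comp (Θ (p₀ + τ • v))).hasFDerivAt.comp_hasDerivAt 0
        (s0.const_smul τ)).const_add (α v τ)
    have s2 : HasDerivAt (fun s : ℝ ↦ R (α v τ + R (α v τ) (Θ (p₀ + τ • v) (τ • s • δ))))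
        (fderiv ℝ R (α v τ) (R (α v τ) (Θ (p₀ + τ • v) (τ • δ)))) 0 := by
      refine HasFDerivAt.comp_hasDerivAt (l := R) 0 ?_ s1
      simpa using ((hRat _ (hαm v hv τ)).differentiableAt one_ne_zero).hasFDerivAt
    have s3 : HasDerivAt (fun s : ℝ ↦ p₀ + τ • (v + s • δ)) (τ • δ) 0 :=
      ((s0.const_add v).const_smul τ).const_add p₀
    have s4 : HasDerivAt (fun s : ℝ ↦ Θ (p₀ + τ • (v + s • δ)))
        (fderiv ℝ Θ (p₀ + τ • v) (τ • δ)) 0 := by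
      refine HasFDerivAt.comp_hasDerivAt (l := Θ) 0 ?_ s3
      simpa using ((hΘat _ (hmem v hv τ hτ)).differentiableAt one_ne_zero).hasFDerivAt
    have s5 := s2.clm_apply (s4.clm_apply (s0.const_add v))
    have := d1.unique s5
    simpa using this
  -- A Lipschitz constant valid for the equations of all rays in the ball of radius `r`, hence
  -- independent of δ.
  set Kf : ℝ≥0 := K * (C' * r.toNNReal) with hKf
  set Gb : ℝ := gronwallBound 0 Kf 1 1 with hGb
  have hGb0 : 0 ≤ Gb := by
    have := gronwallBound_mono (δ := 0) (K := Kf) (ε := 1) le_rfl zero_le_one Kf.2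
      (zero_le_one (α := ℝ))
    simpa [gronwallBound_x0] using this
  refine hasFDerivAt_iff_isLittleO_nhds_zero.2 (Asymptotics.isLittleO_iff.2 fun c hc ↦ ?_)
  -- The final distance is at most ε·`Gb`·‖δ‖; the added 1 avoids a zero denominator.
  have hε : 0 < c / (Gb + 1) := by positivity
  have ev1 := hScpt.eventually_forall_norm_sub_fderiv_le hqat hε
  have ev2 : ∀ᶠ δ in 𝓝 (0 : W), v + δ ∈ ball (0 : W) r :=
    (Continuous.tendsto' (by fun_prop : Continuous fun δ : W ↦ v + δ) 0 v (by simp)).eventually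
      (isOpen_ball.mem_nhds hv)
  -- The correction term of ψ is then shorter than `a`, so ψ stays in the ball of radius 2a, on
  -- which `R` is Lipschitz.
  have ev3 : ∀ᶠ δ in 𝓝 (0 : W), C * (C' * ‖δ‖) < a :=
    (Continuous.tendsto' (by fun_prop : Continuous fun δ : W ↦ C * (C' * ‖δ‖)) 0 0
      (by simp)).eventually (gt_mem_nhds (by exact_mod_cast ha))
  filter_upwards [ev1, ev2, ev3] with δ h1 h2 h3
  -- The guess moves the trajectory of `v` by the increment that the system predicts for the
  -- displacement τδ of the base point. At τ = 1 it is the claimed linear approximation of the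
  -- endpoint.
  set ψ : ℝ → E := fun τ ↦ α v τ + R (α v τ) (Θ (p₀ + τ • v) (τ • δ)) with hψ
  have hψball : ∀ τ ∈ Icc (0 : ℝ) 1, ψ τ ∈ closedBall y₀ (2 * a) := by
    intro τ hτ
    have n1 : ‖R (α v τ) (Θ (p₀ + τ • v) (τ • δ))‖ ≤ a := by
      refine le_trans ?_ h3.le
      refine (R (α v τ)).le_of_opNorm_le_of_le (hC _ (hαm v hv τ)) ?_
      refine (Θ _).le_of_opNorm_le_of_le (hC' _ (hmem v hv τ hτ)) ?_
      rw [norm_smul, Real.norm_of_nonneg hτ.1]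
      exact mul_le_of_le_one_left (norm_nonneg _) hτ.2
    have n2 := mem_closedBall_iff_norm.1 (hαm v hv τ)
    rw [mem_closedBall_iff_norm]
    calc ‖ψ τ - y₀‖ = ‖(α v τ - y₀) + R (α v τ) (Θ (p₀ + τ • v) (τ • δ))‖ := by
          simp only [hψ]; congr 1; abel
      _ ≤ _ := (norm_add_le _ _).trans (by linarith)
  have hψc : ContinuousOn ψ (Icc 0 1) := by
    have i1 : ContinuousOn (fun τ ↦ R (α v τ)) (Icc 0 1) :=
      (hR.continuousOn.mono haO).comp (hαc v hv) fun τ _ ↦ hαm v hv τ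
    have i2 : ContinuousOn (fun τ : ℝ ↦ Θ (p₀ + τ • v)) (Icc 0 1) :=
      hΘ.continuousOn.comp (by fun_prop) (hmem v hv)
    exact (hαc v hv).add (i1.clm_apply (i2.clm_apply (by fun_prop)))
  set ψ' : ℝ → E := fun τ ↦ R (α v τ) (Θ (p₀ + τ • v) v)
    + (fderiv ℝ R (α v τ) (R (α v τ) (Θ (p₀ + τ • v) v)) (Θ (p₀ + τ • v) (τ • δ))
      + R (α v τ) (fderiv ℝ Θ (p₀ + τ • v) v (τ • δ) + Θ (p₀ + τ • v) δ)) with hψ'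
  have hψd : ∀ τ ∈ Ico (0 : ℝ) 1, HasDerivWithinAt ψ (ψ' τ) (Ici τ) τ := by
    intro τ hτ
    have j1 : HasDerivWithinAt (fun τ ↦ R (α v τ))
        (fderiv ℝ R (α v τ) (R (α v τ) (Θ (p₀ + τ • v) v))) (Ici τ) τ :=
      ((hRat _ (hαm v hv τ)).differentiableAt one_ne_zero).hasFDerivAt.comp_hasDerivWithinAt τ
        (hα v hv τ hτ)
    have j2 : HasDerivWithinAt (fun τ : ℝ ↦ Θ (p₀ + τ • v))
        (fderiv ℝ Θ (p₀ + τ • v) v) (Ici τ) τ :=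
      (HasFDerivAt.comp_hasDerivAt (f := fun τ : ℝ ↦ p₀ + τ • v) τ
        ((hΘat _ (hmem v hv τ (Ico_subset_Icc_self hτ))).differentiableAt one_ne_zero).hasFDerivAt
        (hline v τ)).hasDerivWithinAt
    have j3 : HasDerivWithinAt (fun τ : ℝ ↦ τ • δ) δ (Ici τ) τ := by
      simpa using ((hasDerivAt_id τ).smul_const δ).hasDerivWithinAt
    exact (hα v hv τ hτ).add (j1.clm_apply (j2.clm_apply j3))
  have hbound := dist_le_of_approx_trajectories_ODE_of_mem (a := 0) (b := 1) (K := Kf)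
    (v := fun τ y ↦ R y (Θ (p₀ + τ • (v + δ)) (v + δ))) (s := fun _ ↦ closedBall y₀ (2 * a))
    (εf := c / (Gb + 1) * ‖δ‖) (εg := 0) (δ := 0) ?_ hψc hψd ?_
    (fun τ hτ ↦ hψball τ (Ico_subset_Icc_self hτ)) (hαc _ h2) (hα _ h2) (by simp)
    (fun τ hτ ↦ closedBall_subset_closedBall (by linarith [a.2]) (hαm _ h2 τ))
    (by simp [hψ, hα₀ _ h2, hα₀ _ hv]) 1 (right_mem_Icc.2 zero_le_one)
  · rw [add_zero, sub_zero, gronwallBound_zero_mul, ← hGb, dist_comm, dist_eq_norm] at hbound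
    simp only [hψ, one_smul] at hbound
    rw [sub_add_eq_sub_sub] at hbound
    refine hbound.trans ?_
    rw [div_mul_eq_mul_div, div_mul_eq_mul_div, div_le_iff₀ (by positivity)]
    nlinarith [mul_nonneg hc.le (norm_nonneg δ)]
  · intro τ hτ
    refine LipschitzOnWith.of_dist_le_mul fun y hy z hz ↦ ?_
    rw [dist_eq_norm, ← sub_apply]
    refine (ContinuousLinearMap.le_opNorm _ _).trans ?_
    have n1 := hK.norm_sub_le hy hz
    have n2 := (Θ (p₀ + τ • (v + δ))).le_of_opNorm_le_of_le
      (hC' _ (hmem _ h2 τ (Ico_subset_Icc_self hτ))) (mem_ball_zero_iff.1 h2).le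
    have hr : 0 ≤ r := (norm_nonneg _).trans (mem_ball_zero_iff.1 h2).le
    rw [dist_eq_norm, hKf]
    push_cast
    rw [Real.coe_toNNReal r hr]
    calc _ ≤ (K * ‖y - z‖) * (C' * r) := by gcongr
      _ = _ := by ring
  · intro τ hτ
    have m1 := h1 _ ⟨τ, Ico_subset_Icc_self hτ, rfl⟩
    rw [hqder τ (Ico_subset_Icc_self hτ) δ] at m1
    -- The derivative of ψ and the linear part of `q` differ exactly by the integrability expression
    -- for `v` and τδ. Hence the defect of ψ is the Taylor remainder of `q`.
    have m2 := hinv τ hτ (τ • δ)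
    rw [dist_comm, dist_eq_norm]
    refine le_of_eq_of_le ?_ m1
    congr 1
    simp only [hq, hψ, hψ', smul_zero, map_zero, add_zero]
    rw [sub_sub]
    congr 2
    rw [← sub_eq_zero, ← m2]
    simp only [map_add, map_sub]
    abel

/-- Local solvability of `dφ = R(φ) ∘ Θ`, when the integrability condition is only assumed where
the first integral `t` has the prescribed value `h`. -/
theorem exists_hasFDerivAt_comp [CompleteSpace E] {R : E → F →L[ℝ] E} {Θ : W → W →L[ℝ] F}
    {t : E → Y} {h : W → Y} {ρ : Y → F →L[ℝ] Y} {O : Set E} {B : Set W} {p₀ : W} {y₀ : E}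
    (hO : IsOpen O) (hB : IsOpen B) (hy : y₀ ∈ O) (hp : p₀ ∈ B)
    (hR : ContDiffOn ℝ 1 R O) (hΘ : ContDiffOn ℝ 1 Θ B) (hρ : ContDiffAt ℝ 1 ρ (t y₀))
    (ht : ∀ y ∈ O, ∃ t' : E →L[ℝ] Y, HasFDerivAt t t' y ∧ ∀ f, t' (R y f) = ρ (t y) f)
    (hh : ∀ p ∈ B, HasFDerivAt h ((ρ (h p)).comp (Θ p)) p) (h₀ : h p₀ = t y₀)
    (hinv : ∀ p ∈ B, ∀ y ∈ O, t y = h p → ∀ v w,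
      fderiv ℝ R y (R y (Θ p v)) (Θ p w) - fderiv ℝ R y (R y (Θ p w)) (Θ p v)
        + R y (fderiv ℝ Θ p v w - fderiv ℝ Θ p w v) = 0) :
    ∃ U : Set W, IsOpen U ∧ p₀ ∈ U ∧ U ⊆ B ∧ ∃ φ : W → E, φ p₀ = y₀ ∧
      ∀ p ∈ U, φ p ∈ O ∧ t (φ p) = h p ∧ HasFDerivAt φ ((R (φ p)).comp (Θ p)) p := by
  obtain ⟨K, T, hT, hK⟩ := (hR.contDiffAt (hO.mem_nhds hy)).exists_lipschitzOnWith
  obtain ⟨Kρ, N, hN, hKρ⟩ := hρ.exists_lipschitzOnWith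
  have n1 : ∀ᶠ y in 𝓝 y₀, ‖R y‖ < ‖R y₀‖ + 1 :=
    (hR.contDiffAt (hO.mem_nhds hy)).continuousAt.norm.eventually (gt_mem_nhds (lt_add_one _))
  have n2 : ∀ᶠ p in 𝓝 p₀, ‖Θ p‖ < ‖Θ p₀‖ + 1 :=
    (hΘ.contDiffAt (hB.mem_nhds hp)).continuousAt.norm.eventually (gt_mem_nhds (lt_add_one _))
  have n3 : t ⁻¹' N ∈ 𝓝 y₀ := by
    obtain ⟨t', ht', -⟩ := ht y₀ hy
    exact ht'.continuousAt.preimage_mem_nhds hN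
  have n4 : h ⁻¹' N ∈ 𝓝 p₀ := (hh p₀ hp).continuousAt.preimage_mem_nhds (h₀ ▸ hN)
  obtain ⟨b, hb, hball⟩ := Metric.mem_nhds_iff.1 (Filter.inter_mem (Filter.inter_mem
    (hO.mem_nhds hy) hT) (Filter.inter_mem n3 n1))
  obtain ⟨r₁, hr₁, hball₁⟩ := Metric.mem_nhds_iff.1 (Filter.inter_mem (hB.mem_nhds hp)
    (Filter.inter_mem n4 n2))
  -- A third of `b`, so that the closed ball of radius 2a lies in the open ball of radius `b`.
  set a : ℝ≥0 := ⟨b / 3, by positivity⟩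
  have ha : 0 < a := NNReal.coe_pos.1 (show (0 : ℝ) < b / 3 by positivity)
  have hav : (a : ℝ) = b / 3 := rfl
  set C : ℝ≥0 := ‖R y₀‖₊ + 1
  set C' : ℝ≥0 := ‖Θ p₀‖₊ + 1
  -- The bound a/(C·C') makes every ray of length less than `r` admissible for
  -- `exists_ray_trajectory`.
  set r : ℝ := min r₁ (a / (C * C')) with hr
  have hCC : (0 : ℝ) < C * C' := by positivity
  have hr0 : 0 < r := lt_min hr₁ (by positivity)
  have s1 : closedBall y₀ (2 * a) ⊆ ball y₀ b := closedBall_subset_ball (by rw [hav]; linarith)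
  have s2 : closedBall y₀ (a : ℝ) ⊆ ball y₀ b := closedBall_subset_ball (by rw [hav]; linarith)
  have s3 : ball p₀ r ⊆ ball p₀ r₁ := ball_subset_ball (min_le_left _ _)
  have hmem : ∀ w ∈ ball (0 : W) r, ∀ τ ∈ Icc (0 : ℝ) 1, p₀ + τ • w ∈ ball p₀ r := by
    intro w hw τ hτ
    have h1 : ‖w‖ < r := by simpa using hw
    have : ‖τ • w‖ < r := by
      rw [norm_smul, Real.norm_of_nonneg hτ.1]
      nlinarith [norm_nonneg w, hτ.2, hτ.1]
    simpa [dist_eq_norm] using this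
  have hC : ∀ y ∈ closedBall y₀ a, ‖R y‖ ≤ C := fun y hy ↦ (hball (s2 hy)).2.2.le
  have hC' : ∀ p ∈ ball p₀ r, ‖Θ p‖ ≤ C' := fun p hp ↦ (hball₁ (s3 hp)).2.2.le
  have hBr : ball p₀ r ⊆ B := fun p hp ↦ (hball₁ (s3 hp)).1
  have hray : ∀ v ∈ ball (0 : W) r, _ := fun v hv ↦
    exists_ray_trajectory (t := t) (h := h) (p₀ := p₀) (v := v) (y₀ := y₀) (a := a)
      (hK.mono fun y hy ↦ (hball (s2 hy)).1.2) hC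
      (fun τ hτ ↦ (hΘ.contDiffAt (hB.mem_nhds (hBr (hmem v hv τ hτ)))).continuousAt)
      (fun τ hτ ↦ hC' _ (hmem v hv τ hτ)) (by
        have : ‖v‖ ≤ a / (C * C') := (mem_ball_zero_iff.1 hv).le.trans (min_le_right _ _)
        rw [le_div_iff₀ hCC] at this
        linarith) hKρ
      (fun y hy ↦ ⟨(hball (s2 hy)).2.1, ht y (hball (s2 hy)).1.1⟩)
      (fun τ hτ ↦ ⟨(hball₁ (s3 (hmem v hv τ hτ))).2.1, hh _ (hBr (hmem v hv τ hτ))⟩) h₀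
  choose! α hα₀ hαm hαc hα hαt using hray
  have hsub : ∀ p ∈ ball p₀ r, p - p₀ ∈ ball (0 : W) r := fun p hp ↦ by
    simpa [dist_eq_norm] using hp
  refine ⟨ball p₀ r, isOpen_ball, mem_ball_self hr0, hBr, fun p ↦ α (p - p₀) 1, ?_, fun p hp ↦
    ⟨(hball (s2 (hαm _ (hsub p hp) 1))).1.1, ?_, ?_⟩⟩
  · have hz : (0 : W) ∈ ball (0 : W) r := mem_ball_self hr0
    have := constant_of_has_deriv_right_zero (hαc 0 hz)
      (fun τ hτ ↦ by simpa using hα 0 hz τ hτ) 1 (right_mem_Icc.2 zero_le_one)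
    simpa [hα₀ 0 hz] using this
  · simpa using hαt _ (hsub p hp) 1 (right_mem_Icc.2 zero_le_one)
  -- The restricted integrability hypothesis suffices, since `hαt` says that ray trajectories stay
  -- on the locus t = h.
  · have := hasFDerivAt_ray_endpoint (R := R) (Θ := Θ) (p₀ := p₀) (v := p - p₀) (α := α) ha
      (hK.mono fun y hy ↦ (hball (s1 hy)).1.2) hO (fun y hy ↦ (hball (s2 hy)).1.1) hR hC
      (hΘ.mono hBr) hC' (hsub p hp) hα₀ hαm hαc hα fun τ hτ w ↦
        hinv _ (hBr (hmem _ (hsub p hp) τ (Ico_subset_Icc_self hτ))) _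
          (hball (s2 (hαm _ (hsub p hp) τ))).1.1
          (hαt _ (hsub p hp) τ (Ico_subset_Icc_self hτ)) _ w
    rw [add_sub_cancel] at this
    have h2 := this.comp p ((hasFDerivAt_id p).sub_const p₀)
    exact h2

end LocalSystem

/-! ### Manifold derivatives as linear maps between model spaces, and velocities of curves -/

section ModelDeriv

variable {E E' E'' : Type*} [NormedAddCommGroup E] [NormedSpace ℝ E]
    [NormedAddCommGroup E'] [NormedSpace ℝ E'] [NormedAddCommGroup E''] [NormedSpace ℝ E'']
    {M : Type*} [TopologicalSpace M] [ChartedSpace E M]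
    {M' : Type*} [TopologicalSpace M'] [ChartedSpace E' M']
    {M'' : Type*} [TopologicalSpace M''] [ChartedSpace E'' M'']

/-- `HasMFDerivAt` for a boundaryless model, with the derivative as a linear map between the model
spaces, to which the tangent spaces are definitionally equal. -/
def HasModelDerivAt (f : M → M') (x : M) (L : E →L[ℝ] E') : Prop :=
  HasMFDerivAt 𝓘(ℝ, E) 𝓘(ℝ, E') f x L

variable (E E') in
/-- `mfderiv` for a boundaryless model, as a linear map between the model spaces. -/
def modelDeriv (f : M → M') (x : M) : E →L[ℝ] E' :=
  mfderiv 𝓘(ℝ, E) 𝓘(ℝ, E') f x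

theorem HasModelDerivAt.modelDeriv {f : M → M'} {x : M} {L : E →L[ℝ] E'}
    (h : HasModelDerivAt f x L) : modelDeriv E E' f x = L :=
  HasMFDerivAt.mfderiv h

theorem MDifferentiableAt.hasModelDerivAt {f : M → M'} {x : M}
    (h : MDifferentiableAt 𝓘(ℝ, E) 𝓘(ℝ, E') f x) :
    HasModelDerivAt f x (_root_.modelDeriv E E' f x) :=
  h.hasMFDerivAt

theorem ContMDiffAt.hasModelDerivAt {f : M → M'} {x : M}
    (h : ContMDiffAt 𝓘(ℝ, E) 𝓘(ℝ, E') ∞ f x) :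
    HasModelDerivAt f x (_root_.modelDeriv E E' f x) :=
  (h.mdifferentiableAt (by simp)).hasModelDerivAt

namespace HasModelDerivAt

theorem mdifferentiableAt {f : M → M'} {x : M} {L : E →L[ℝ] E'}
    (h : HasModelDerivAt f x L) : MDifferentiableAt 𝓘(ℝ, E) 𝓘(ℝ, E') f x :=
  HasMFDerivAt.mdifferentiableAt h

theorem continuousAt {f : M → M'} {x : M} {L : E →L[ℝ] E'}
    (h : HasModelDerivAt f x L) : ContinuousAt f x :=
  HasMFDerivAt.continuousAt h

theorem congr_deriv {f : M → M'} {x : M} {L L' : E →L[ℝ] E'}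
    (h : HasModelDerivAt f x L) (hL : L = L') : HasModelDerivAt f x L' :=
  hL ▸ h

theorem unique {f : M → M'} {x : M} {L L' : E →L[ℝ] E'}
    (h : HasModelDerivAt f x L) (h' : HasModelDerivAt f x L') : L = L' :=
  hasMFDerivAt_unique h h'

theorem congr_of_eventuallyEq {f g : M → M'} {x : M} {L : E →L[ℝ] E'}
    (h : HasModelDerivAt f x L) (hfg : g =ᶠ[𝓝 x] f) : HasModelDerivAt g x L :=
  HasMFDerivAt.congr_of_eventuallyEq h hfg

theorem comp {g : M' → M''} {f : M → M'} {x : M} {y : M'} {L : E →L[ℝ] E'} {L' : E' →L[ℝ] E''}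
    (hg : HasModelDerivAt g y L') (hf : HasModelDerivAt f x L) (hy : f x = y) :
    HasModelDerivAt (fun x ↦ g (f x)) x (L'.comp L) := by
  subst hy
  exact HasMFDerivAt.comp x hg hf

end HasModelDerivAt

theorem hasModelDerivAt_id (x : M) : HasModelDerivAt (fun x : M ↦ x) x (.id ℝ E) :=
  hasMFDerivAt_id x

theorem hasModelDerivAt_const (y : M') (x : M) :
    HasModelDerivAt (fun _ : M ↦ y) x (0 : E →L[ℝ] E') :=
  hasMFDerivAt_const y x

theorem hasModelDerivAt_iff_hasFDerivAt {f : E → E'} {x : E} {L : E →L[ℝ] E'} :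
    HasModelDerivAt f x L ↔ HasFDerivAt f L x :=
  hasMFDerivAt_iff_hasFDerivAt

/-- The velocity of a curve: `HasDerivAt` for curves in a manifold. -/
def HasVelocityAt (c : ℝ → M) (ξ : E) : Prop :=
  HasModelDerivAt c 0 (ContinuousLinearMap.toSpanSingleton ℝ ξ)

namespace HasVelocityAt

theorem map {f : M → M'} {c : ℝ → M} {y : M} {ξ : E} {L : E →L[ℝ] E'}
    (hc : HasVelocityAt c ξ) (hf : HasModelDerivAt f y L) (hy : c 0 = y) :
    HasVelocityAt (fun ε ↦ f (c ε)) (L ξ) :=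
  (hf.comp hc hy).congr_deriv (by ext; simp)

theorem unique {c : ℝ → M} {ξ ξ' : E} (h : HasVelocityAt c ξ) (h' : HasVelocityAt c ξ') :
    ξ = ξ' := by
  simpa using DFunLike.congr_fun (HasModelDerivAt.unique h h') 1

theorem congr {c c' : ℝ → M} {ξ : E} (h : HasVelocityAt c ξ) (hc : c' =ᶠ[𝓝 0] c) :
    HasVelocityAt c' ξ :=
  h.congr_of_eventuallyEq hc

end HasVelocityAt

theorem hasVelocityAt_const (y : M) : HasVelocityAt (fun _ ↦ y) (0 : E) :=
  (hasModelDerivAt_const y (0 : ℝ)).congr_deriv (by ext; simp)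

theorem hasVelocityAt_iff_hasDerivAt {c : ℝ → E} {ξ : E} :
    HasVelocityAt c ξ ↔ HasDerivAt c ξ 0 :=
  hasModelDerivAt_iff_hasFDerivAt

end ModelDeriv

/-! ### Retractions onto the fibres of a submersion; derivatives of charts -/

section Submersion

/-- A submersion between vector spaces has, near each point, a smooth retraction onto its fibres,
with the fibre as a parameter. -/
theorem ContDiffAt.exists_fiber_retraction {E E' : Type*} [NormedAddCommGroup E] [NormedSpace ℝ E]
    [FiniteDimensional ℝ E] [NormedAddCommGroup E'] [NormedSpace ℝ E'] [FiniteDimensional ℝ E']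
    {s : E → E'} {y₀ : E} (hs : ContDiffAt ℝ ∞ s y₀)
    (hsurj : Function.Surjective (fderiv ℝ s y₀)) :
    ∃ K : E' × E → E, ContDiffAt ℝ ∞ K (s y₀, y₀) ∧ (∀ᶠ y in 𝓝 y₀, K (s y, y) = y) ∧
      ∀ᶠ z in 𝓝 (s y₀, y₀), s (K z) = z.1 := by
  have : CompleteSpace E := FiniteDimensional.complete ℝ E
  have : CompleteSpace E' := FiniteDimensional.complete ℝ E'
  obtain ⟨J₀, hJ₀⟩ := (fderiv ℝ s y₀ : E →ₗ[ℝ] E').exists_rightInverse_of_surjective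
    (LinearMap.range_eq_top.2 hsurj)
  set J : E' →L[ℝ] E := J₀.toContinuousLinearMap
  have hJ : ∀ z, fderiv ℝ s y₀ (J z) = z := fun z ↦ LinearMap.congr_fun hJ₀ z
  -- Starting at `y`, the fibre over `x` is reached by moving along the range of a right inverse `J`
  -- of ds, that is, by solving s(y + Jz) = x for `z`. At the base point the derivative in `z` is
  -- the identity.
  set f : (E' × E) × E' → E' := fun w ↦ s (w.1.2 + J w.2) - w.1.1 with hf
  have hfc : ContDiffAt ℝ ∞ f ((s y₀, y₀), 0) := by
    refine ContDiffAt.sub ?_ (by fun_prop)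
    refine ContDiffAt.comp (g := s) ((s y₀, y₀), (0 : E')) (by simpa using hs) (by fun_prop)
  have hf0 : f ((s y₀, y₀), 0) = 0 := by simp [hf]
  have hder : fderiv ℝ f ((s y₀, y₀), 0) ∘L .inr ℝ (E' × E) E' = ContinuousLinearMap.id ℝ E' := by
    have h1 : HasFDerivAt (fun z : E' ↦ f ((s y₀, y₀), z))
        (fderiv ℝ f ((s y₀, y₀), 0) ∘L .inr ℝ (E' × E) E') 0 :=
      HasFDerivAt.comp (g := f) (0 : E') (hfc.differentiableAt (by simp)).hasFDerivAt
        (hasFDerivAt_prodMk_right _ _)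
    have h2 : HasFDerivAt (fun z : E' ↦ s (y₀ + J z) - s y₀) (fderiv ℝ s y₀ ∘L J) 0 := by
      refine HasFDerivAt.sub_const _ (HasFDerivAt.comp (g := s) (0 : E') ?_
        (J.hasFDerivAt.const_add y₀))
      simpa using (hs.differentiableAt (by simp)).hasFDerivAt
    rw [h1.unique h2]
    ext z
    exact hJ z
  have hinv : (fderiv ℝ f ((s y₀, y₀), 0) ∘L .inr ℝ (E' × E) E').IsInvertible := by
    rw [hder]
    exact ⟨.refl ℝ E', rfl⟩
  set ψ := hfc.implicitFunction (by simp) hinv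
  have hψ0 : ψ (s y₀, y₀) = 0 := hfc.implicitFunction_apply_self (by simp) hinv
  have hψc : ContDiffAt ℝ ∞ ψ (s y₀, y₀) := hfc.contDiffAt_implicitFunction (by simp) hinv
  have hψ1 := hfc.eventually_apply_implicitFunction (by simp) hinv
  have hψ2 := hfc.eventually_apply_eq_iff_implicitFunction (by simp) hinv
  refine ⟨fun w ↦ w.2 + J (ψ w), ?_, ?_, ?_⟩
  · exact contDiffAt_snd.add (J.contDiff.contDiffAt.comp _ hψc)
  · have ht : Filter.Tendsto (fun y ↦ ((s y, y), (0 : E'))) (𝓝 y₀) (𝓝 ((s y₀, y₀), 0)) :=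
      (hs.continuousAt.prodMk continuousAt_id).prodMk continuousAt_const
    filter_upwards [ht.eventually hψ2] with y hy
    -- For x = s(y) the value z = 0 is a solution, and the implicit function theorem gives local
    -- uniqueness.
    have : ψ (s y, y) = 0 := hy.1 (by rw [hf0]; simp [hf])
    simp [this]
  · filter_upwards [hψ1] with z hz
    rw [hf0] at hz
    exact sub_eq_zero.1 hz

variable {E E' : Type*} [NormedAddCommGroup E] [NormedSpace ℝ E]
    [NormedAddCommGroup E'] [NormedSpace ℝ E']
    {G : Type*} [TopologicalSpace G] [ChartedSpace E G]
    {X : Type*} [TopologicalSpace X] [ChartedSpace E' X]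

/-- The expression of a smooth map in charts, at points of the chart domains. -/
theorem ContMDiffAt.contDiffAt_extChartAt_comp_symm [IsManifold 𝓘(ℝ, E) ∞ G]
    [IsManifold 𝓘(ℝ, E') ∞ X] {s : G → X} {u g : G} {x : X}
    (hg : g ∈ (extChartAt 𝓘(ℝ, E) u).source)
    (hx : s g ∈ (extChartAt 𝓘(ℝ, E') x).source) (hs : ContMDiffAt 𝓘(ℝ, E) 𝓘(ℝ, E') ∞ s g) :
    ContDiffAt ℝ ∞ (fun y ↦ extChartAt 𝓘(ℝ, E') x (s ((extChartAt 𝓘(ℝ, E) u).symm y)))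
      (extChartAt 𝓘(ℝ, E) u g) := by
  rw [← contMDiffAt_iff_contDiffAt]
  have h1 : ContMDiffAt 𝓘(ℝ, E) 𝓘(ℝ, E) ∞ (extChartAt 𝓘(ℝ, E) u).symm
      (extChartAt 𝓘(ℝ, E) u g) :=
    (contMDiffOn_extChartAt_symm u).contMDiffAt
      ((isOpen_extChartAt_target u).mem_nhds ((extChartAt 𝓘(ℝ, E) u).map_source hg))
  have h2 : (extChartAt 𝓘(ℝ, E) u).symm (extChartAt 𝓘(ℝ, E) u g) = g :=
    (extChartAt 𝓘(ℝ, E) u).left_inv hg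
  have h3 : ContMDiffAt 𝓘(ℝ, E') 𝓘(ℝ, E') ∞ (extChartAt 𝓘(ℝ, E') x) (s g) :=
    contMDiffAt_extChartAt' (by simpa using hx)
  have h4 : ContMDiffAt 𝓘(ℝ, E) 𝓘(ℝ, E') ∞ (fun y ↦ s ((extChartAt 𝓘(ℝ, E) u).symm y))
      (extChartAt 𝓘(ℝ, E) u g) :=
    ContMDiffAt.comp_of_eq (g := s) hs h1 h2
  exact ContMDiffAt.comp_of_eq (g := extChartAt 𝓘(ℝ, E') x) h3 h4 (by rw [h2])

theorem contMDiffAt_extChartAt_symm [IsManifold 𝓘(ℝ, E) ∞ G] {u : G} {y : E}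
    (hy : y ∈ (extChartAt 𝓘(ℝ, E) u).target) :
    ContMDiffAt 𝓘(ℝ, E) 𝓘(ℝ, E) ∞ (extChartAt 𝓘(ℝ, E) u).symm y :=
  (contMDiffOn_extChartAt_symm u).contMDiffAt ((isOpen_extChartAt_target u).mem_nhds hy)

/-- The chart at `u`, as a differentiable map at `g`. -/
theorem hasModelDerivAt_extChartAt [IsManifold 𝓘(ℝ, E) ∞ G] {u g : G}
    (hg : g ∈ (extChartAt 𝓘(ℝ, E) u).source) :
    HasModelDerivAt (extChartAt 𝓘(ℝ, E) u) g (modelDeriv E E (extChartAt 𝓘(ℝ, E) u) g) :=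
  ContMDiffAt.hasModelDerivAt (contMDiffAt_extChartAt' (by simpa using hg))

theorem hasModelDerivAt_extChartAt_symm [IsManifold 𝓘(ℝ, E) ∞ G] {u : G} {y : E}
    (hy : y ∈ (extChartAt 𝓘(ℝ, E) u).target) :
    HasModelDerivAt (extChartAt 𝓘(ℝ, E) u).symm y (modelDeriv E E (extChartAt 𝓘(ℝ, E) u).symm y) :=
  (contMDiffAt_extChartAt_symm hy).hasModelDerivAt

theorem modelDeriv_extChartAt_comp_symm [IsManifold 𝓘(ℝ, E) ∞ G] {u : G} {y : E}
    (hy : y ∈ (extChartAt 𝓘(ℝ, E) u).target) :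
    (modelDeriv E E (extChartAt 𝓘(ℝ, E) u) ((extChartAt 𝓘(ℝ, E) u).symm y)).comp
      (modelDeriv E E (extChartAt 𝓘(ℝ, E) u).symm y) = .id ℝ E := by
  set κ := extChartAt 𝓘(ℝ, E) u
  have h1 := (hasModelDerivAt_extChartAt (κ.map_target hy)).comp
    (hasModelDerivAt_extChartAt_symm hy) rfl
  refine h1.unique ((hasModelDerivAt_id y).congr_of_eventuallyEq ?_)
  filter_upwards [(isOpen_extChartAt_target u).mem_nhds hy] with z hz using κ.right_inv hz

theorem modelDeriv_symm_comp_extChartAt [IsManifold 𝓘(ℝ, E) ∞ G] {u g : G}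
    (hg : g ∈ (extChartAt 𝓘(ℝ, E) u).source) :
    (modelDeriv E E (extChartAt 𝓘(ℝ, E) u).symm (extChartAt 𝓘(ℝ, E) u g)).comp
      (modelDeriv E E (extChartAt 𝓘(ℝ, E) u) g) = .id ℝ E := by
  set κ := extChartAt 𝓘(ℝ, E) u
  have h1 := (hasModelDerivAt_extChartAt_symm (κ.map_source hg)).comp
    (hasModelDerivAt_extChartAt hg) rfl
  refine h1.unique ((hasModelDerivAt_id g).congr_of_eventuallyEq ?_)
  filter_upwards [(isOpen_extChartAt_source u).mem_nhds hg] with z hz using κ.left_inv hz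

/-- A submersion has, near each point, a smooth retraction onto its fibres, with the fibre as a
parameter. -/
theorem ContMDiff.exists_fiber_retraction [FiniteDimensional ℝ E] [FiniteDimensional ℝ E']
    [IsManifold 𝓘(ℝ, E) ∞ G] [IsManifold 𝓘(ℝ, E') ∞ X] {s : G → X}
    (hs : ContMDiff 𝓘(ℝ, E) 𝓘(ℝ, E') ∞ s) (u : G)
    (hsurj : Function.Surjective (mfderiv 𝓘(ℝ, E) 𝓘(ℝ, E') s u)) :
    ∃ K : X × G → G, ContMDiffAt (𝓘(ℝ, E').prod 𝓘(ℝ, E)) 𝓘(ℝ, E) ∞ K (s u, u) ∧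
      (∀ᶠ g in 𝓝 u, K (s g, g) = g) ∧ ∀ᶠ z in 𝓝 (s u, u), s (K z) = z.1 := by
  set κ := extChartAt 𝓘(ℝ, E) u with hκ
  set χ := extChartAt 𝓘(ℝ, E') (s u) with hχ
  have hu : κ.symm (κ u) = u := κ.left_inv (mem_extChartAt_source u)
  have hc : ContDiffAt ℝ ∞ (fun y ↦ χ (s (κ.symm y))) (κ u) :=
    (hs u).contDiffAt_extChartAt_comp_symm (mem_extChartAt_source u) (mem_extChartAt_source _)
  have hsurj' : Function.Surjective (fderiv ℝ (fun y ↦ χ (s (κ.symm y))) (κ u)) := by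
    have := (hs u).mdifferentiableAt (by simp)
    have h2 := this.mfderiv
    rw [modelWithCornersSelf_coe, range_id, fderivWithin_univ] at h2
    rw [h2] at hsurj
    exact hsurj
  obtain ⟨K, hK, hK1, hK2⟩ := hc.exists_fiber_retraction hsurj'
  simp only [hu] at hK hK2
  have hcont : Filter.Tendsto (fun z : X × G ↦ (χ z.1, κ z.2)) (𝓝 (s u, u)) (𝓝 (χ (s u), κ u)) :=
    (ContinuousAt.comp (x := (s u, u)) (f := Prod.fst) (continuousAt_extChartAt (s u))
      continuousAt_fst).prodMk
      (ContinuousAt.comp (x := (s u, u)) (f := Prod.snd)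
      (continuousAt_extChartAt u) continuousAt_snd)
  have hK0 : K (χ (s u), κ u) = κ u := by simpa [hu] using hK1.self_of_nhds
  have hKc : Filter.Tendsto (fun z : X × G ↦ K (χ z.1, κ z.2)) (𝓝 (s u, u)) (𝓝 (κ u)) := by
    have := hK.continuousAt.tendsto.comp hcont
    rwa [hK0] at this
  have hGc : Filter.Tendsto (fun z : X × G ↦ κ.symm (K (χ z.1, κ z.2))) (𝓝 (s u, u)) (𝓝 u) := by
    have := (continuousAt_extChartAt_symm (I := 𝓘(ℝ, E)) u).tendsto.comp hKc
    rwa [extChartAt_to_inv] at this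
  refine ⟨fun z ↦ κ.symm (K (χ z.1, κ z.2)), ?_, ?_, ?_⟩
  · have m1 : ContMDiffAt (𝓘(ℝ, E').prod 𝓘(ℝ, E)) 𝓘(ℝ, E' × E) ∞
        (fun z : X × G ↦ (χ z.1, κ z.2)) (s u, u) := by
      refine ContMDiffAt.prodMk_space ?_ ?_
      · exact ContMDiffAt.comp (g := χ) (s u, u) contMDiffAt_extChartAt contMDiffAt_fst
      · exact ContMDiffAt.comp (g := κ) (s u, u) contMDiffAt_extChartAt contMDiffAt_snd
    have m2 := ContMDiffAt.comp (g := K) (s u, u) (contMDiffAt_iff_contDiffAt.2 hK) m1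
    refine ContMDiffAt.comp_of_eq (g := κ.symm) (contMDiffAt_extChartAt_symm ?_) m2 hK0
    exact mem_extChartAt_target u
  · have := (continuousAt_extChartAt (I := 𝓘(ℝ, E)) u).tendsto.eventually hK1
    filter_upwards [this, extChartAt_source_mem_nhds (I := 𝓘(ℝ, E)) u] with g hg hgs
    rw [κ.left_inv hgs] at hg
    rw [hg, κ.left_inv hgs]
  · have e1 := hcont.eventually hK2
    have e2 := hGc.eventually ((hs u).continuousAt.preimage_mem_nhds
      (extChartAt_source_mem_nhds (I := 𝓘(ℝ, E')) (s u)))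
    have e3 := continuousAt_fst.preimage_mem_nhds (x := (s u, u))
      (extChartAt_source_mem_nhds (I := 𝓘(ℝ, E')) (s u))
    filter_upwards [e1, e2, e3] with z h1 h2 h3
    exact χ.injOn h2 h3 h1

end Submersion
/-- The trivialization of the tangent bundle at `u` is the derivative of the chart at `u`. -/
theorem snd_trivializationAt_tangentSpace {E : Type*} [NormedAddCommGroup E] [NormedSpace ℝ E]
    {G : Type*} [TopologicalSpace G] [ChartedSpace E G] [IsManifold 𝓘(ℝ, E) 1 G] {u g : G}
    (hg : g ∈ (extChartAt 𝓘(ℝ, E) u).source) (ξ : TangentSpace 𝓘(ℝ, E) g) :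
    (trivializationAt E (TangentSpace 𝓘(ℝ, E)) u ⟨g, ξ⟩).2 =
      modelDeriv E E (extChartAt 𝓘(ℝ, E) u) g ξ := by
  have hg' : g ∈ (chartAt E u).source := by
    rw [← extChartAt_source (I := 𝓘(ℝ, E))]
    exact hg
  have h2 := TangentBundle.continuousLinearMapAt_trivializationAt (I := 𝓘(ℝ, E)) hg'
  have h3 := DFunLike.congr_fun h2 ξ
  rw [Trivialization.continuousLinearMapAt_apply, Trivialization.linearMapAt_apply,
    if_pos (by simpa using hg')] at h3
  exact h3

/-! ### Curves in the fibres of a submersion -/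

section CurvesInFibers

variable {E E' : Type*} [NormedAddCommGroup E] [NormedSpace ℝ E]
    [NormedAddCommGroup E'] [NormedSpace ℝ E']
    {G : Type*} [TopologicalSpace G] [ChartedSpace E G] [IsManifold 𝓘(ℝ, E) ∞ G]
    {X : Type*} [TopologicalSpace X] [ChartedSpace E' X] [IsManifold 𝓘(ℝ, E') ∞ X]

/-- The curve through `u` which is straight in the chart at `g₀`, with velocity `ξ`. -/
theorem hasVelocityAt_straight_curve {g₀ u : G} (hu : u ∈ (extChartAt 𝓘(ℝ, E) g₀).source) (ξ : E) :
    HasVelocityAt (fun ε : ℝ ↦ (extChartAt 𝓘(ℝ, E) g₀).symm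
      (extChartAt 𝓘(ℝ, E) g₀ u + ε • modelDeriv E E (extChartAt 𝓘(ℝ, E) g₀) u ξ)) ξ := by
  set κ := extChartAt 𝓘(ℝ, E) g₀
  set b : E := modelDeriv E E κ u ξ with hb
  have h1 : HasVelocityAt (fun ε : ℝ ↦ κ u + ε • b) b := by
    rw [hasVelocityAt_iff_hasDerivAt]
    simpa using ((hasDerivAt_id (0 : ℝ)).smul_const b).const_add (κ u)
  have h2 := h1.map (hasModelDerivAt_extChartAt_symm (κ.map_source hu)) (by simp)
  have h3 := DFunLike.congr_fun (modelDeriv_symm_comp_extChartAt hu) ξ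
  rw [ContinuousLinearMap.comp_apply] at h3
  rw [h3] at h2
  exact h2

/-- A fibre retraction turns a curve into a curve in the fibre, with the same velocity if this is
tangent to the fibre. -/
theorem hasVelocityAt_fiber_retraction {s : G → X} {K : X × G → G} {u : G}
    (hs : MDifferentiableAt 𝓘(ℝ, E) 𝓘(ℝ, E') s u)
    (hK : MDifferentiableAt (𝓘(ℝ, E').prod 𝓘(ℝ, E)) 𝓘(ℝ, E) K (s u, u))
    (hK1 : ∀ᶠ g in 𝓝 u, K (s g, g) = g) {c : ℝ → G} {ξ : E} (hc0 : c 0 = u)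
    (hc : HasVelocityAt c ξ) (hξ : modelDeriv E E' s u ξ = 0) :
    HasVelocityAt (fun ε ↦ K (s u, c ε)) ξ := by
  subst hc0
  obtain ⟨K', hK'⟩ : ∃ K' : E' × E →L[ℝ] E,
      HasMFDerivAt (𝓘(ℝ, E').prod 𝓘(ℝ, E)) 𝓘(ℝ, E) K (s (c 0), c 0) K' := ⟨_, hK.hasMFDerivAt⟩
  have h1 : HasModelDerivAt (fun g ↦ K (s g, g)) (c 0) (K'.comp
      ((modelDeriv E E' s (c 0)).prod (.id ℝ E))) :=
    HasMFDerivAt.comp (f := fun g ↦ (s g, g)) (c 0) hK'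
      (hs.hasMFDerivAt.prodMk (hasMFDerivAt_id (c 0)))
  have h2 : HasModelDerivAt (fun g ↦ K (s g, g)) (c 0) (.id ℝ E) :=
    (hasModelDerivAt_id (c 0)).congr_of_eventuallyEq hK1
  -- Differentiating K(s(g), g) = g gives ∂₁K ∘ ds + ∂₂K = id, so ∂₂K fixes the vectors in ker ds.
  have h4 := DFunLike.congr_fun (h1.unique h2) ξ
  have h5 : HasModelDerivAt (fun ε : ℝ ↦ K (s (c 0), c ε)) 0
      (K'.comp ((0 : ℝ →L[ℝ] E').prod (ContinuousLinearMap.toSpanSingleton ℝ ξ))) :=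
    HasMFDerivAt.comp (f := fun ε : ℝ ↦ (s (c 0), c ε)) (0 : ℝ) hK'
      ((hasMFDerivAt_const (s (c 0)) (0 : ℝ)).prodMk hc)
  refine h5.congr_deriv ?_
  ext
  simpa [hξ] using h4

end CurvesInFibers

/-! ### Right translations, right invariant fields and the Maurer–Cartan form in the model space -/

namespace LieGroupoid

variable {EX EG EN F : Type*}
  [NormedAddCommGroup EX] [NormedSpace ℝ EX]
  [NormedAddCommGroup EG] [NormedSpace ℝ EG]
  [NormedAddCommGroup EN] [NormedSpace ℝ EN]
  [NormedAddCommGroup F] [NormedSpace ℝ F]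
  {X : Type*} [TopologicalSpace X] [ChartedSpace EX X]
  {G : Type*} [TopologicalSpace G] [ChartedSpace EG G]
  {N : Type*} [TopologicalSpace N] [ChartedSpace EN N]
  {V : X → Type*} [∀ x, AddCommGroup (V x)] [∀ x, Module ℝ (V x)]
  [∀ x, TopologicalSpace (V x)]

variable (𝒢 : LieGroupoid EX EG X G)

/-- Products of smooth maps into a Lie groupoid are smooth. -/
theorem contMDiffAt_mul {a b : N → G} {q : N} (ha : ContMDiffAt 𝓘(ℝ, EN) 𝓘(ℝ, EG) ∞ a q)
    (hb : ContMDiffAt 𝓘(ℝ, EN) 𝓘(ℝ, EG) ∞ b q) (hab : ∀ᶠ q' in 𝓝 q, 𝒢.src (a q') = 𝒢.tgt (b q')) :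
    ContMDiffAt 𝓘(ℝ, EN) 𝓘(ℝ, EG) ∞ (fun q' ↦ 𝒢.mul (a q') (b q')) q := by
  have h1 := 𝒢.contMDiffOn_mul (a q, b q) hab.self_of_nhds
  have h2 : ContMDiffWithinAt 𝓘(ℝ, EN) 𝓘(ℝ, EG) ∞ (fun q' ↦ 𝒢.mul (a q') (b q'))
      {q' | 𝒢.src (a q') = 𝒢.tgt (b q')} q :=
    ContMDiffWithinAt.comp (g := fun z : G × G ↦ 𝒢.mul z.1 z.2) (f := fun q' ↦ (a q', b q')) q h1
      (ha.prodMk hb).contMDiffWithinAt fun q' hq' ↦ hq'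
  exact h2.contMDiffAt hab

/-- The differential of right translation by `g` at `k`, as a linear map on the model space. -/
def dRightL (g k : G) : EG →L[ℝ] EG :=
  mfderivWithin 𝓘(ℝ, EG) 𝓘(ℝ, EG) (fun k' ↦ 𝒢.mul k' g) (𝒢.srcFiber (𝒢.tgt g)) k

/-- `dRightL` is a derivative within the s-fibre, hence meaningful only on tangent vectors of this
fibre. Composition with a map that stays in the fibre near `q` gives an ordinary derivative, which
allows right translations to be differentiated without treating the fibre as a manifold. -/
theorem hasModelDerivAt_mul_right {c : N → G} {q : N} {k : G} {L : EN →L[ℝ] EG} (hck : c q = k)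
    (hc : HasModelDerivAt c q L) {g : G} (hs : ∀ᶠ q' in 𝓝 q, 𝒢.src (c q') = 𝒢.tgt g) :
    HasModelDerivAt (fun q' ↦ 𝒢.mul (c q') g) q ((𝒢.dRightL g k).comp L) := by
  subst hck
  have h1 : ContMDiffWithinAt 𝓘(ℝ, EG) 𝓘(ℝ, EG) ∞ (fun k' ↦ 𝒢.mul k' g) (𝒢.srcFiber (𝒢.tgt g))
      (c q) :=
    ContMDiffWithinAt.comp (g := fun z : G × G ↦ 𝒢.mul z.1 z.2) (f := fun k' ↦ (k', g)) (c q)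
      (𝒢.contMDiffOn_mul (c q, g) hs.self_of_nhds)
      (contMDiffWithinAt_id.prodMk contMDiffWithinAt_const) fun k' hk' ↦ hk'
  have h2 := (h1.mdifferentiableWithinAt (by simp)).hasMFDerivWithinAt
  have h3 := HasMFDerivWithinAt.comp (f := c) (s := c ⁻¹' 𝒢.srcFiber (𝒢.tgt g)) q h2
    (HasMFDerivAt.hasMFDerivWithinAt hc) Subset.rfl
  exact h3.hasMFDerivAt hs

theorem hasVelocityAt_mul_right {c : ℝ → G} {k : G} {ξ : EG} (hck : c 0 = k)
    (hc : HasVelocityAt c ξ) {g : G} (hs : ∀ᶠ ε in 𝓝 0, 𝒢.src (c ε) = 𝒢.tgt g) :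
    HasVelocityAt (fun ε ↦ 𝒢.mul (c ε) g) (𝒢.dRightL g k ξ) :=
  (𝒢.hasModelDerivAt_mul_right hck hc hs).congr_deriv (by ext; simp)

/-- All tangent spaces are definitionally the model space, so transport along an equality of base
points does nothing. This removes the casts in the definitions of `rightInvariantField` and
`maurerCartan`. -/
theorem cast_tangent {g g' : G} (h : g = g') (ξ : TangentSpace 𝓘(ℝ, EG) g) :
    (h ▸ ξ : TangentSpace 𝓘(ℝ, EG) g') = (ξ : EG) := by
  subst h; rfl

/-- The identification `ι x` of the fibre `V x` with `ker ds` at the unit, as a linear map into the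
model space. -/
def unitTangent (ι : ∀ x : X, V x →L[ℝ] TangentSpace 𝓘(ℝ, EG) (𝒢.unit x)) (x : X) :
    V x →L[ℝ] EG :=
  ι x

/-- The tangent vector to the `s`-fibre at `g` which corresponds to `a` under right translation. -/
def rightTangent (ι : ∀ x : X, V x →L[ℝ] TangentSpace 𝓘(ℝ, EG) (𝒢.unit x)) (g : G) :
    V (𝒢.tgt g) →L[ℝ] EG :=
  (𝒢.dRightL g (𝒢.unit (𝒢.tgt g))).comp (𝒢.unitTangent ι (𝒢.tgt g))

variable {𝒢} {ι : ∀ x : X, V x →L[ℝ] TangentSpace 𝓘(ℝ, EG) (𝒢.unit x)}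

theorem rightInvariantField_eq (α : ∀ x, V x) (g : G) :
    (𝒢.rightInvariantField ι α g : EG) = 𝒢.rightTangent ι g (α (𝒢.tgt g)) :=
  cast_tangent (𝒢.unit_mul g) _

variable (𝒢 ι) in
/-- The Maurer–Cartan form, on vectors of the model space. -/
def modelMaurerCartan (g : G) (ξ : EG) : V (𝒢.tgt g) :=
  𝒢.maurerCartan ι g ξ

theorem modelMaurerCartan_eq (g : G) (ξ : EG) :
    𝒢.modelMaurerCartan ι g ξ =
      Function.invFun (𝒢.unitTangent ι (𝒢.tgt g)) (𝒢.dRightL (𝒢.inv g) g ξ) := by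
  unfold modelMaurerCartan maurerCartan
  congr 1
  exact cast_tangent (𝒢.mul_inv g) _

theorem hasVelocityAt_curve_mul {c : ℝ → G} {g : G} {a : V (𝒢.tgt g)}
    (hc0 : c 0 = 𝒢.unit (𝒢.tgt g)) (hc : HasVelocityAt c (𝒢.unitTangent ι (𝒢.tgt g) a))
    (hs : ∀ᶠ ε in 𝓝 0, 𝒢.src (c ε) = 𝒢.tgt g) :
    HasVelocityAt (fun ε ↦ 𝒢.mul (c ε) g) (𝒢.rightTangent ι g a) :=
  𝒢.hasVelocityAt_mul_right hc0 hc hs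

end LieGroupoid

/-! ### The isomorphism from the fibre of A at t(g) to ker ds at g, and smoothness of right
invariant fields -/

namespace LieGroupoid

section RightTangent

variable {EX EG EN F : Type*}
  [NormedAddCommGroup EX] [NormedSpace ℝ EX] [FiniteDimensional ℝ EX]
  [NormedAddCommGroup EG] [NormedSpace ℝ EG] [FiniteDimensional ℝ EG]
  [NormedAddCommGroup EN] [NormedSpace ℝ EN]
  [NormedAddCommGroup F] [NormedSpace ℝ F]
  {X : Type*} [TopologicalSpace X] [ChartedSpace EX X] [IsManifold 𝓘(ℝ, EX) ∞ X]
  {G : Type*} [TopologicalSpace G] [ChartedSpace EG G] [IsManifold 𝓘(ℝ, EG) ∞ G]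
  {N : Type*} [TopologicalSpace N] [ChartedSpace EN N]
  {V : X → Type*} [∀ x, AddCommGroup (V x)] [∀ x, Module ℝ (V x)]
  [∀ x, TopologicalSpace (V x)] [∀ x, IsTopologicalAddGroup (V x)]
  [∀ x, ContinuousSMul ℝ (V x)] [TopologicalSpace (TotalSpace F V)]
  [FiberBundle F V] [VectorBundle ℝ F V]
  {A : LieAlgebroid EX F V} {𝒢 : LieGroupoid EX EG X G}
  {ι : ∀ x : X, V x →L[ℝ] TangentSpace 𝓘(ℝ, EG) (𝒢.unit x)}

/-- Every vector tangent to an `s`-fibre is the velocity of a curve in this fibre. -/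
theorem exists_curve_in_srcFiber (𝒢 : LieGroupoid EX EG X G) {u : G} {ξ : EG}
    (hξ : modelDeriv EG EX 𝒢.src u ξ = 0) :
    ∃ c : ℝ → G, c 0 = u ∧ HasVelocityAt c ξ ∧ ∀ᶠ ε in 𝓝 0, 𝒢.src (c ε) = 𝒢.src u := by
  obtain ⟨K, hK, hK1, hK2⟩ := 𝒢.contMDiff_src.exists_fiber_retraction u (𝒢.src_submersion u)
  have hv := hasVelocityAt_straight_curve (mem_extChartAt_source (I := 𝓘(ℝ, EG)) u) ξ
  set c : ℝ → G := fun ε ↦ (extChartAt 𝓘(ℝ, EG) u).symm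
    (extChartAt 𝓘(ℝ, EG) u u + ε • modelDeriv EG EG (extChartAt 𝓘(ℝ, EG) u) u ξ)
  have hc0 : c 0 = u := by simp [c]
  refine ⟨fun ε ↦ K (𝒢.src u, c ε), ?_, ?_, ?_⟩
  · show K (𝒢.src u, c 0) = u
    rw [hc0]
    exact hK1.self_of_nhds
  · exact hasVelocityAt_fiber_retraction ((𝒢.contMDiff_src u).mdifferentiableAt (by simp))
      (hK.mdifferentiableAt (by simp)) hK1 hc0 hv hξ
  · have ht : Filter.Tendsto (fun ε ↦ (𝒢.src u, c ε)) (𝓝 0) (𝓝 (𝒢.src u, u)) := by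
      have := (HasModelDerivAt.continuousAt hv).tendsto
      rw [hc0] at this
      exact tendsto_const_nhds.prodMk_nhds this
    exact ht.eventually hK2

namespace Integrates

variable (hι : 𝒢.Integrates A ι)
include hι

theorem unitTangent_injective (x : X) : Function.Injective (𝒢.unitTangent ι x) := hι.injective x

theorem modelDeriv_src_unitTangent (x : X) (a : V x) :
    modelDeriv EG EX 𝒢.src (𝒢.unit x) (𝒢.unitTangent ι x a) = 0 := by
  have : ι x a ∈ range (ι x) := mem_range_self a
  rw [hι.range_eq x] at this
  exact this

theorem exists_unitTangent_eq {x : X} {ξ : EG}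
    (hξ : modelDeriv EG EX 𝒢.src (𝒢.unit x) ξ = 0) : ∃ a, 𝒢.unitTangent ι x a = ξ := by
  have : (ξ : TangentSpace 𝓘(ℝ, EG) (𝒢.unit x)) ∈ range (ι x) := by
    rw [hι.range_eq x]
    exact hξ
  exact this

theorem modelDeriv_tgt_unitTangent (x : X) (a : V x) :
    modelDeriv EG EX 𝒢.tgt (𝒢.unit x) (𝒢.unitTangent ι x a) = A.anchor x a := by
  have h := hι.anchor x a
  rw [TotalSpace.mk.injEq] at h
  have key : ∀ (y : X) (η : TangentSpace 𝓘(ℝ, EX) y) (η' : TangentSpace 𝓘(ℝ, EX) x), x = y →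
      HEq η' η → (η : EX) = (η' : EX) := by
    rintro y η η' rfl h
    exact (eq_of_heq h).symm
  exact key _ _ _ h.1 h.2

/-- Curves through a unit, in its `s`-fibre. -/
theorem exists_curve_unit (x : X) (a : V x) :
    ∃ c : ℝ → G, c 0 = 𝒢.unit x ∧ HasVelocityAt c (𝒢.unitTangent ι x a) ∧
      ∀ᶠ ε in 𝓝 0, 𝒢.src (c ε) = x := by
  have := 𝒢.exists_curve_in_srcFiber (hι.modelDeriv_src_unitTangent x a)
  rwa [𝒢.src_unit] at this

/-- The tangent vector is the velocity of a curve c·g with `c` in the s-fibre over t(g), and s(c·g)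
= s(g) is constant. -/
theorem modelDeriv_src_rightTangent (g : G) (a : V (𝒢.tgt g)) :
    modelDeriv EG EX 𝒢.src g (𝒢.rightTangent ι g a) = 0 := by
  obtain ⟨c, hc0, hc, hcs⟩ := hι.exists_curve_unit (𝒢.tgt g) a
  have h1 := hasVelocityAt_curve_mul hc0 hc hcs
  have h2 := h1.map (𝒢.contMDiff_src g).hasModelDerivAt (by rw [hc0, 𝒢.unit_mul])
  refine h2.unique ((hasVelocityAt_const (𝒢.src g)).congr ?_)
  filter_upwards [hcs] with ε hε using 𝒢.src_mul _ _ hε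

/-- Because t(c·g) = t(c), the value is the same as at the unit, where dt is the anchor. -/
theorem modelDeriv_tgt_rightTangent (g : G) (a : V (𝒢.tgt g)) :
    modelDeriv EG EX 𝒢.tgt g (𝒢.rightTangent ι g a) = A.anchor (𝒢.tgt g) a := by
  obtain ⟨c, hc0, hc, hcs⟩ := hι.exists_curve_unit (𝒢.tgt g) a
  have h1 := hasVelocityAt_curve_mul hc0 hc hcs
  have h2 := h1.map (𝒢.contMDiff_tgt g).hasModelDerivAt (by rw [hc0, 𝒢.unit_mul])
  have h3 := hc.map (𝒢.contMDiff_tgt _).hasModelDerivAt hc0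
  rw [hι.modelDeriv_tgt_unitTangent] at h3
  refine h2.unique (h3.congr ?_)
  filter_upwards [hcs] with ε hε using 𝒢.tgt_mul _ _ hε

/-- Right translation by g⁻¹ undoes right translation by g, on curves: (c·g)·g⁻¹ = c. In particular
`rightTangent` is injective. -/
theorem maurerCartan_rightTangent (g : G) (a : V (𝒢.tgt g)) :
    𝒢.modelMaurerCartan ι g (𝒢.rightTangent ι g a) = a := by
  obtain ⟨c, hc0, hc, hcs⟩ := hι.exists_curve_unit (𝒢.tgt g) a
  have h1 := hasVelocityAt_curve_mul hc0 hc hcs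
  have h2 := 𝒢.hasVelocityAt_mul_right (g := 𝒢.inv g) (k := g) (by rw [hc0, 𝒢.unit_mul]) h1 (by
    filter_upwards [hcs] with ε hε
    rw [𝒢.src_mul _ _ hε, 𝒢.tgt_inv])
  have h3 : 𝒢.dRightL (𝒢.inv g) g (𝒢.rightTangent ι g a) = 𝒢.unitTangent ι (𝒢.tgt g) a := by
    refine h2.unique (hc.congr ?_)
    filter_upwards [hcs] with ε hε
    rw [𝒢.mul_assoc _ _ _ hε (𝒢.tgt_inv g).symm, 𝒢.mul_inv, ← hε, 𝒢.mul_unit]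
  rw [modelMaurerCartan_eq, h3]
  exact Function.leftInverse_invFun (hι.unitTangent_injective _) a

/-- The Maurer–Cartan form determines the derivative of maps into an `s`-fibre. -/
theorem rightTangent_maurerCartan {c : N → G} {q : N} {L : EN →L[ℝ] EG}
    (hc : HasModelDerivAt c q L) (hs : ∀ᶠ q' in 𝓝 q, 𝒢.src (c q') = 𝒢.src (c q)) (v : EN) :
    𝒢.rightTangent ι (c q) (𝒢.modelMaurerCartan ι (c q) (L v)) = L v := by
  set k := c q with hk
  have h1 : HasModelDerivAt (fun q' ↦ 𝒢.mul (c q') (𝒢.inv k)) q ((𝒢.dRightL (𝒢.inv k) k).comp L) :=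
    𝒢.hasModelDerivAt_mul_right hk.symm hc (by
      filter_upwards [hs] with q' hq'
      rw [hq', 𝒢.tgt_inv])
  have hv : 𝒢.mul k (𝒢.inv k) = 𝒢.unit (𝒢.tgt k) := 𝒢.mul_inv k
  have hsrc : ∀ᶠ q' in 𝓝 q, 𝒢.src (𝒢.mul (c q') (𝒢.inv k)) = 𝒢.tgt k := by
    filter_upwards [hs] with q' hq'
    rw [𝒢.src_mul _ _ (by rw [hq', 𝒢.tgt_inv]), 𝒢.src_inv]
  have h2 := (𝒢.contMDiff_src (𝒢.unit (𝒢.tgt k))).hasModelDerivAt.comp h1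
    (by rw [← hk, hv])
  have h3 := h2.unique ((hasModelDerivAt_const (𝒢.tgt k) q).congr_of_eventuallyEq hsrc)
  -- The map c·k⁻¹ takes values in the s-fibre over t(k), so its derivative at the unit lies in the
  -- range of ι. Only then does `Function.invFun` return a preimage.
  obtain ⟨a, ha⟩ := hι.exists_unitTangent_eq (x := 𝒢.tgt k)
    (ξ := 𝒢.dRightL (𝒢.inv k) k (L v)) (DFunLike.congr_fun h3 v)
  have h4 : 𝒢.unitTangent ι (𝒢.tgt k) (𝒢.modelMaurerCartan ι k (L v)) =
      𝒢.dRightL (𝒢.inv k) k (L v) := by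
    rw [modelMaurerCartan_eq]
    exact Function.invFun_eq ⟨a, ha⟩
  have h5 := 𝒢.hasModelDerivAt_mul_right (g := k) (k := 𝒢.unit (𝒢.tgt k)) (by rw [← hk, hv]) h1 hsrc
  -- Translating back: (c·k⁻¹)·k = c.
  have h6 : HasModelDerivAt (fun q' ↦ 𝒢.mul (𝒢.mul (c q') (𝒢.inv k)) k) q L := by
    refine hc.congr_of_eventuallyEq ?_
    filter_upwards [hs] with q' hq'
    rw [𝒢.mul_assoc _ _ _ (by rw [hq', 𝒢.tgt_inv]) (𝒢.src_inv k), 𝒢.inv_mul, ← hq', 𝒢.mul_unit]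
  have h7 := DFunLike.congr_fun (h5.unique h6) v
  rw [rightTangent, ContinuousLinearMap.comp_apply, h4]
  exact h7

/-- A vector in ker ds is the velocity of a curve in the s-fibre, and the Maurer–Cartan form of this
velocity is the preimage. With `maurerCartan_rightTangent` this makes `rightTangent` an isomorphism
onto ker ds. -/
theorem exists_rightTangent_eq {g : G} {ξ : EG} (hξ : modelDeriv EG EX 𝒢.src g ξ = 0) :
    ∃ a, 𝒢.rightTangent ι g a = ξ := by
  obtain ⟨c, rfl, hc, hcs⟩ := 𝒢.exists_curve_in_srcFiber hξ
  have := hι.rightTangent_maurerCartan hc hcs 1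
  simp only [ContinuousLinearMap.toSpanSingleton_apply, one_smul] at this
  exact ⟨_, this⟩

/-- A smooth section of `V`, transported to the units, read in a chart. -/
theorem contMDiffAt_modelDeriv_unitTangent {α : ∀ x, V x} {x₁ : X}
    (hα : ContMDiffAt 𝓘(ℝ, EX) (𝓘(ℝ, EX).prod 𝓘(ℝ, F)) ∞
      (fun x ↦ (⟨x, α x⟩ : TotalSpace F V)) x₁) :
    ContMDiffAt 𝓘(ℝ, EX) 𝓘(ℝ, EG) ∞
      (fun x ↦ modelDeriv EG EG (extChartAt 𝓘(ℝ, EG) (𝒢.unit x₁)) (𝒢.unit x)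
        (𝒢.unitTangent ι x (α x))) x₁ := by
  have : IsManifold 𝓘(ℝ, EG) 1 G := IsManifold.of_le (n := ∞) (by simp)
  have h1 : ContMDiffAt 𝓘(ℝ, EX) 𝓘(ℝ, EG).tangent ∞
      (fun x ↦ (⟨𝒢.unit x, ι x (α x)⟩ : TangentBundle 𝓘(ℝ, EG) G)) x₁ :=
    ContMDiffAt.comp (g := fun a : TotalSpace F V ↦
      (⟨𝒢.unit a.proj, ι a.proj a.snd⟩ : TangentBundle 𝓘(ℝ, EG) G)) x₁
      (hι.contMDiff _) hα
  refine (contMDiffAt_totalSpace.1 h1).2.congr_of_eventuallyEq ?_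
  filter_upwards [(𝒢.contMDiff_unit x₁).continuousAt.eventually
    (extChartAt_source_mem_nhds (I := 𝓘(ℝ, EG)) (𝒢.unit x₁))] with x hx
  exact (snd_trivializationAt_tangentSpace hx _).symm

/-- A smooth section of `V` is the velocity of a smooth family of curves in the `s`-fibres, which
start at the units. -/
theorem exists_family_of_curves {α : ∀ x, V x} {x₁ : X}
    (hα : ContMDiffAt 𝓘(ℝ, EX) (𝓘(ℝ, EX).prod 𝓘(ℝ, F)) ∞
      (fun x ↦ (⟨x, α x⟩ : TotalSpace F V)) x₁) :
    ∃ σ : X × ℝ → G, ContMDiffAt (𝓘(ℝ, EX).prod 𝓘(ℝ, ℝ)) 𝓘(ℝ, EG) ∞ σ (x₁, 0) ∧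
      (∀ᶠ z in 𝓝 (x₁, 0), 𝒢.src (σ z) = z.1) ∧
      ∀ᶠ x in 𝓝 x₁, σ (x, 0) = 𝒢.unit x ∧
        HasVelocityAt (fun ε ↦ σ (x, ε)) (𝒢.unitTangent ι x (α x)) := by
  have hX : IsManifold 𝓘(ℝ, EX) 1 X := IsManifold.of_le (n := ∞) (by simp)
  have hG : IsManifold 𝓘(ℝ, EG) 1 G := IsManifold.of_le (n := ∞) (by simp)
  set u₀ := 𝒢.unit x₁ with hu₀
  set κu := extChartAt 𝓘(ℝ, EG) u₀ with hκu
  obtain ⟨K, hK, hK1, hK2⟩ := 𝒢.contMDiff_src.exists_fiber_retraction u₀ (𝒢.src_submersion u₀)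
  rw [hu₀, 𝒢.src_unit, ← hu₀] at hK hK2
  have hunit : Filter.Tendsto 𝒢.unit (𝓝 x₁) (𝓝 u₀) := (𝒢.contMDiff_unit x₁).continuousAt
  have hunitsrc : ∀ᶠ x in 𝓝 x₁, 𝒢.unit x ∈ κu.source :=
    hunit.eventually (extChartAt_source_mem_nhds (I := 𝓘(ℝ, EG)) u₀)
  have hb := hι.contMDiffAt_modelDeriv_unitTangent hα
  set b : X → EG := fun x ↦ modelDeriv EG EG κu (𝒢.unit x) (𝒢.unitTangent ι x (α x))
  -- Straight segments in the chart, starting at the units with the velocities given by α. They need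
  -- not stay in the s-fibres; the retraction `K` corrects this without changing the velocities.
  set kf : X × ℝ → G := fun z ↦ κu.symm (κu (𝒢.unit z.1) + z.2 • b z.1) with hkf
  have hk0 : ∀ x, 𝒢.unit x ∈ κu.source → kf (x, 0) = 𝒢.unit x := by
    intro x hx
    simp only [hkf, zero_smul, add_zero]
    exact κu.left_inv hx
  have hkfc : ContMDiffAt (𝓘(ℝ, EX).prod 𝓘(ℝ, ℝ)) 𝓘(ℝ, EG) ∞ kf (x₁, 0) := by
    have h1 : ContMDiffAt (𝓘(ℝ, EX).prod 𝓘(ℝ, ℝ)) 𝓘(ℝ, EG) ∞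
        (fun z : X × ℝ ↦ κu (𝒢.unit z.1)) (x₁, 0) :=
      ContMDiffAt.comp (g := κu) (f := fun z : X × ℝ ↦ 𝒢.unit z.1) (x₁, (0 : ℝ))
        (contMDiffAt_extChartAt (x := u₀))
        (ContMDiffAt.comp (g := 𝒢.unit) (f := Prod.fst) (x₁, (0 : ℝ)) (𝒢.contMDiff_unit _)
          contMDiffAt_fst)
    have h2 : ContMDiffAt (𝓘(ℝ, EX).prod 𝓘(ℝ, ℝ)) 𝓘(ℝ, EG) ∞ (fun z : X × ℝ ↦ b z.1) (x₁, 0) :=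
      ContMDiffAt.comp (g := b) (f := Prod.fst) (x₁, (0 : ℝ)) hb contMDiffAt_fst
    refine ContMDiffAt.comp_of_eq (g := κu.symm)
      (contMDiffAt_extChartAt_symm (mem_extChartAt_target u₀)) (h1.add (contMDiffAt_snd.smul h2)) ?_
    simp [hκu, hu₀]
  have hxk : ContMDiffAt (𝓘(ℝ, EX).prod 𝓘(ℝ, ℝ)) (𝓘(ℝ, EX).prod 𝓘(ℝ, EG)) ∞
      (fun z : X × ℝ ↦ (z.1, kf z)) (x₁, 0) := contMDiffAt_fst.prodMk hkfc
  refine ⟨fun z ↦ K (z.1, kf z),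
    ContMDiffAt.comp_of_eq (g := K) hK hxk (by rw [hk0 _ hunitsrc.self_of_nhds]), ?_, ?_⟩
  · have := hxk.continuousAt.tendsto
    rw [hk0 _ hunitsrc.self_of_nhds] at this
    exact this.eventually hK2
  · have e4 : ∀ᶠ x in 𝓝 x₁, MDifferentiableAt (𝓘(ℝ, EX).prod 𝓘(ℝ, EG)) 𝓘(ℝ, EG) K
        (x, 𝒢.unit x) := by
      have h := (contMDiffAt_iff_contMDiffAt_nhds (by simp)).1 (hK.of_le (m := 1) (by simp))
      filter_upwards [(Filter.tendsto_id.prodMk_nhds hunit).eventually h] with x h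
        using h.mdifferentiableAt (by simp)
    filter_upwards [hunitsrc, hunit.eventually hK1.eventually_nhds, e4] with x h2 h3 h4
    have hs : 𝒢.src (𝒢.unit x) = x := 𝒢.src_unit x
    constructor
    · have := h3.self_of_nhds
      rw [hs] at this
      rw [hk0 _ h2, this]
    · have := hasVelocityAt_fiber_retraction (s := 𝒢.src) (K := K) (u := 𝒢.unit x)
        ((𝒢.contMDiff_src _).mdifferentiableAt (by simp)) (by rw [hs]; exact h4) h3 (hk0 x h2)
        (hasVelocityAt_straight_curve h2 _) (hι.modelDeriv_src_unitTangent x (α x))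
      rw [hs] at this
      exact this

/-- Right invariant vector fields are smooth. -/
theorem contDiffAt_rightTangent {α : ∀ x, V x} {g₀ g₁ : G}
    (hg : g₁ ∈ (extChartAt 𝓘(ℝ, EG) g₀).source)
    (hα : ContMDiffAt 𝓘(ℝ, EX) (𝓘(ℝ, EX).prod 𝓘(ℝ, F)) ∞
      (fun x ↦ (⟨x, α x⟩ : TotalSpace F V)) (𝒢.tgt g₁)) :
    ContDiffAt ℝ ∞ (fun y ↦ modelDeriv EG EG (extChartAt 𝓘(ℝ, EG) g₀)
        ((extChartAt 𝓘(ℝ, EG) g₀).symm y) (𝒢.rightTangent ι ((extChartAt 𝓘(ℝ, EG) g₀).symm y)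
          (α (𝒢.tgt ((extChartAt 𝓘(ℝ, EG) g₀).symm y))))) (extChartAt 𝓘(ℝ, EG) g₀ g₁) := by
  obtain ⟨σ, hσ, hσs, hσv⟩ := hι.exists_family_of_curves hα
  set κ := extChartAt 𝓘(ℝ, EG) g₀ with hκ
  have hg1 : κ.symm (κ g₁) = g₁ := κ.left_inv hg
  have hgfc : ContMDiffAt 𝓘(ℝ, EG × ℝ) 𝓘(ℝ, EG) ∞ (fun z : EG × ℝ ↦ κ.symm z.1) (κ g₁, 0) :=
    ContMDiffAt.comp (g := κ.symm) (κ g₁, (0 : ℝ)) (contMDiffAt_extChartAt_symm (κ.map_source hg))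
      contDiff_fst.contMDiff.contMDiffAt
  have hxf : ContMDiffAt 𝓘(ℝ, EG × ℝ) (𝓘(ℝ, EX).prod 𝓘(ℝ, ℝ)) ∞
      (fun z : EG × ℝ ↦ (𝒢.tgt (κ.symm z.1), z.2)) (κ g₁, 0) :=
    (ContMDiffAt.comp (g := 𝒢.tgt) (κ g₁, (0 : ℝ)) (𝒢.contMDiff_tgt _) hgfc).prodMk
      contDiff_snd.contMDiff.contMDiffAt
  have hxt : Filter.Tendsto (fun z : EG × ℝ ↦ (𝒢.tgt (κ.symm z.1), z.2)) (𝓝 (κ g₁, 0))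
      (𝓝 (𝒢.tgt g₁, 0)) := by
    have := hxf.continuousAt.tendsto
    simp only [hg1] at this
    exact this
  have hσc : ContMDiffAt 𝓘(ℝ, EG × ℝ) 𝓘(ℝ, EG) ∞
      (fun z : EG × ℝ ↦ σ (𝒢.tgt (κ.symm z.1), z.2)) (κ g₁, 0) :=
    ContMDiffAt.comp_of_eq (g := σ) hσ hxf (by simp only [hg1])
  -- The right invariant field at `y` is the derivative of m(y, ε) in ε at 0. Multiplication is
  -- composed here with a map into composable pairs, so `m` is jointly smooth near (κ g₁, 0) and its
  -- partial derivative is smooth in `y`.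
  set m : EG × ℝ → EG := fun z ↦ κ (𝒢.mul (σ (𝒢.tgt (κ.symm z.1), z.2)) (κ.symm z.1)) with hm
  have hmc : ContDiffAt ℝ ∞ m (κ g₁, 0) := by
    rw [← contMDiffAt_iff_contDiffAt]
    refine ContMDiffAt.comp_of_eq (g := κ) (y := g₁)
      (contMDiffAt_extChartAt' (by simpa [hκ] using hg))
      (𝒢.contMDiffAt_mul hσc hgfc (hxt.eventually hσs)) ?_
    rw [hg1, hσv.self_of_nhds.1, 𝒢.unit_mul]
  have hder : ContDiffAt ℝ ∞ (fun y ↦ fderiv ℝ m (y, 0) (0, 1)) (κ g₁) := by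
    have h1 : ContDiffAt ℝ ∞ (fderiv ℝ m) (κ g₁, 0) := hmc.fderiv_right (by simp)
    have h2 : ContDiffAt ℝ ∞ (fun y ↦ fderiv ℝ m (y, 0)) (κ g₁) :=
      ContDiffAt.comp (κ g₁) (f := fun y : EG ↦ (y, (0 : ℝ))) h1 (by fun_prop)
    exact h2.clm_apply contDiffAt_const
  refine hder.congr_of_eventuallyEq ?_
  have hy : Filter.Tendsto (fun y : EG ↦ (y, (0 : ℝ))) (𝓝 (κ g₁)) (𝓝 (κ g₁, 0)) :=
    Continuous.tendsto' (by fun_prop) _ _ rfl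
  have e1 : ∀ᶠ y in 𝓝 (κ g₁), DifferentiableAt ℝ m (y, 0) := by
    have := (hmc.of_le (m := 1) (by simp)).eventually (by simp)
    filter_upwards [hy.eventually this] with y h using h.differentiableAt one_ne_zero
  have hxt' : Filter.Tendsto (fun y : EG ↦ 𝒢.tgt (κ.symm y)) (𝓝 (κ g₁)) (𝓝 (𝒢.tgt g₁)) :=
    (continuous_fst.tendsto' _ _ rfl).comp (hxt.comp hy)
  filter_upwards [e1, hxt'.eventually hσv, hy.eventually (hxt.eventually hσs).eventually_nhds,
    (isOpen_extChartAt_target g₀).mem_nhds (κ.map_source hg)] with y h1 h2 h3 h4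
  have ht : Filter.Tendsto (fun ε : ℝ ↦ (y, ε)) (𝓝 0) (𝓝 (y, 0)) :=
    Continuous.tendsto' (by fun_prop) _ _ rfl
  have v3 := hasVelocityAt_curve_mul (𝒢 := 𝒢) (ι := ι) (g := κ.symm y) h2.1 h2.2 (ht.eventually h3)
  have v4 := v3.map (hasModelDerivAt_extChartAt (u := g₀) (κ.map_target h4)) (by
    rw [h2.1, 𝒢.unit_mul])
  rw [hasVelocityAt_iff_hasDerivAt] at v4
  have v5 : HasDerivAt (fun ε : ℝ ↦ m (y, ε)) (fderiv ℝ m (y, 0) (0, 1)) 0 :=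
    HasFDerivAt.comp_hasDerivAt (l := m) (f := fun ε : ℝ ↦ (y, ε)) 0 h1.hasFDerivAt
      ((hasDerivAt_const _ _).prodMk (hasDerivAt_id _))
  exact v4.unique v5

end Integrates

end RightTangent

end LieGroupoid

/-! ### Extension of local sections and tensoriality -/

section SmoothSections

variable {EX F : Type*}
  [NormedAddCommGroup EX] [NormedSpace ℝ EX] [FiniteDimensional ℝ EX]
  [NormedAddCommGroup F] [NormedSpace ℝ F]
  {X : Type*} [TopologicalSpace X] [ChartedSpace EX X] [IsManifold 𝓘(ℝ, EX) ∞ X] [T2Space X]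
  {V : X → Type*} [∀ x, AddCommGroup (V x)] [∀ x, Module ℝ (V x)]
  [∀ x, TopologicalSpace (V x)] [∀ x, IsTopologicalAddGroup (V x)]
  [∀ x, ContinuousSMul ℝ (V x)] [TopologicalSpace (TotalSpace F V)]
  [FiberBundle F V] [VectorBundle ℝ F V] [ContMDiffVectorBundle ∞ F V 𝓘(ℝ, EX)]

/-- A local smooth section agrees near each point with a global smooth section. -/
theorem exists_smooth_section_eventuallyEq {U : Set X} (hU : IsOpen U) {s : ∀ x, V x}
    (hs : ContMDiffOn 𝓘(ℝ, EX) (𝓘(ℝ, EX).prod 𝓘(ℝ, F)) ∞ (fun y ↦ TotalSpace.mk' F y (s y)) U)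
    {x : X} (hx : x ∈ U) :
    ∃ α : Cₛ^∞⟮𝓘(ℝ, EX); F, V⟯, ∀ᶠ y in 𝓝 x, α y = s y := by
  obtain ⟨ψ, -, hψ⟩ := (SmoothBumpFunction.nhds_basis_tsupport (I := 𝓘(ℝ, EX)) x).mem_iff.1
    (hU.mem_nhds hx)
  refine ⟨⟨fun y ↦ ψ y • s y,
    ContMDiffOn.smul_section_of_tsupport ψ.contMDiff.contMDiffOn hU hψ hs⟩, ?_⟩
  filter_upwards [ψ.eventuallyEq_one] with y hy
  show ψ y • s y = s y
  rw [hy]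
  simp

omit [FiniteDimensional ℝ EX] [T2Space X] in
theorem contMDiffOn_trivialization_symm_const
    (e : Trivialization F (TotalSpace.proj : TotalSpace F V → X)) [MemTrivializationAtlas e]
    (f : F) : ContMDiffOn 𝓘(ℝ, EX) (𝓘(ℝ, EX).prod 𝓘(ℝ, F)) ∞
      (fun y ↦ TotalSpace.mk' F y (e.symm y f)) e.baseSet := by
  rw [e.contMDiffOn_section_baseSet_iff]
  refine (contMDiffOn_const (c := f)).congr fun y hy ↦ ?_
  rw [e.apply_mk_symm hy]

/-- A linear map on smooth sections which is linear over smooth functions at `x` vanishes on the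
sections which vanish at `x`. -/
theorem map_eq_zero_of_smoothSMul [FiniteDimensional ℝ F] {W : Type*} [AddCommGroup W] [Module ℝ W]
    {x : X} (Φ : Cₛ^∞⟮𝓘(ℝ, EX); F, V⟯ →ₗ[ℝ] W)
    (hΦ : ∀ (f : C^∞⟮𝓘(ℝ, EX), X; ℝ⟯) α, Φ (smoothSMul f α) = f x • Φ α)
    {α : Cₛ^∞⟮𝓘(ℝ, EX); F, V⟯} (hα : α x = 0) : Φ α = 0 := by
  set e := trivializationAt F V x
  have hx : x ∈ e.baseSet := FiberBundle.mem_baseSet_trivializationAt' x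
  obtain ⟨ψ, -, hψ⟩ := (SmoothBumpFunction.nhds_basis_tsupport (I := 𝓘(ℝ, EX)) x).mem_iff.1
    (e.open_baseSet.mem_nhds hx)
  set b := Module.finBasis ℝ F
  have hcoord : ContMDiffOn 𝓘(ℝ, EX) 𝓘(ℝ, F) ∞ (fun y ↦ (e ⟨y, α y⟩).2) e.baseSet :=
    e.contMDiffOn_section_baseSet_iff.1 α.contMDiff.contMDiffOn
  let f (i) : C^∞⟮𝓘(ℝ, EX), X; ℝ⟯ := ⟨fun y ↦ ψ y • b.coord i (e ⟨y, α y⟩).2,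
    contMDiff_of_tsupport fun y hy ↦ by
      have hy' : y ∈ e.baseSet := hψ (tsupport_smul_subset_left _ _ hy)
      refine ψ.contMDiff.contMDiffAt.smul ?_
      exact ((LinearMap.toContinuousLinearMap (b.coord i)).contMDiff.contMDiffAt).comp y
        (hcoord.contMDiffAt (e.open_baseSet.mem_nhds hy'))⟩
  let s (i) : Cₛ^∞⟮𝓘(ℝ, EX); F, V⟯ := ⟨fun y ↦ ψ y • e.symm y (b i),
    ContMDiffOn.smul_section_of_tsupport ψ.contMDiff.contMDiffOn e.open_baseSet hψ
      (contMDiffOn_trivialization_symm_const e (b i))⟩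
  let ψ' : C^∞⟮𝓘(ℝ, EX), X; ℝ⟯ := ⟨fun y ↦ ψ y * ψ y, ψ.contMDiff.mul ψ.contMDiff⟩
  -- The cutoff is used twice, once to make the coordinates of α global functions and once to make
  -- the local frame global. So ψ²α has a global expansion whose coefficients vanish at `x`, whereas
  -- ψ(x) = 1.
  have key : smoothSMul ψ' α = ∑ i, smoothSMul (f i) (s i) := by
    ext y
    rw [show (∑ i, smoothSMul (f i) (s i)) y = ∑ i, smoothSMul (f i) (s i) y from
      (congrFun (map_sum (ContMDiffSection.coeAddHom 𝓘(ℝ, EX) F ∞ V) _ _) y).trans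
        (Finset.sum_apply _ _ _)]
    show (ψ y * ψ y) • α y = ∑ i, (ψ y • b.coord i (e ⟨y, α y⟩).2) • (ψ y • e.symm y (b i))
    by_cases hy : y ∈ e.baseSet
    · have h1 : α y = ∑ i, b.coord i (e ⟨y, α y⟩).2 • e.symm y (b i) := by
        conv_lhs => rw [← e.symm_apply_apply_mk hy (α y), ← b.sum_repr (e ⟨y, α y⟩).2]
        simp_rw [← e.symmL_apply (R := ℝ) hy, map_sum, map_smul]
        rfl
      conv_lhs => rw [h1, Finset.smul_sum]
      refine Finset.sum_congr rfl fun i _ ↦ ?_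
      simp only [smul_smul, smul_eq_mul]
      congr 1
      ring
    · have : ψ y = 0 := by
        by_contra h
        exact hy (hψ (subset_tsupport _ h))
      simp [this]
  have h2 := congrArg Φ key
  rw [hΦ, map_sum] at h2
  have h3 : ∀ i, f i x = 0 := fun i ↦ by
    show ψ x • b.coord i (e ⟨x, α x⟩).2 = 0
    have : (e ⟨x, (0 : V x)⟩).2 = 0 := by
      have h0 := congrFun (e.coe_linearMapAt_of_mem (R := ℝ) hx) 0
      rw [map_zero] at h0
      exact h0.symm
    rw [hα, this, map_zero, smul_zero]
  simp only [hΦ, h3, zero_smul, Finset.sum_const_zero] at h2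
  have h4 : ψ' x = 1 := by
    show ψ x * ψ x = 1
    simp
  rwa [h4, one_smul] at h2

end SmoothSections

/-! ### Tensoriality of the torsion -/

namespace LieAlgebroid

variable {EX F : Type*}
  [NormedAddCommGroup EX] [NormedSpace ℝ EX] [FiniteDimensional ℝ EX]
  [NormedAddCommGroup F] [NormedSpace ℝ F] [FiniteDimensional ℝ F]
  {X : Type*} [TopologicalSpace X] [ChartedSpace EX X] [IsManifold 𝓘(ℝ, EX) ∞ X] [T2Space X]
  {V : X → Type*} [∀ x, AddCommGroup (V x)] [∀ x, Module ℝ (V x)]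
  [∀ x, TopologicalSpace (V x)] [∀ x, IsTopologicalAddGroup (V x)]
  [∀ x, ContinuousSMul ℝ (V x)] [TopologicalSpace (TotalSpace F V)]
  [FiberBundle F V] [VectorBundle ℝ F V] [ContMDiffVectorBundle ∞ F V 𝓘(ℝ, EX)]
  (A : LieAlgebroid EX F V) (D : CovariantDerivative 𝓘(ℝ, EX) F V)

theorem bracket_swap (α β : Cₛ^∞⟮𝓘(ℝ, EX); F, V⟯) : A.bracket α β = -A.bracket β α := by
  have h := A.bracket_self (α + β)
  simp only [map_add, LinearMap.add_apply, A.bracket_self, zero_add, add_zero] at h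
  exact eq_neg_of_add_eq_zero_right h

theorem sectionTorsion_swap (α β : Cₛ^∞⟮𝓘(ℝ, EX); F, V⟯) (x : X) :
    A.sectionTorsion D α β x = -A.sectionTorsion D β α x := by
  simp only [sectionTorsion, A.bracket_swap α β, ContMDiffSection.coe_neg, Pi.neg_apply]
  abel

/-- The torsion as a linear function of the first section. -/
def torsionLinear (β : Cₛ^∞⟮𝓘(ℝ, EX); F, V⟯) (x : X) :
    Cₛ^∞⟮𝓘(ℝ, EX); F, V⟯ →ₗ[ℝ] V x where
  toFun α := A.sectionTorsion D α β x
  map_add' α α' := by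
    have h := D.isCovariantDerivativeOn.add (x := x)
      (α.contMDiff.mdifferentiable (by simp) x) (α'.contMDiff.mdifferentiable (by simp) x)
    simp only [sectionTorsion, ContMDiffSection.coe_add, h, map_add, LinearMap.add_apply,
      Pi.add_apply, add_apply]
    abel
  map_smul' c α := by
    have h := D.isCovariantDerivativeOn.smul_const (x := x) c
      (α.contMDiff.mdifferentiable (by simp) x)
    simp only [sectionTorsion, ContMDiffSection.coe_smul, h, map_smul, LinearMap.smul_apply,
      Pi.smul_apply, smul_apply, smul_sub, RingHom.id_apply]

/-- The term df(♯β)α occurs twice with opposite signs: in ∇_{♯β}(fα) and in the Leibniz rule for [β,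
fα] = −[fα, β]. -/
theorem sectionTorsion_smoothSMul (f : C^∞⟮𝓘(ℝ, EX), X; ℝ⟯) (α β : Cₛ^∞⟮𝓘(ℝ, EX); F, V⟯) (x : X) :
    A.sectionTorsion D (smoothSMul f α) β x = f x • A.sectionTorsion D α β x := by
  have h := D.isCovariantDerivativeOn.leibniz (x := x) (g := f)
    (α.contMDiff.mdifferentiable (by simp) x) (f.contMDiff.mdifferentiable (by simp) x)
  have h1 : (⇑(smoothSMul f α) : ∀ x, V x) = ⇑f • ⇑α := rfl
  rw [sectionTorsion, A.bracket_swap, ContMDiffSection.coe_neg, Pi.neg_apply, A.leibniz, h1, h,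
    sectionTorsion, A.bracket_swap α β, ContMDiffSection.coe_neg, Pi.neg_apply]
  simp only [Pi.smul_apply', map_smul, add_apply, smul_apply,
    ContinuousLinearMap.smulRight_apply, smul_sub, smul_neg]
  abel

/-- The torsion of a connection on a Lie algebroid is tensorial. -/
theorem sectionTorsion_congr {α α' β β' : Cₛ^∞⟮𝓘(ℝ, EX); F, V⟯} {x : X} (hα : α x = α' x)
    (hβ : β x = β' x) : A.sectionTorsion D α β x = A.sectionTorsion D α' β' x := by
  have key : ∀ {α α' : Cₛ^∞⟮𝓘(ℝ, EX); F, V⟯} (β : Cₛ^∞⟮𝓘(ℝ, EX); F, V⟯), α x = α' x →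
      A.sectionTorsion D α β x = A.sectionTorsion D α' β x := fun {α α'} β h ↦ by
    have := map_eq_zero_of_smoothSMul (A.torsionLinear D β x)
      (fun f α ↦ A.sectionTorsion_smoothSMul D f α β x) (α := α - α')
      (by rw [ContMDiffSection.coe_sub, Pi.sub_apply, h, sub_self])
    rw [map_sub] at this
    exact sub_eq_zero.1 this
  -- Tensoriality in the second argument follows from that in the first by antisymmetry.
  rw [key β hα, sectionTorsion_swap, key α' hβ, ← sectionTorsion_swap]

/-- Tensoriality makes the sections chosen in `torsion` irrelevant, so the torsion can be evaluated
on sections that are constant in a trivialization near the point. -/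
theorem torsion_eq_sectionTorsion (α β : Cₛ^∞⟮𝓘(ℝ, EX); F, V⟯) (x : X) :
    A.torsion D x (α x) (β x) = A.sectionTorsion D α β x :=
  A.sectionTorsion_congr D (Classical.choose_spec (exists_smooth_section_through x (α x)))
    (Classical.choose_spec (exists_smooth_section_through x (β x)))

end LieAlgebroid

/-! ### Connections and pullback connections in an arbitrary trivialization -/

section Connections

variable {EX EM F : Type*}
  [NormedAddCommGroup EX] [NormedSpace ℝ EX]
  [NormedAddCommGroup EM] [NormedSpace ℝ EM]
  [NormedAddCommGroup F] [NormedSpace ℝ F] [FiniteDimensional ℝ F]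
  {X : Type*} [TopologicalSpace X] [ChartedSpace EX X] [IsManifold 𝓘(ℝ, EX) ∞ X]
  {M : Type*} [TopologicalSpace M] [ChartedSpace EM M] [IsManifold 𝓘(ℝ, EM) ∞ M]
  {V : X → Type*} [∀ x, AddCommGroup (V x)] [∀ x, Module ℝ (V x)]
  [∀ x, TopologicalSpace (V x)] [∀ x, IsTopologicalAddGroup (V x)]
  [∀ x, ContinuousSMul ℝ (V x)] [TopologicalSpace (TotalSpace F V)]
  [FiberBundle F V] [VectorBundle ℝ F V] [ContMDiffVectorBundle ∞ F V 𝓘(ℝ, EX)]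

theorem covariantDerivative_sum (D : CovariantDerivative 𝓘(ℝ, EX) F V) {ι : Type*} (I : Finset ι)
    {c : ι → X → ℝ} {t : ι → ∀ x, V x} {x : X}
    (hc : ∀ i, MDifferentiableAt 𝓘(ℝ, EX) 𝓘(ℝ, ℝ) (c i) x)
    (ht : ∀ i, MDifferentiableAt 𝓘(ℝ, EX) (𝓘(ℝ, EX).prod 𝓘(ℝ, F))
      (fun y ↦ TotalSpace.mk' F y (t i y)) x) :
    D (∑ i ∈ I, c i • t i) x =
      ∑ i ∈ I, (c i x • D (t i) x + (mvfderiv 𝓘(ℝ, EX) (c i) x).smulRight (t i x)) := by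
  classical
  induction I using Finset.induction_on with
  | empty =>
    simp only [Finset.sum_empty]
    exact D.isCovariantDerivativeOn.zero
  | insert i I hi ih =>
    rw [Finset.sum_insert hi, Finset.sum_insert hi, ← ih,
      ← D.isCovariantDerivativeOn.leibniz (ht i) (hc i)]
    refine D.isCovariantDerivativeOn.add ((hc i).smul_section (ht i)) ?_
    have := MDifferentiableAt.sum_section (s := I) (t := fun i ↦ c i • t i) (x₀ := x)
      fun i _ ↦ (hc i).smul_section (ht i)
    convert this using 2 with y
    simp [Finset.sum_apply]

/-- A connection in a trivialization: the coordinates are differentiated, up to the covariant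
derivative of a section which is constant in the trivialization. -/
theorem covariantDerivative_eq_of_trivialization (D : CovariantDerivative 𝓘(ℝ, EX) F V)
    (e : Trivialization F (TotalSpace.proj : TotalSpace F V → X)) [MemTrivializationAtlas e]
    {x : X} (hx : x ∈ e.baseSet) {s : ∀ x, V x}
    (hs : MDifferentiableAt 𝓘(ℝ, EX) (𝓘(ℝ, EX).prod 𝓘(ℝ, F))
      (fun y ↦ TotalSpace.mk' F y (s y)) x) (w : EX) :
    D s x w = e.symm x (modelDeriv EX F (fun y ↦ (e ⟨y, s y⟩).2) x w)
      + D (fun y ↦ e.symm y (e ⟨x, s x⟩).2) x w := by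
  suffices main : ∀ w : TangentSpace 𝓘(ℝ, EX) x, D s x w =
      e.symm x (modelDeriv EX F (fun y ↦ (e ⟨y, s y⟩).2) x w)
        + D (fun y ↦ e.symm y (e ⟨x, s x⟩).2) x w from main w
  intro w
  have : ContMDiffVectorBundle 1 F V 𝓘(ℝ, EX) := ContMDiffVectorBundle.of_le (n := ∞) (by simp)
  set b := Module.finBasis ℝ F
  set sh : X → F := fun y ↦ (e ⟨y, s y⟩).2 with hsh
  have hshd : MDifferentiableAt 𝓘(ℝ, EX) 𝓘(ℝ, F) sh x :=
    (e.mdifferentiableAt_section_iff 𝓘(ℝ, EX) s hx).1 hs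
  set t : Fin (Module.finrank ℝ F) → ∀ y, V y := fun i y ↦ e.symm y (b i) with ht
  have htd : ∀ i, MDifferentiableAt 𝓘(ℝ, EX) (𝓘(ℝ, EX).prod 𝓘(ℝ, F))
      (fun y ↦ TotalSpace.mk' F y (t i y)) x := fun i ↦
    ((contMDiffOn_trivialization_symm_const e (b i)).contMDiffAt
      (e.open_baseSet.mem_nhds hx)).mdifferentiableAt (by simp)
  have hsymm : ∀ y ∈ e.baseSet, ∀ f : F, e.symm y f = ∑ i, b.coord i f • t i y := by
    intro y hy f
    conv_lhs => rw [← b.sum_repr f, ← e.symmL_apply (R := ℝ) hy, map_sum]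
    refine Finset.sum_congr rfl fun i _ ↦ ?_
    rw [map_smul, e.symmL_apply hy]
    rfl
  have hc : ∀ i, HasModelDerivAt (fun y ↦ b.coord i (sh y)) x
      ((LinearMap.toContinuousLinearMap (b.coord i)).comp (modelDeriv EX F sh x)) := fun i ↦
    HasModelDerivAt.comp (g := b.coord i) (hasModelDerivAt_iff_hasFDerivAt.2
      (LinearMap.toContinuousLinearMap (b.coord i)).hasFDerivAt) hshd.hasModelDerivAt rfl
  -- Leibniz rule for any section that is near `x` a combination of the frame. It is applied to `s`,
  -- with its coordinate functions, and to the section with these coordinates frozen at `x`; the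
  -- difference of the two results is the derivative of the coordinates.
  have hcs : ∀ c : Fin (Module.finrank ℝ F) → X → ℝ,
      (∀ i, MDifferentiableAt 𝓘(ℝ, EX) 𝓘(ℝ, ℝ) (c i) x) → ∀ s' : ∀ x, V x,
      (∀ᶠ y in 𝓝 x, s' y = ∑ i, c i y • t i y) →
      D s' x = ∑ i, (c i x • D (t i) x + (mvfderiv 𝓘(ℝ, EX) (c i) x).smulRight (t i x)) := by
    intro c hc s' hs'
    rw [← covariantDerivative_sum D Finset.univ hc htd]
    have h2 : MDifferentiableAt 𝓘(ℝ, EX) (𝓘(ℝ, EX).prod 𝓘(ℝ, F))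
        (fun y ↦ TotalSpace.mk' F y ((∑ i, c i • t i) y)) x := by
      have := MDifferentiableAt.sum_section (s := Finset.univ) (t := fun i ↦ c i • t i) (x₀ := x)
        fun i _ ↦ (hc i).smul_section (htd i)
      convert this using 2 with y
      simp [Finset.sum_apply]
    have h3 : ∀ᶠ y in 𝓝 x, s' y = (∑ i, c i • t i) y := by
      filter_upwards [hs'] with y hy
      rw [hy]
      simp [Finset.sum_apply]
    refine D.isCovariantDerivativeOn.congr_of_eventuallyEq (h2.congr_of_eventuallyEq ?_) h2
      Filter.univ_mem h3
    filter_upwards [h3] with y hy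
    rw [hy]
  have hbase : ∀ᶠ y in 𝓝 x, y ∈ e.baseSet := e.open_baseSet.mem_nhds hx
  rw [hcs (fun i y ↦ b.coord i (sh y)) (fun i ↦ (hc i).mdifferentiableAt) s (by
      filter_upwards [hbase] with y hy
      rw [← hsymm y hy, hsh, e.symm_apply_apply_mk hy]),
    hcs (fun i _ ↦ b.coord i (sh x)) (fun i ↦ mdifferentiableAt_const) _ (by
      filter_upwards [hbase] with y hy using hsymm y hy _), hsymm x hx]
  simp only [mvfderiv_const, sum_apply, add_apply, smul_apply,
    ContinuousLinearMap.smulRight_apply, zero_apply, zero_smul, Finset.sum_add_distrib,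
    Finset.sum_const_zero, add_zero]
  rw [add_comm]
  congr 1
  refine Finset.sum_congr rfl fun i _ ↦ ?_
  congr 1
  exact DFunLike.congr_fun (hc i).modelDeriv w

/-- The pullback connection can be computed in any trivialization. -/
theorem pullbackConnection_eq_of_trivialization (D : CovariantDerivative 𝓘(ℝ, EX) F V)
    (e : Trivialization F (TotalSpace.proj : TotalSpace F V → X)) [MemTrivializationAtlas e]
    {h : M → X} {p : M} (hp : h p ∈ e.baseSet)
    (hh : MDifferentiableAt 𝓘(ℝ, EM) 𝓘(ℝ, EX) h p) {σ : ∀ p, V (h p)}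
    (hσ : MDifferentiableAt 𝓘(ℝ, EM) 𝓘(ℝ, F) (fun q ↦ (e ⟨h q, σ q⟩).2) p)
    (v : EM) :
    pullbackConnection D h σ p v =
      e.symm (h p) (modelDeriv EM F (fun q ↦ (e ⟨h q, σ q⟩).2) p v)
        + D (fun y ↦ e.symm y (e ⟨h p, σ p⟩).2) (h p) (modelDeriv EM EX h p v) := by
  have : ContMDiffVectorBundle 1 F V 𝓘(ℝ, EX) := ContMDiffVectorBundle.of_le (n := ∞) (by simp)
  set e' := trivializationAt F V (h p) with he'
  have hp' : h p ∈ e'.baseSet := FiberBundle.mem_baseSet_trivializationAt' _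
  set T : X → F →L[ℝ] F := fun x ↦ (e.coordChangeL ℝ e' x : F →L[ℝ] F) with hT
  have hTd : MDifferentiableAt 𝓘(ℝ, EX) 𝓘(ℝ, F →L[ℝ] F) T (h p) :=
    ((contMDiffOn_coordChangeL (n := ∞) (IB := 𝓘(ℝ, EX)) e e').contMDiffAt
      ((e.open_baseSet.inter e'.open_baseSet).mem_nhds ⟨hp, hp'⟩)).mdifferentiableAt (by simp)
  set f := (e ⟨h p, σ p⟩).2 with hf
  obtain ⟨c, hc0, hc⟩ : ∃ c : ℝ → M, c 0 = p ∧ HasVelocityAt c v :=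
    ⟨_, by simp, hasVelocityAt_straight_curve (mem_extChartAt_source (I := 𝓘(ℝ, EM)) p) v⟩
  have hhc := hc.map hh.hasModelDerivAt hc0
  have hTc := hasVelocityAt_iff_hasDerivAt.1 (hhc.map hTd.hasModelDerivAt (by rw [hc0]))
  have hσc := hasVelocityAt_iff_hasDerivAt.1 (hc.map hσ.hasModelDerivAt hc0)
  -- Product rule for T ∘ h applied to the coordinates of σ, along a curve with velocity `v`; here
  -- `T` is the change of trivialization from `e` to `e'`.
  have hprod := hTc.clm_apply hσc
  have hTf : HasDerivAt (fun ε ↦ T (h (c ε)) f)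
      (modelDeriv EX (F →L[ℝ] F) T (h p) (modelDeriv EM EX h p v) f) 0 := by
    simpa using hTc.clm_apply (hasDerivAt_const (0 : ℝ) f)
  have hnear : ∀ᶠ x in 𝓝 (h p), x ∈ e.baseSet ∩ e'.baseSet :=
    (e.open_baseSet.inter e'.open_baseSet).mem_nhds ⟨hp, hp'⟩
  have hTe : ∀ x ∈ e.baseSet ∩ e'.baseSet, ∀ a : V x, T x (e ⟨x, a⟩).2 = (e' ⟨x, a⟩).2 := by
    intro x hx a
    show e.coordChangeL ℝ e' x _ = _
    rw [e.coordChangeL_apply e' hx, e.symm_apply_apply_mk hx.1]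
  have hTs : ∀ x ∈ e.baseSet ∩ e'.baseSet, ∀ f : F, T x f = (e' ⟨x, e.symm x f⟩).2 := by
    intro x hx f
    exact e.coordChangeL_apply e' hx f
  have hTsymm : ∀ x ∈ e.baseSet ∩ e'.baseSet, ∀ f : F, e'.symm x (T x f) = e.symm x f := by
    intro x hx f
    rw [hTs x hx, e'.symm_apply_apply_mk hx.2]
  -- the derivative of the coordinates in the canonical trivialization
  have hσ'd : MDifferentiableAt 𝓘(ℝ, EM) 𝓘(ℝ, F) (fun q ↦ (e' ⟨h q, σ q⟩).2) p := by
    have : MDifferentiableAt 𝓘(ℝ, EM) 𝓘(ℝ, F) (fun q ↦ T (h q) (e ⟨h q, σ q⟩).2) p :=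
      (hTd.comp p hh).clm_apply hσ
    refine this.congr_of_eventuallyEq ?_
    filter_upwards [hh.continuousAt.eventually hnear] with q hq using (hTe _ hq _).symm
  have hσ'c := hasVelocityAt_iff_hasDerivAt.1 (hc.map hσ'd.hasModelDerivAt hc0)
  have hct : Filter.Tendsto (fun ε ↦ h (c ε)) (𝓝 0) (𝓝 (h p)) := by
    have := (HasModelDerivAt.continuousAt hhc).tendsto
    rwa [hc0] at this
  have h1 := hσ'c.unique (hprod.congr_of_eventuallyEq (by
    filter_upwards [hct.eventually hnear] with ε hε using (hTe _ hε _).symm))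
  rw [hc0] at h1
  -- the covariant derivative of a constant section of the given trivialization
  set s : ∀ x, V x := fun y ↦ e.symm y f with hs
  have hsd : MDifferentiableAt 𝓘(ℝ, EX) (𝓘(ℝ, EX).prod 𝓘(ℝ, F))
      (fun y ↦ TotalSpace.mk' F y (s y)) (h p) :=
    ((contMDiffOn_trivialization_symm_const e f).contMDiffAt
      (e.open_baseSet.mem_nhds hp)).mdifferentiableAt (by simp)
  have hD := covariantDerivative_eq_of_trivialization D e' hp' hsd (modelDeriv EM EX h p v)
  have hsd' := (e'.mdifferentiableAt_section_iff 𝓘(ℝ, EX) s hp').1 hsd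
  have h2 := (hasVelocityAt_iff_hasDerivAt.1 (hhc.map hsd'.hasModelDerivAt (by rw [hc0]))).unique
    (hTf.congr_of_eventuallyEq (by
      filter_upwards [hct.eventually hnear] with ε hε using (hTs _ hε _).symm))
  have h3 : s (h p) = σ p := e.symm_apply_apply_mk hp _
  rw [h2, h3] at hD
  have hunf : pullbackConnection D h σ p v =
      e'.symm (h p) (modelDeriv EM F (fun q ↦ (e' ⟨h q, σ q⟩).2) p v)
        + D (fun y ↦ e'.symm y (e' ⟨h p, σ p⟩).2) (h p) (modelDeriv EM EX h p v) := rfl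
  -- The derivative of `T` appears on both sides: in the coordinates of σ for `e'`, and in the
  -- covariant derivative of the section that is constant for `e` but not for `e'`.
  rw [hunf, h1, hD, ← add_assoc]
  congr 1
  rw [add_comm, ← e'.symmL_apply (R := ℝ) hp', map_add, e'.symmL_apply hp', e'.symmL_apply hp',
    hTsymm _ ⟨hp, hp'⟩]

end Connections

/-! ### Vector fields and their Lie brackets in charts -/

section VectorFieldsInCharts

variable {E : Type*} [NormedAddCommGroup E] [NormedSpace ℝ E]
    {G : Type*} [TopologicalSpace G] [ChartedSpace E G] [IsManifold 𝓘(ℝ, E) ∞ G]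

/-- A vector field on `G` in the chart at `u`, in which it is a map from the model space to
itself. -/
def chartVectorField (u : G) (ξ : ∀ g : G, TangentSpace 𝓘(ℝ, E) g) (y : E) : E :=
  modelDeriv E E (extChartAt 𝓘(ℝ, E) u) ((extChartAt 𝓘(ℝ, E) u).symm y)
    (ξ ((extChartAt 𝓘(ℝ, E) u).symm y))

theorem contMDiffAt_of_contDiffAt_chartVectorField [IsManifold 𝓘(ℝ, E) 1 G] {u g : G}
    (hg : g ∈ (extChartAt 𝓘(ℝ, E) u).source) {ξ : ∀ g : G, TangentSpace 𝓘(ℝ, E) g}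
    (hξ : ContDiffAt ℝ ∞ (chartVectorField u ξ) (extChartAt 𝓘(ℝ, E) u g)) :
    ContMDiffAt 𝓘(ℝ, E) 𝓘(ℝ, E).tangent ∞
      (fun g ↦ (⟨g, ξ g⟩ : TangentBundle 𝓘(ℝ, E) G)) g := by
  have hg' : g ∈ (trivializationAt E (TangentSpace 𝓘(ℝ, E)) u).baseSet := by simpa using hg
  refine ((trivializationAt E (TangentSpace 𝓘(ℝ, E)) u).contMDiffAt_section_iff hg').2 ?_
  have h1 : ContMDiffAt 𝓘(ℝ, E) 𝓘(ℝ, E) ∞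
      (fun g ↦ chartVectorField u ξ (extChartAt 𝓘(ℝ, E) u g)) g :=
    ContMDiffAt.comp (g := chartVectorField u ξ) g hξ.contMDiffAt
      (contMDiffAt_extChartAt' (by simpa using hg))
  refine h1.congr_of_eventuallyEq ?_
  filter_upwards [(isOpen_extChartAt_source u).mem_nhds hg] with q hq
  refine (snd_trivializationAt_tangentSpace hq _).trans ?_
  unfold chartVectorField
  rw [(extChartAt 𝓘(ℝ, E) u).left_inv hq]

theorem contDiffAt_chartVectorField [IsManifold 𝓘(ℝ, E) 1 G] {u : G} {y : E}
    (hy : y ∈ (extChartAt 𝓘(ℝ, E) u).target) {ξ : ∀ g : G, TangentSpace 𝓘(ℝ, E) g}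
    (hξ : ContMDiffAt 𝓘(ℝ, E) 𝓘(ℝ, E).tangent ∞
      (fun g ↦ (⟨g, ξ g⟩ : TangentBundle 𝓘(ℝ, E) G)) ((extChartAt 𝓘(ℝ, E) u).symm y)) :
    ContDiffAt ℝ ∞ (chartVectorField u ξ) y := by
  have hg : (extChartAt 𝓘(ℝ, E) u).symm y ∈
      (trivializationAt E (TangentSpace 𝓘(ℝ, E)) u).baseSet := by
    simpa using (extChartAt 𝓘(ℝ, E) u).map_target hy
  have h1 := ((trivializationAt E (TangentSpace 𝓘(ℝ, E)) u).contMDiffAt_section_iff hg).1 hξ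
  have h2 := ContMDiffAt.comp y h1 (contMDiffAt_extChartAt_symm hy)
  rw [contMDiffAt_iff_contDiffAt] at h2
  refine h2.congr_of_eventuallyEq ?_
  filter_upwards [(isOpen_extChartAt_target u).mem_nhds hy] with z hz
  exact (snd_trivializationAt_tangentSpace ((extChartAt 𝓘(ℝ, E) u).map_target hz) _).symm

theorem mpullback_extChartAt_symm {u : G} (ξ : ∀ g : G, TangentSpace 𝓘(ℝ, E) g) {y : E}
    (hy : y ∈ (extChartAt 𝓘(ℝ, E) u).target) :
    VectorField.mpullback 𝓘(ℝ, E) 𝓘(ℝ, E) (extChartAt 𝓘(ℝ, E) u).symm ξ y =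
      chartVectorField u ξ y := by
  have h1 := modelDeriv_extChartAt_comp_symm hy
  have h2 := modelDeriv_symm_comp_extChartAt ((extChartAt 𝓘(ℝ, E) u).map_target hy)
  rw [(extChartAt 𝓘(ℝ, E) u).right_inv hy] at h2
  have h3 : (modelDeriv E E (extChartAt 𝓘(ℝ, E) u).symm y).inverse =
      modelDeriv E E (extChartAt 𝓘(ℝ, E) u) ((extChartAt 𝓘(ℝ, E) u).symm y) :=
    ContinuousLinearMap.inverse_eq h2 h1
  exact DFunLike.congr_fun h3 (ξ ((extChartAt 𝓘(ℝ, E) u).symm y))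

/-- The Lie bracket of vector fields, computed in a chart. -/
theorem chartVectorField_mlieBracket [CompleteSpace E] [IsManifold 𝓘(ℝ, E) 1 G] {u : G}
    {ξ η : ∀ g : G, TangentSpace 𝓘(ℝ, E) g} {y : E} (hy : y ∈ (extChartAt 𝓘(ℝ, E) u).target)
    (hξ : ContDiffAt ℝ ∞ (chartVectorField u ξ) y)
    (hη : ContDiffAt ℝ ∞ (chartVectorField u η) y) :
    chartVectorField u (VectorField.mlieBracket 𝓘(ℝ, E) ξ η) y =
      VectorField.lieBracket ℝ (chartVectorField u ξ) (chartVectorField u η) y := by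
  have : IsManifold 𝓘(ℝ, E) (minSmoothness ℝ 3) G := 
    IsManifold.of_le (n := ∞) (by simpa using ENat.LEInfty.out)
  set κ := extChartAt 𝓘(ℝ, E) u
  have hsm : ∀ {ξ : ∀ g : G, TangentSpace 𝓘(ℝ, E) g}, ContDiffAt ℝ ∞ (chartVectorField u ξ) y →
      MDifferentiableAt 𝓘(ℝ, E) 𝓘(ℝ, E).tangent
        (fun g ↦ (⟨g, ξ g⟩ : TangentBundle 𝓘(ℝ, E) G)) (κ.symm y) := fun hξ ↦
    (contMDiffAt_of_contDiffAt_chartVectorField (κ.map_target hy)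
      (by rwa [κ.right_inv hy])).mdifferentiableAt (by simp)
  -- The bracket is natural under pullback by the inverse chart, and on the target of the chart this
  -- pullback is `chartVectorField`.
  have h1 := VectorField.mpullback_mlieBracket (f := κ.symm) (x₀ := y) (hsm hξ) (hsm hη)
    (contMDiffAt_extChartAt_symm hy) (n := ∞) (by simpa using ENat.LEInfty.out)
  rw [mpullback_extChartAt_symm _ hy] at h1
  have h3 : ∀ V W : E → E, (VectorField.mlieBracket 𝓘(ℝ, E) V W y : E) =
      VectorField.lieBracket ℝ V W y := fun V W ↦ by
    rw [← VectorField.lieBracketWithin_univ]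
    exact congrFun VectorField.mlieBracketWithin_eq_lieBracketWithin y
  have hnear : ∀ ξ : ∀ g : G, TangentSpace 𝓘(ℝ, E) g,
      VectorField.mpullback 𝓘(ℝ, E) 𝓘(ℝ, E) κ.symm ξ =ᶠ[𝓝 y] chartVectorField u ξ := fun ξ ↦ by
    filter_upwards [(isOpen_extChartAt_target u).mem_nhds hy] with z hz
      using mpullback_extChartAt_symm ξ hz
  exact h1.trans (((hnear ξ).mlieBracket_vectorField_eq (hnear η)).trans (h3 _ _))

/-- The vector field on the domain of the chart at `u` which is constant in this chart. -/
def constVectorField (u : G) (v : E) (g : G) : TangentSpace 𝓘(ℝ, E) g :=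
  modelDeriv E E (extChartAt 𝓘(ℝ, E) u).symm (extChartAt 𝓘(ℝ, E) u g) v

theorem chartVectorField_constVectorField {u : G} (v : E) {y : E}
    (hy : y ∈ (extChartAt 𝓘(ℝ, E) u).target) :
    chartVectorField u (constVectorField u v) y = v := by
  have h := DFunLike.congr_fun (modelDeriv_extChartAt_comp_symm hy) v
  unfold chartVectorField constVectorField
  rw [(extChartAt 𝓘(ℝ, E) u).right_inv hy]
  exact h

theorem contDiffAt_chartVectorField_constVectorField {u : G} (v : E) {y : E}
    (hy : y ∈ (extChartAt 𝓘(ℝ, E) u).target) :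
    ContDiffAt ℝ ∞ (chartVectorField u (constVectorField u v)) y := by
  refine (contDiffAt_const (c := v)).congr_of_eventuallyEq ?_
  filter_upwards [(isOpen_extChartAt_target u).mem_nhds hy] with z hz
    using chartVectorField_constVectorField v hz

theorem contMDiffOn_constVectorField [IsManifold 𝓘(ℝ, E) 1 G] (u : G) (v : E) :
    ContMDiffOn 𝓘(ℝ, E) 𝓘(ℝ, E).tangent ∞
      (fun g ↦ (⟨g, constVectorField u v g⟩ : TangentBundle 𝓘(ℝ, E) G))
      (extChartAt 𝓘(ℝ, E) u).source := fun _ hg ↦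
  (contMDiffAt_of_contDiffAt_chartVectorField hg (contDiffAt_chartVectorField_constVectorField v
    ((extChartAt 𝓘(ℝ, E) u).map_source hg))).contMDiffWithinAt

/-- In the chart both fields are constant, and the derivative of the chart is injective. On such
fields the term θ([ξ₁, ξ₂]) of the Maurer–Cartan equation disappears. -/
theorem mlieBracket_constVectorField [CompleteSpace E] [IsManifold 𝓘(ℝ, E) 1 G] {u g : G}
    (hg : g ∈ (extChartAt 𝓘(ℝ, E) u).source) (v w : E) :
    VectorField.mlieBracket 𝓘(ℝ, E) (constVectorField u v) (constVectorField u w) g = 0 := by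
  set κ := extChartAt 𝓘(ℝ, E) u
  have hy := κ.map_source hg
  have h1 := chartVectorField_mlieBracket hy (contDiffAt_chartVectorField_constVectorField v hy)
    (contDiffAt_chartVectorField_constVectorField w hy)
  have hc : ∀ v : E, fderiv ℝ (chartVectorField u (constVectorField u v)) (κ g) = 0 := fun v ↦ by
    have : chartVectorField u (constVectorField u v) =ᶠ[𝓝 (κ g)] fun _ ↦ v := by
      filter_upwards [(isOpen_extChartAt_target u).mem_nhds hy] with z hz
        using chartVectorField_constVectorField v hz
    rw [this.fderiv_eq]
    simp
  rw [VectorField.lieBracket, hc, hc, zero_apply, zero_apply, sub_zero] at h1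
  unfold chartVectorField at h1
  rw [κ.left_inv hg] at h1
  have h2 : ∀ ζ : E, modelDeriv E E κ g ζ = 0 → ζ = 0 := fun ζ hζ ↦ by
    have h2 := DFunLike.congr_fun (modelDeriv_symm_comp_extChartAt hg) ζ
    rw [ContinuousLinearMap.comp_apply, hζ, map_zero] at h2
    exact h2.symm
  exact h2 _ h1

end VectorFieldsInCharts

theorem contDiffAt_clm_apply_iff {E E' D : Type*} [NormedAddCommGroup E] [NormedSpace ℝ E]
    [NormedAddCommGroup E'] [NormedSpace ℝ E'] [NormedAddCommGroup D] [NormedSpace ℝ D]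
    [FiniteDimensional ℝ E] {f : D → E →L[ℝ] E'} {x : D} {n : WithTop ℕ∞} :
    ContDiffAt ℝ n f x ↔ ∀ v, ContDiffAt ℝ n (fun y ↦ f y v) x := by
  refine ⟨fun h v ↦ h.clm_apply contDiffAt_const, fun h ↦ ?_⟩
  let e₁ := (ContinuousLinearEquiv.ofFinrankEq (Module.finrank_fin_fun ℝ
    (n := Module.finrank ℝ E)).symm : E ≃L[ℝ] _)
  let e₂ := (e₁.arrowCongr (1 : E' ≃L[ℝ] E')).trans
    (ContinuousLinearEquiv.piRing (Fin (Module.finrank ℝ E)))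
  rw [← Function.id_comp f, ← e₂.symm_comp_self]
  exact e₂.symm.contDiff.contDiffAt.comp x (contDiffAt_pi.2 fun i ↦ h _)

/-! ### The generalized Maurer–Cartan equation in coordinates -/

section LocalRepresentatives

variable {EX EG EM F : Type*}
  [NormedAddCommGroup EX] [NormedSpace ℝ EX] [FiniteDimensional ℝ EX]
  [NormedAddCommGroup EG] [NormedSpace ℝ EG] [FiniteDimensional ℝ EG]
  [NormedAddCommGroup EM] [NormedSpace ℝ EM] [FiniteDimensional ℝ EM]
  [NormedAddCommGroup F] [NormedSpace ℝ F] [FiniteDimensional ℝ F]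
  {X : Type*} [TopologicalSpace X] [ChartedSpace EX X] [IsManifold 𝓘(ℝ, EX) ∞ X] [T2Space X]
  {G : Type*} [TopologicalSpace G] [ChartedSpace EG G] [IsManifold 𝓘(ℝ, EG) ∞ G]
  {M : Type*} [TopologicalSpace M] [ChartedSpace EM M] [IsManifold 𝓘(ℝ, EM) ∞ M] [T2Space M]
  {V : X → Type*} [∀ x, AddCommGroup (V x)] [∀ x, Module ℝ (V x)]
  [∀ x, TopologicalSpace (V x)] [∀ x, IsTopologicalAddGroup (V x)]
  [∀ x, ContinuousSMul ℝ (V x)] [TopologicalSpace (TotalSpace F V)]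
  [FiberBundle F V] [VectorBundle ℝ F V] [ContMDiffVectorBundle ∞ F V 𝓘(ℝ, EX)]
  {A : LieAlgebroid EX F V} {𝒢 : LieGroupoid EX EG X G}
  {ι : ∀ x : X, V x →L[ℝ] TangentSpace 𝓘(ℝ, EG) (𝒢.unit x)} {h : M → X}

namespace LieAlgebroid.OneForm

/-- A 1-form at a point, as a linear map on the model space. -/
def modelMap (θ : A.OneForm (EM := EM) h) (p : M) : EM →L[ℝ] V (h p) :=
  θ.toFun p

theorem anchor_modelMap (θ : A.OneForm (EM := EM) h) (p : M) (v : EM) :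
    A.anchor (h p) (θ.modelMap p v) = modelDeriv EM EX h p v :=
  θ.anchor_comp p v

/-- A 1-form with values in `A`, in the chart at `p₀` and a trivialization of `V`. -/
def coord (θ : A.OneForm (EM := EM) h)
    (e : Trivialization F (TotalSpace.proj : TotalSpace F V → X)) [MemTrivializationAtlas e]
    (p₀ : M) (z : EM) : EM →L[ℝ] F :=
  (e.continuousLinearMapAt ℝ (h ((extChartAt 𝓘(ℝ, EM) p₀).symm z))).comp
    ((θ.modelMap ((extChartAt 𝓘(ℝ, EM) p₀).symm z)).comp
      (modelDeriv EM EM (extChartAt 𝓘(ℝ, EM) p₀).symm z))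

variable (θ : A.OneForm (EM := EM) h)
  (e : Trivialization F (TotalSpace.proj : TotalSpace F V → X)) [MemTrivializationAtlas e]
  {p₀ : M}

theorem symm_coord {z : EM} (hz : h ((extChartAt 𝓘(ℝ, EM) p₀).symm z) ∈ e.baseSet) (w : EM) :
    e.symm (h ((extChartAt 𝓘(ℝ, EM) p₀).symm z)) (θ.coord e p₀ z w) =
      θ.modelMap ((extChartAt 𝓘(ℝ, EM) p₀).symm z)
        (modelDeriv EM EM (extChartAt 𝓘(ℝ, EM) p₀).symm z w) := by
  rw [← e.symmL_apply (R := ℝ) hz]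
  exact e.symmL_continuousLinearMapAt hz _

theorem coord_extChartAt {q : M} (hq : q ∈ (extChartAt 𝓘(ℝ, EM) p₀).source)
    (hb : h q ∈ e.baseSet) (w : EM) :
    θ.coord e p₀ (extChartAt 𝓘(ℝ, EM) p₀ q) w =
      (e ⟨h q, θ.toFun q (constVectorField p₀ w q)⟩).2 := by
  have h1 : θ.coord e p₀ (extChartAt 𝓘(ℝ, EM) p₀ q) w =
      (e.continuousLinearMapAt ℝ (h q)) (θ.modelMap q
        (modelDeriv EM EM (extChartAt 𝓘(ℝ, EM) p₀).symm (extChartAt 𝓘(ℝ, EM) p₀ q) w)) := by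
    rw [coord, (extChartAt 𝓘(ℝ, EM) p₀).left_inv hq]
    rfl
  rw [h1, e.continuousLinearMapAt_apply (R := ℝ), e.linearMapAt_apply (R := ℝ), if_pos hb]
  rfl

theorem contMDiffAt_snd_constVectorField {q : M} (hq : q ∈ (extChartAt 𝓘(ℝ, EM) p₀).source)
    (hb : h q ∈ e.baseSet) (w : EM) :
    ContMDiffAt 𝓘(ℝ, EM) 𝓘(ℝ, F) ∞
      (fun q ↦ (e ⟨h q, θ.toFun q (constVectorField p₀ w q)⟩).2) q := by
  have : IsManifold 𝓘(ℝ, EM) 1 M := IsManifold.of_le (n := ∞) (by simp)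
  have h1 := (contMDiffOn_constVectorField p₀ w).contMDiffAt
    ((isOpen_extChartAt_source (I := 𝓘(ℝ, EM)) p₀).mem_nhds hq)
  have h2 := ContMDiffAt.comp (g := fun w : TangentBundle 𝓘(ℝ, EM) M ↦
    (⟨h w.proj, θ.toFun w.proj w.snd⟩ : TotalSpace F V)) q (θ.contMDiff_toFun _) h1
  exact ((e.contMDiffAt_iff (IB := 𝓘(ℝ, EX)) (by simpa [e.mem_source] using hb)).1 h2).2

/-- In finite dimension smoothness of an operator-valued map can be tested on vectors, and on `w`
the coordinate form is θ applied to the field that is constant in the chart. -/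
theorem contDiffAt_coord {z : EM} (hz : z ∈ (extChartAt 𝓘(ℝ, EM) p₀).target)
    (hb : h ((extChartAt 𝓘(ℝ, EM) p₀).symm z) ∈ e.baseSet) : ContDiffAt ℝ ∞ (θ.coord e p₀) z := by
  set κ := extChartAt 𝓘(ℝ, EM) p₀
  rw [contDiffAt_clm_apply_iff]
  intro w
  have h1 : ContMDiffAt 𝓘(ℝ, EM) 𝓘(ℝ, F) ∞ (fun z ↦
      (e ⟨h (κ.symm z), θ.toFun (κ.symm z) (constVectorField p₀ w (κ.symm z))⟩).2) z :=
    ContMDiffAt.comp (f := κ.symm)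
      (g := fun q ↦ (e ⟨h q, θ.toFun q (constVectorField p₀ w q)⟩).2) z
      (θ.contMDiffAt_snd_constVectorField e (κ.map_target hz) hb w) (contMDiffAt_extChartAt_symm hz)
  rw [contMDiffAt_iff_contDiffAt] at h1
  refine h1.congr_of_eventuallyEq ?_
  have hc : ContinuousAt (fun z ↦ h (κ.symm z)) z :=
    (θ.contMDiff_base _).continuousAt.comp (contMDiffAt_extChartAt_symm hz).continuousAt
  filter_upwards [(isOpen_extChartAt_target p₀).mem_nhds hz,
    hc.eventually (e.open_baseSet.mem_nhds hb)] with y hy hyb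
  have := θ.coord_extChartAt e (κ.map_target hy) hyb w
  rwa [κ.right_inv hy] at this

/-- The generalized Maurer–Cartan equation in a chart. -/
theorem MaurerCartanEquation.coord {θ : A.OneForm (EM := EM) h}
    {D : CovariantDerivative 𝓘(ℝ, EX) F V} (hθ : θ.MaurerCartanEquation D) {z : EM}
    (hz : z ∈ (extChartAt 𝓘(ℝ, EM) p₀).target)
    (hb : h ((extChartAt 𝓘(ℝ, EM) p₀).symm z) ∈ e.baseSet) (v w : EM)
    {α β : Cₛ^∞⟮𝓘(ℝ, EX); F, V⟯}
    (hα : ∀ᶠ x in 𝓝 (h ((extChartAt 𝓘(ℝ, EM) p₀).symm z)), α x = e.symm x (θ.coord e p₀ z v))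
    (hβ : ∀ᶠ x in 𝓝 (h ((extChartAt 𝓘(ℝ, EM) p₀).symm z)), β x = e.symm x (θ.coord e p₀ z w)) :
    e.symm (h ((extChartAt 𝓘(ℝ, EM) p₀).symm z))
        (fderiv ℝ (θ.coord e p₀) z v w - fderiv ℝ (θ.coord e p₀) z w v)
      + A.bracket α β (h ((extChartAt 𝓘(ℝ, EM) p₀).symm z)) = 0 := by
  have hM : IsManifold 𝓘(ℝ, EM) 1 M := IsManifold.of_le (n := ∞) (by simp)
  have hE : CompleteSpace EM := FiniteDimensional.complete ℝ EM
  set κ := extChartAt 𝓘(ℝ, EM) p₀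
  set p := κ.symm z with hp
  have hps : p ∈ κ.source := κ.map_target hz
  have hκp : κ p = z := κ.right_inv hz
  -- The equation is assumed only for global fields, so the fields that are constant in the chart
  -- are replaced by global ones with the same germ at `p`.
  obtain ⟨ξ, hξ⟩ := exists_smooth_section_eventuallyEq (isOpen_extChartAt_source (I := 𝓘(ℝ, EM)) p₀)
    (contMDiffOn_constVectorField p₀ v) hps
  obtain ⟨η, hη⟩ := exists_smooth_section_eventuallyEq (isOpen_extChartAt_source (I := 𝓘(ℝ, EM)) p₀)
    (contMDiffOn_constVectorField p₀ w) hps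
  have hh : MDifferentiableAt 𝓘(ℝ, EM) 𝓘(ℝ, EX) h p :=
    (θ.contMDiff_base p).mdifferentiableAt (by simp)
  have hhb : ∀ᶠ q in 𝓝 p, h q ∈ e.baseSet :=
    hh.continuousAt.eventually (e.open_baseSet.mem_nhds hb)
  have hsrc : ∀ᶠ q in 𝓝 p, q ∈ κ.source := (isOpen_extChartAt_source p₀).mem_nhds hps
  have hcd : DifferentiableAt ℝ (θ.coord e p₀) z :=
    (θ.contDiffAt_coord e hz hb).differentiableAt (by simp)
  -- the pullback connection
  have key : ∀ (ζ : Cₛ^∞⟮𝓘(ℝ, EM); EM, (TangentSpace 𝓘(ℝ, EM) : M → Type _)⟯) (w : EM),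
      (∀ᶠ q in 𝓝 p, ζ q = constVectorField p₀ w q) → ∀ u : EM,
      pullbackConnection D h (fun q ↦ θ.toFun q (ζ q)) p u =
        e.symm (h p) (fderiv ℝ (θ.coord e p₀) z (modelDeriv EM EM κ p u) w)
          + D (fun y ↦ e.symm y (θ.coord e p₀ z w)) (h p) (modelDeriv EM EX h p u) := by
    intro ζ w hζ u
    have h1 : (fun q ↦ (e ⟨h q, θ.toFun q (ζ q)⟩).2) =ᶠ[𝓝 p] fun q ↦ θ.coord e p₀ (κ q) w := by
      filter_upwards [hζ, hhb, hsrc] with q hq hqb hqs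
      rw [hq, θ.coord_extChartAt e hqs hqb]
    have h2 : HasModelDerivAt (fun z ↦ θ.coord e p₀ z w) z
        ((fderiv ℝ (θ.coord e p₀) z).flip w) := by
      rw [hasModelDerivAt_iff_hasFDerivAt]
      exact (hcd.hasFDerivAt.clm_apply (hasFDerivAt_const w z)).congr_fderiv (by ext; simp)
    have h3 := (h2.comp (hasModelDerivAt_extChartAt hps) hκp).congr_of_eventuallyEq h1
    refine (pullbackConnection_eq_of_trivialization D e hb hh h3.mdifferentiableAt u).trans ?_
    have h4 : (e ⟨h p, θ.toFun p (ζ p)⟩).2 = θ.coord e p₀ z w :=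
      h1.self_of_nhds.trans (congrArg (fun z ↦ θ.coord e p₀ z w) hκp)
    rw [h3.modelDeriv, h4]
    rfl
  have hconst : ∀ v : EM, modelDeriv EM EM κ p (constVectorField p₀ v p) = v := by
    intro v
    unfold constVectorField
    rw [hκp]
    exact DFunLike.congr_fun (modelDeriv_extChartAt_comp_symm hz) v
  have hξp : ξ p = constVectorField p₀ v p := hξ.self_of_nhds
  have hηp : η p = constVectorField p₀ w p := hη.self_of_nhds
  have hlie : VectorField.mlieBracket 𝓘(ℝ, EM) ξ η p = 0 := by
    rw [← mlieBracket_constVectorField hps v w]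
    exact Filter.EventuallyEq.mlieBracket_vectorField_eq hξ hη
  have hαp : α (h p) = θ.toFun p (ξ p) := by
    rw [hα.self_of_nhds, hξp]
    refine (θ.symm_coord e hb v).trans ?_
    unfold constVectorField
    rw [hκp]
    rfl
  have hβp : β (h p) = θ.toFun p (η p) := by
    rw [hβ.self_of_nhds, hηp]
    refine (θ.symm_coord e hb w).trans ?_
    unfold constVectorField
    rw [hκp]
    rfl
  have hD : ∀ (α : Cₛ^∞⟮𝓘(ℝ, EX); F, V⟯) (f : F), (∀ᶠ x in 𝓝 (h p), α x = e.symm x f) →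
      D (fun y ↦ e.symm y f) (h p) = D α (h p) := by
    intro α f hα
    exact D.isCovariantDerivativeOn.congr_of_eventuallyEq
      (((contMDiffOn_trivialization_symm_const e f).contMDiffAt
        (e.open_baseSet.mem_nhds hb)).mdifferentiableAt (by simp))
      (α.contMDiff.mdifferentiable (by simp) _) Filter.univ_mem
      (by filter_upwards [hα] with x hx using hx.symm)
  -- Compatibility with the anchors: the direction dh(ξ) of the pullback connection is the direction
  -- ♯α of the torsion.
  have ha : modelDeriv EM EX h p (ξ p) = A.anchor (h p) (α (h p)) := by
    rw [hαp]
    exact (θ.anchor_modelMap p _).symm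
  have hb' : modelDeriv EM EX h p (η p) = A.anchor (h p) (β (h p)) := by
    rw [hβp]
    exact (θ.anchor_modelMap p _).symm
  have k1 : pullbackConnection D h (fun q ↦ θ.toFun q (η q)) p (ξ p) =
      e.symm (h p) (fderiv ℝ (θ.coord e p₀) z v w) + D β (h p) (A.anchor (h p) (α (h p))) := by
    refine (key η w hη (ξ p)).trans ?_
    rw [hD _ _ hβ, ha, hξp, hconst]
  have k2 : pullbackConnection D h (fun q ↦ θ.toFun q (ξ q)) p (η p) =
      e.symm (h p) (fderiv ℝ (θ.coord e p₀) z w v) + D α (h p) (A.anchor (h p) (β (h p))) := by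
    refine (key ξ v hξ (η p)).trans ?_
    rw [hD _ _ hα, hb', hηp, hconst]
  -- The terms ∇_{♯α}β and ∇_{♯β}α of d_∇θ cancel against those of the torsion, and of the torsion
  -- only the bracket survives. The factor ½ compensates the two equal terms in `bracketNabla`.
  have hMC := hθ ξ η p
  simp only [dNabla, bracketNabla, ← hαp, ← hβp, A.torsion_eq_sectionTorsion, hlie, map_zero,
    sub_zero, k1, k2, sectionTorsion] at hMC
  rw [← e.symmL_apply (R := ℝ) hb, map_sub, e.symmL_apply hb, e.symmL_apply hb, ← hMC]
  module

end LieAlgebroid.OneForm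

end LocalRepresentatives

/-! ### The integrability condition in coordinates -/

namespace LieGroupoid

section RightCoord

variable {EX EG EM F : Type*}
  [NormedAddCommGroup EX] [NormedSpace ℝ EX] [FiniteDimensional ℝ EX]
  [NormedAddCommGroup EG] [NormedSpace ℝ EG] [FiniteDimensional ℝ EG]
  [NormedAddCommGroup EM] [NormedSpace ℝ EM] [FiniteDimensional ℝ EM]
  [NormedAddCommGroup F] [NormedSpace ℝ F] [FiniteDimensional ℝ F]
  {X : Type*} [TopologicalSpace X] [ChartedSpace EX X] [IsManifold 𝓘(ℝ, EX) ∞ X] [T2Space X]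
  {G : Type*} [TopologicalSpace G] [ChartedSpace EG G] [IsManifold 𝓘(ℝ, EG) ∞ G]
  {M : Type*} [TopologicalSpace M] [ChartedSpace EM M] [IsManifold 𝓘(ℝ, EM) ∞ M] [T2Space M]
  {V : X → Type*} [∀ x, AddCommGroup (V x)] [∀ x, Module ℝ (V x)]
  [∀ x, TopologicalSpace (V x)] [∀ x, IsTopologicalAddGroup (V x)]
  [∀ x, ContinuousSMul ℝ (V x)] [TopologicalSpace (TotalSpace F V)]
  [FiberBundle F V] [VectorBundle ℝ F V] [ContMDiffVectorBundle ∞ F V 𝓘(ℝ, EX)]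
  {A : LieAlgebroid EX F V} (𝒢 : LieGroupoid EX EG X G)
  (ι : ∀ x : X, V x →L[ℝ] TangentSpace 𝓘(ℝ, EG) (𝒢.unit x)) {h : M → X}
  (e : Trivialization F (TotalSpace.proj : TotalSpace F V → X)) [MemTrivializationAtlas e]

/-- The right invariant vector fields of sections which are constant in a trivialization of `V`, in
the chart at `g₀`. -/
def rightCoord (g₀ : G) (y : EG) : F →L[ℝ] EG :=
  (modelDeriv EG EG (extChartAt 𝓘(ℝ, EG) g₀) ((extChartAt 𝓘(ℝ, EG) g₀).symm y)).comp
    ((𝒢.rightTangent ι ((extChartAt 𝓘(ℝ, EG) g₀).symm y)).comp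
      (e.symmL ℝ (𝒢.tgt ((extChartAt 𝓘(ℝ, EG) g₀).symm y))))

variable {𝒢 ι e} {g₀ : G} {y : EG}

theorem rightCoord_apply (hb : 𝒢.tgt ((extChartAt 𝓘(ℝ, EG) g₀).symm y) ∈ e.baseSet) (f : F) :
    𝒢.rightCoord ι e g₀ y f =
      modelDeriv EG EG (extChartAt 𝓘(ℝ, EG) g₀) ((extChartAt 𝓘(ℝ, EG) g₀).symm y)
        (𝒢.rightTangent ι ((extChartAt 𝓘(ℝ, EG) g₀).symm y)
          (e.symm (𝒢.tgt ((extChartAt 𝓘(ℝ, EG) g₀).symm y)) f)) := by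
  rw [← e.symmL_apply (R := ℝ) hb]
  rfl

theorem chartVectorField_rightInvariantField (α : ∀ x, V x) :
    chartVectorField g₀ (𝒢.rightInvariantField ι α) y =
      modelDeriv EG EG (extChartAt 𝓘(ℝ, EG) g₀) ((extChartAt 𝓘(ℝ, EG) g₀).symm y)
        (𝒢.rightTangent ι ((extChartAt 𝓘(ℝ, EG) g₀).symm y)
          (α (𝒢.tgt ((extChartAt 𝓘(ℝ, EG) g₀).symm y)))) :=
  congrArg (modelDeriv EG EG (extChartAt 𝓘(ℝ, EG) g₀) ((extChartAt 𝓘(ℝ, EG) g₀).symm y))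
    (rightInvariantField_eq α _)

theorem eventually_tgt_mem_baseSet (hy : y ∈ (extChartAt 𝓘(ℝ, EG) g₀).target)
    {P : X → Prop} (hb : ∀ᶠ x in 𝓝 (𝒢.tgt ((extChartAt 𝓘(ℝ, EG) g₀).symm y)), P x) :
    ∀ᶠ z in 𝓝 y, P (𝒢.tgt ((extChartAt 𝓘(ℝ, EG) g₀).symm z)) :=
  ((𝒢.contMDiff_tgt _).continuousAt.comp
    (contMDiffAt_extChartAt_symm hy).continuousAt).eventually hb

namespace Integrates

variable (hι : 𝒢.Integrates A ι)
include hι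

theorem contDiffAt_chartVectorField_rightInvariantField
    (hy : y ∈ (extChartAt 𝓘(ℝ, EG) g₀).target) {α : ∀ x, V x}
    (hα : ContMDiffAt 𝓘(ℝ, EX) (𝓘(ℝ, EX).prod 𝓘(ℝ, F)) ∞
      (fun x ↦ (⟨x, α x⟩ : TotalSpace F V)) (𝒢.tgt ((extChartAt 𝓘(ℝ, EG) g₀).symm y))) :
    ContDiffAt ℝ ∞ (chartVectorField g₀ (𝒢.rightInvariantField ι α)) y := by
  have h1 := hι.contDiffAt_rightTangent ((extChartAt 𝓘(ℝ, EG) g₀).map_target hy) hα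
  rw [(extChartAt 𝓘(ℝ, EG) g₀).right_inv hy] at h1
  exact h1.congr_of_eventuallyEq
    (Filter.Eventually.of_forall fun z ↦ chartVectorField_rightInvariantField α)

theorem contDiffAt_rightCoord (hy : y ∈ (extChartAt 𝓘(ℝ, EG) g₀).target)
    (hb : 𝒢.tgt ((extChartAt 𝓘(ℝ, EG) g₀).symm y) ∈ e.baseSet) :
    ContDiffAt ℝ ∞ (𝒢.rightCoord ι e g₀) y := by
  rw [contDiffAt_clm_apply_iff]
  intro f
  have h1 := hι.contDiffAt_chartVectorField_rightInvariantField hy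
    ((contMDiffOn_trivialization_symm_const (EX := EX) e f).contMDiffAt
      (e.open_baseSet.mem_nhds hb))
  refine h1.congr_of_eventuallyEq ?_
  filter_upwards [eventually_tgt_mem_baseSet hy (e.open_baseSet.mem_nhds hb)] with z hz
  rw [rightCoord_apply hz, chartVectorField_rightInvariantField]

/-- The bracket of the Lie algebroid in a chart of the Lie groupoid. -/
theorem fderiv_rightCoord_sub (hy : y ∈ (extChartAt 𝓘(ℝ, EG) g₀).target)
    (hb : 𝒢.tgt ((extChartAt 𝓘(ℝ, EG) g₀).symm y) ∈ e.baseSet) {f f' : F}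
    {α β : Cₛ^∞⟮𝓘(ℝ, EX); F, V⟯}
    (hα : ∀ᶠ x in 𝓝 (𝒢.tgt ((extChartAt 𝓘(ℝ, EG) g₀).symm y)), α x = e.symm x f)
    (hβ : ∀ᶠ x in 𝓝 (𝒢.tgt ((extChartAt 𝓘(ℝ, EG) g₀).symm y)), β x = e.symm x f') :
    fderiv ℝ (𝒢.rightCoord ι e g₀) y (𝒢.rightCoord ι e g₀ y f) f'
        - fderiv ℝ (𝒢.rightCoord ι e g₀) y (𝒢.rightCoord ι e g₀ y f') f =
      modelDeriv EG EG (extChartAt 𝓘(ℝ, EG) g₀) ((extChartAt 𝓘(ℝ, EG) g₀).symm y)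
        (𝒢.rightTangent ι ((extChartAt 𝓘(ℝ, EG) g₀).symm y)
          (A.bracket α β (𝒢.tgt ((extChartAt 𝓘(ℝ, EG) g₀).symm y)))) := by
  have hG : IsManifold 𝓘(ℝ, EG) 1 G := IsManifold.of_le (n := ∞) (by simp)
  have hE : CompleteSpace EG := FiniteDimensional.complete ℝ EG
  have hR : HasFDerivAt (𝒢.rightCoord ι e g₀) (fderiv ℝ (𝒢.rightCoord ι e g₀) y) y :=
    ((hι.contDiffAt_rightCoord hy hb).differentiableAt (by simp)).hasFDerivAt
  -- Near `y` the chart expression of the right invariant field of α is `rightCoord` applied to the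
  -- fixed vector `f`, so its derivative is that of `rightCoord` with `f` inserted.
  have key : ∀ {f : F} {α : Cₛ^∞⟮𝓘(ℝ, EX); F, V⟯},
      (∀ᶠ x in 𝓝 (𝒢.tgt ((extChartAt 𝓘(ℝ, EG) g₀).symm y)), α x = e.symm x f) →
      chartVectorField g₀ (𝒢.rightInvariantField ι α) y = 𝒢.rightCoord ι e g₀ y f ∧
      ∀ u, fderiv ℝ (chartVectorField g₀ (𝒢.rightInvariantField ι α)) y u =
        fderiv ℝ (𝒢.rightCoord ι e g₀) y u f := by
    intro f α hα
    have h1 : chartVectorField g₀ (𝒢.rightInvariantField ι α) =ᶠ[𝓝 y]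
        fun z ↦ 𝒢.rightCoord ι e g₀ z f := by
      filter_upwards [eventually_tgt_mem_baseSet hy (e.open_baseSet.mem_nhds hb),
        eventually_tgt_mem_baseSet hy hα] with z hz hz'
      rw [rightCoord_apply hz, chartVectorField_rightInvariantField, hz']
    refine ⟨h1.self_of_nhds, fun u ↦ ?_⟩
    rw [h1.fderiv_eq, (hR.clm_apply (hasFDerivAt_const f y)).fderiv]
    simp
  have h1 := chartVectorField_mlieBracket hy
    (hι.contDiffAt_chartVectorField_rightInvariantField hy α.contMDiff.contMDiffAt)
    (hι.contDiffAt_chartVectorField_rightInvariantField hy β.contMDiff.contMDiffAt)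
  rw [VectorField.lieBracket, (key hα).2, (key hβ).2, (key hα).1, (key hβ).1,
    show VectorField.mlieBracket 𝓘(ℝ, EG) (𝒢.rightInvariantField ι α) (𝒢.rightInvariantField ι β) =
      𝒢.rightInvariantField ι (A.bracket α β) from funext (hι.bracket α β),
    chartVectorField_rightInvariantField] at h1
  exact h1.symm

/-- The generalized Maurer–Cartan equation is the integrability condition for the total differential
equation `dφ = dR_φ θ`, in charts. -/
theorem integrability {θ : A.OneForm (EM := EM) h} {D : CovariantDerivative 𝓘(ℝ, EX) F V}
    (hθ : θ.MaurerCartanEquation D) {p₀ : M} {z : EM}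
    (hz : z ∈ (extChartAt 𝓘(ℝ, EM) p₀).target) (hy : y ∈ (extChartAt 𝓘(ℝ, EG) g₀).target)
    (hyz : 𝒢.tgt ((extChartAt 𝓘(ℝ, EG) g₀).symm y) = h ((extChartAt 𝓘(ℝ, EM) p₀).symm z))
    (hb : 𝒢.tgt ((extChartAt 𝓘(ℝ, EG) g₀).symm y) ∈ e.baseSet) (v w : EM) :
    fderiv ℝ (𝒢.rightCoord ι e g₀) y (𝒢.rightCoord ι e g₀ y (θ.coord e p₀ z v)) (θ.coord e p₀ z w)
      - fderiv ℝ (𝒢.rightCoord ι e g₀) y (𝒢.rightCoord ι e g₀ y (θ.coord e p₀ z w))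
        (θ.coord e p₀ z v)
      + 𝒢.rightCoord ι e g₀ y (fderiv ℝ (θ.coord e p₀) z v w - fderiv ℝ (θ.coord e p₀) z w v)
      = 0 := by
  obtain ⟨α, hα⟩ := exists_smooth_section_eventuallyEq (EX := EX) e.open_baseSet
    (contMDiffOn_trivialization_symm_const e (θ.coord e p₀ z v)) hb
  obtain ⟨β, hβ⟩ := exists_smooth_section_eventuallyEq (EX := EX) e.open_baseSet
    (contMDiffOn_trivialization_symm_const e (θ.coord e p₀ z w)) hb
  -- Here t(y) = h(z) is essential: the bracket produced by the right invariant fields lives over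
  -- t(y), the one in the Maurer–Cartan equation over h(z).
  have hMC := LieAlgebroid.OneForm.MaurerCartanEquation.coord e hθ hz (hyz ▸ hb) v w
    (α := α) (β := β) (by rwa [← hyz]) (by rwa [← hyz])
  rw [← hyz] at hMC
  rw [hι.fderiv_rightCoord_sub hy hb hα hβ, rightCoord_apply hb, ← map_add, ← map_add, add_comm,
    hMC, map_zero, map_zero]

end Integrates

end RightCoord

end LieGroupoid

/-! ### Solutions on M and solutions in charts -/

namespace LieGroupoid

section Solutions

variable {EX EG EM F : Type*}
  [NormedAddCommGroup EX] [NormedSpace ℝ EX] [FiniteDimensional ℝ EX]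
  [NormedAddCommGroup EG] [NormedSpace ℝ EG] [FiniteDimensional ℝ EG]
  [NormedAddCommGroup EM] [NormedSpace ℝ EM] [FiniteDimensional ℝ EM]
  [NormedAddCommGroup F] [NormedSpace ℝ F] [FiniteDimensional ℝ F]
  {X : Type*} [TopologicalSpace X] [ChartedSpace EX X] [IsManifold 𝓘(ℝ, EX) ∞ X] [T2Space X]
  {G : Type*} [TopologicalSpace G] [ChartedSpace EG G] [IsManifold 𝓘(ℝ, EG) ∞ G]
  {M : Type*} [TopologicalSpace M] [ChartedSpace EM M] [IsManifold 𝓘(ℝ, EM) ∞ M] [T2Space M]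
  {V : X → Type*} [∀ x, AddCommGroup (V x)] [∀ x, Module ℝ (V x)]
  [∀ x, TopologicalSpace (V x)] [∀ x, IsTopologicalAddGroup (V x)]
  [∀ x, ContinuousSMul ℝ (V x)] [TopologicalSpace (TotalSpace F V)]
  [FiberBundle F V] [VectorBundle ℝ F V] [ContMDiffVectorBundle ∞ F V 𝓘(ℝ, EX)]
  {A : LieAlgebroid EX F V} {𝒢 : LieGroupoid EX EG X G}
  {ι : ∀ x : X, V x →L[ℝ] TangentSpace 𝓘(ℝ, EG) (𝒢.unit x)} {h : M → X}
  {e : Trivialization F (TotalSpace.proj : TotalSpace F V → X)} [MemTrivializationAtlas e]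
  {θ : A.OneForm (EM := EM) h} {g₀ : G} {p₀ : M}

theorem coord_modelDeriv_extChartAt {q : M} (hq : q ∈ (extChartAt 𝓘(ℝ, EM) p₀).source)
    (hb : h q ∈ e.baseSet) (v : EM) :
    θ.coord e p₀ (extChartAt 𝓘(ℝ, EM) p₀ q) (modelDeriv EM EM (extChartAt 𝓘(ℝ, EM) p₀) q v) =
      (e ⟨h q, θ.modelMap q v⟩).2 := by
  rw [θ.coord_extChartAt e hq hb]
  have h1 := DFunLike.congr_fun (modelDeriv_symm_comp_extChartAt hq) v
  exact congrArg (fun v : EM ↦ (e ⟨h q, θ.modelMap q v⟩).2) h1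

theorem totalSpace_mk_symm_apply {x x' : X} (hx : x = x') (hb : x' ∈ e.baseSet) (a : V x') :
    (⟨x, e.symm x (e ⟨x', a⟩).2⟩ : TotalSpace F V) = ⟨x', a⟩ := by
  subst hx
  rw [e.symm_apply_apply_mk hb]

namespace Integrates

variable (hι : 𝒢.Integrates A ι)
include hι

/-- A solution of the differential equation in charts has the prescribed Maurer–Cartan form. -/
theorem modelMaurerCartan_eq_of_hasFDerivAt {φ : EM → EG} {z : EM}
    (hz : z ∈ (extChartAt 𝓘(ℝ, EM) p₀).target) (hφz : φ z ∈ (extChartAt 𝓘(ℝ, EG) g₀).target)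
    (ht : 𝒢.tgt ((extChartAt 𝓘(ℝ, EG) g₀).symm (φ z)) = h ((extChartAt 𝓘(ℝ, EM) p₀).symm z))
    (hb : h ((extChartAt 𝓘(ℝ, EM) p₀).symm z) ∈ e.baseSet)
    (hφ : HasFDerivAt φ ((𝒢.rightCoord ι e g₀ (φ z)).comp (θ.coord e p₀ z)) z) (v : EM) :
    (⟨𝒢.tgt ((extChartAt 𝓘(ℝ, EG) g₀).symm (φ z)),
      𝒢.modelMaurerCartan ι ((extChartAt 𝓘(ℝ, EG) g₀).symm (φ z))
        (modelDeriv EM EG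
          (fun q ↦ (extChartAt 𝓘(ℝ, EG) g₀).symm (φ (extChartAt 𝓘(ℝ, EM) p₀ q)))
          ((extChartAt 𝓘(ℝ, EM) p₀).symm z) v)⟩ : TotalSpace F V) =
      ⟨h ((extChartAt 𝓘(ℝ, EM) p₀).symm z), θ.modelMap ((extChartAt 𝓘(ℝ, EM) p₀).symm z) v⟩ := by
  set κ := extChartAt 𝓘(ℝ, EG) g₀
  set μ := extChartAt 𝓘(ℝ, EM) p₀
  have hq : μ.symm z ∈ μ.source := μ.map_target hz
  have h1 := ((hasModelDerivAt_extChartAt_symm hφz).comp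
    ((hasModelDerivAt_iff_hasFDerivAt.2 hφ).comp (hasModelDerivAt_extChartAt hq)
      (μ.right_inv hz)) (congrArg φ (μ.right_inv hz))).modelDeriv
  have h2 := coord_modelDeriv_extChartAt (θ := θ) hq hb v
  rw [μ.right_inv hz] at h2
  have h3 := DFunLike.congr_fun (modelDeriv_symm_comp_extChartAt (κ.map_target hφz))
    (𝒢.rightTangent ι (κ.symm (φ z)) (e.symm (𝒢.tgt (κ.symm (φ z)))
      (e ⟨h (μ.symm z), θ.modelMap (μ.symm z) v⟩).2))
  rw [κ.right_inv hφz, ContinuousLinearMap.comp_apply] at h3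
  rw [h1]
  simp only [ContinuousLinearMap.comp_apply]
  rw [h2, rightCoord_apply (by rw [ht]; exact hb), h3, ContinuousLinearMap.id_apply,
    hι.maurerCartan_rightTangent, totalSpace_mk_symm_apply ht hb]

/-- Solutions satisfy the differential equation `dφ = dR_φ θ`. -/
theorem hasModelDerivAt_of_isSolutionOn {x : X} {U : Set M} {φ : M → G}
    (hφ : 𝒢.IsSolutionOn θ ι x U φ) {q : M} (hq : q ∈ U) (hb : h q ∈ e.baseSet) :
    HasModelDerivAt φ q ((𝒢.rightTangent ι (φ q)).comp ((e.symmL ℝ (𝒢.tgt (φ q))).comp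
      ((e.continuousLinearMapAt ℝ (h q)).comp (θ.modelMap q)))) := by
  have h1 := (hφ.contMDiffOn.contMDiffAt (hφ.isOpen.mem_nhds hq)).hasModelDerivAt
  have hs : ∀ᶠ q' in 𝓝 q, 𝒢.src (φ q') = 𝒢.src (φ q) := by
    filter_upwards [hφ.isOpen.mem_nhds hq] with q' hq'
    exact (hφ.mapsTo hq').trans (hφ.mapsTo hq).symm
  refine h1.congr_deriv (ContinuousLinearMap.ext fun v ↦ ?_)
  rw [← hι.rightTangent_maurerCartan h1 hs v]
  have h2 := hφ.pullback_eq q hq v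
  have h3 : 𝒢.tgt (φ q) = h q := congrArg TotalSpace.proj h2
  -- The fibres over t(φ(q)) and h(q) agree only through the equality `h3`. Applying `e` over one
  -- base point and its inverse over the other transports vectors between them.
  have h4 : e.symm (𝒢.tgt (φ q)) (e ⟨h q, θ.modelMap q v⟩).2 =
      𝒢.modelMaurerCartan ι (φ q) (modelDeriv EM EG φ q v) := by
    have h5 : (e ⟨𝒢.tgt (φ q), 𝒢.modelMaurerCartan ι (φ q) (modelDeriv EM EG φ q v)⟩).2 =
      (e ⟨h q, θ.modelMap q v⟩).2 := congrArg (fun a ↦ (e a).2) h2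
    rw [← h5, e.symm_apply_apply_mk (by rw [h3]; exact hb)]
  rw [← h4]
  simp only [ContinuousLinearMap.comp_apply]
  rw [e.continuousLinearMapAt_apply (R := ℝ), e.linearMapAt_apply (R := ℝ), if_pos hb,
    e.symmL_apply (by rw [h3]; exact hb)]

/-- Converse to `modelMaurerCartan_eq_of_hasFDerivAt`. It brings arbitrary solutions into the
coordinate system in which uniqueness is proved. -/
theorem hasFDerivAt_of_isSolutionOn {x : X} {U : Set M} {φ : M → G}
    (hφ : 𝒢.IsSolutionOn θ ι x U φ) {z : EM} (hz : z ∈ (extChartAt 𝓘(ℝ, EM) p₀).target)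
    (hq : (extChartAt 𝓘(ℝ, EM) p₀).symm z ∈ U)
    (hφq : φ ((extChartAt 𝓘(ℝ, EM) p₀).symm z) ∈ (extChartAt 𝓘(ℝ, EG) g₀).source)
    (hb : h ((extChartAt 𝓘(ℝ, EM) p₀).symm z) ∈ e.baseSet) :
    HasFDerivAt
      (fun z ↦ extChartAt 𝓘(ℝ, EG) g₀ (φ ((extChartAt 𝓘(ℝ, EM) p₀).symm z)))
      ((𝒢.rightCoord ι e g₀ (extChartAt 𝓘(ℝ, EG) g₀ (φ ((extChartAt 𝓘(ℝ, EM) p₀).symm z)))).comp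
        (θ.coord e p₀ z)) z := by
  have h1 := (hasModelDerivAt_extChartAt hφq).comp
    ((hι.hasModelDerivAt_of_isSolutionOn hφ hq hb).comp
      (hasModelDerivAt_extChartAt_symm hz) rfl) rfl
  rw [hasModelDerivAt_iff_hasFDerivAt] at h1
  convert h1 using 1
  rw [rightCoord, (extChartAt 𝓘(ℝ, EG) g₀).left_inv hφq]
  rfl

end Integrates

end Solutions

end LieGroupoid

/-! ### Anchor, target and source in coordinates -/

section Existence

variable {EX EG EM F : Type*}
  [NormedAddCommGroup EX] [NormedSpace ℝ EX] [FiniteDimensional ℝ EX]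
  [NormedAddCommGroup EG] [NormedSpace ℝ EG] [FiniteDimensional ℝ EG]
  [NormedAddCommGroup EM] [NormedSpace ℝ EM] [FiniteDimensional ℝ EM]
  [NormedAddCommGroup F] [NormedSpace ℝ F] [FiniteDimensional ℝ F]
  {X : Type*} [TopologicalSpace X] [ChartedSpace EX X] [IsManifold 𝓘(ℝ, EX) ∞ X] [T2Space X]
  {G : Type*} [TopologicalSpace G] [ChartedSpace EG G] [IsManifold 𝓘(ℝ, EG) ∞ G]
  {M : Type*} [TopologicalSpace M] [ChartedSpace EM M] [IsManifold 𝓘(ℝ, EM) ∞ M] [T2Space M]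
  {V : X → Type*} [∀ x, AddCommGroup (V x)] [∀ x, Module ℝ (V x)]
  [∀ x, TopologicalSpace (V x)] [∀ x, IsTopologicalAddGroup (V x)]
  [∀ x, ContinuousSMul ℝ (V x)] [TopologicalSpace (TotalSpace F V)]
  [FiberBundle F V] [VectorBundle ℝ F V] [ContMDiffVectorBundle ∞ F V 𝓘(ℝ, EX)]
  {A : LieAlgebroid EX F V} {𝒢 : LieGroupoid EX EG X G}
  {ι : ∀ x : X, V x →L[ℝ] TangentSpace 𝓘(ℝ, EG) (𝒢.unit x)} {h : M → X}

/-- The anchor of a Lie algebroid, in the chart at `x₁` and a trivialization of `V`. -/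
def LieAlgebroid.anchorCoord (A : LieAlgebroid EX F V)
    (e : Trivialization F (TotalSpace.proj : TotalSpace F V → X)) [MemTrivializationAtlas e]
    (x₁ : X) (z : EX) : F →L[ℝ] EX :=
  (modelDeriv EX EX (extChartAt 𝓘(ℝ, EX) x₁) ((extChartAt 𝓘(ℝ, EX) x₁).symm z)).comp
    ((A.anchor ((extChartAt 𝓘(ℝ, EX) x₁).symm z)).comp
      (e.symmL ℝ ((extChartAt 𝓘(ℝ, EX) x₁).symm z)))

variable {e : Trivialization F (TotalSpace.proj : TotalSpace F V → X)} [MemTrivializationAtlas e]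
  {θ : A.OneForm (EM := EM) h} {g₀ : G} {p₀ : M} {x₁ : X}

theorem LieAlgebroid.anchorCoord_extChartAt {x : X} (hx : x ∈ (extChartAt 𝓘(ℝ, EX) x₁).source)
    (hb : x ∈ e.baseSet) (f : F) :
    A.anchorCoord e x₁ (extChartAt 𝓘(ℝ, EX) x₁ x) f =
      modelDeriv EX EX (extChartAt 𝓘(ℝ, EX) x₁) x (A.anchor x (e.symm x f)) := by
  rw [anchorCoord, (extChartAt 𝓘(ℝ, EX) x₁).left_inv hx, ← e.symmL_apply (R := ℝ) hb]
  rfl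

theorem LieAlgebroid.contDiffAt_anchorCoord {z : EX} (hz : z ∈ (extChartAt 𝓘(ℝ, EX) x₁).target)
    (hb : (extChartAt 𝓘(ℝ, EX) x₁).symm z ∈ e.baseSet) :
    ContDiffAt ℝ ∞ (A.anchorCoord e x₁) z := by
  have : IsManifold 𝓘(ℝ, EX) 1 X := IsManifold.of_le (n := ∞) (by simp)
  rw [contDiffAt_clm_apply_iff]
  intro f
  have h1 : ContMDiffAt 𝓘(ℝ, EX) 𝓘(ℝ, EX).tangent ∞
      (fun x ↦ (⟨x, A.anchor x (e.symm x f)⟩ : TangentBundle 𝓘(ℝ, EX) X))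
      ((extChartAt 𝓘(ℝ, EX) x₁).symm z) :=
    ContMDiffAt.comp (g := fun a : TotalSpace F V ↦
      (⟨a.proj, A.anchor a.proj a.snd⟩ : TangentBundle 𝓘(ℝ, EX) X)) _ (A.contMDiff_anchor _)
      ((contMDiffOn_trivialization_symm_const e f).contMDiffAt (e.open_baseSet.mem_nhds hb))
  refine (contDiffAt_chartVectorField hz h1).congr_of_eventuallyEq ?_
  filter_upwards [(isOpen_extChartAt_target x₁).mem_nhds hz,
    (contMDiffAt_extChartAt_symm hz).continuousAt.eventually (e.open_baseSet.mem_nhds hb)]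
    with y hy hyb
  have h2 := A.anchorCoord_extChartAt ((extChartAt 𝓘(ℝ, EX) x₁).map_target hy) hyb f
  rw [(extChartAt 𝓘(ℝ, EX) x₁).right_inv hy] at h2
  exact h2

/-- The condition ♯ ∘ θ = dh in coordinates. It makes h a solution of the equation dx = ρ(x) ∘ Θ,
with ρ the anchor, that t ∘ φ has to satisfy. -/
theorem LieAlgebroid.OneForm.hasFDerivAt_base {z : EM} (hz : z ∈ (extChartAt 𝓘(ℝ, EM) p₀).target)
    (hx : h ((extChartAt 𝓘(ℝ, EM) p₀).symm z) ∈ (extChartAt 𝓘(ℝ, EX) x₁).source)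
    (hb : h ((extChartAt 𝓘(ℝ, EM) p₀).symm z) ∈ e.baseSet) :
    HasFDerivAt (fun z ↦ extChartAt 𝓘(ℝ, EX) x₁ (h ((extChartAt 𝓘(ℝ, EM) p₀).symm z)))
      ((A.anchorCoord e x₁ (extChartAt 𝓘(ℝ, EX) x₁ (h ((extChartAt 𝓘(ℝ, EM) p₀).symm z)))).comp
        (θ.coord e p₀ z)) z := by
  have h1 := (hasModelDerivAt_extChartAt hx).comp
    ((θ.contMDiff_base _).hasModelDerivAt.comp (hasModelDerivAt_extChartAt_symm hz) rfl) rfl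
  rw [hasModelDerivAt_iff_hasFDerivAt] at h1
  refine h1.congr_fderiv (ContinuousLinearMap.ext fun v ↦ ?_)
  simp only [ContinuousLinearMap.comp_apply]
  rw [A.anchorCoord_extChartAt hx hb, θ.symm_coord e hb, θ.anchor_modelMap]

/-- Right invariant fields are t-related to the anchors of their sections. This is the
first-integral hypothesis of `exists_hasFDerivAt_comp`. -/
theorem LieGroupoid.Integrates.exists_hasFDerivAt_tgt (hι : 𝒢.Integrates A ι) {y : EG}
    (hy : y ∈ (extChartAt 𝓘(ℝ, EG) g₀).target)
    (hx : 𝒢.tgt ((extChartAt 𝓘(ℝ, EG) g₀).symm y) ∈ (extChartAt 𝓘(ℝ, EX) x₁).source)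
    (hb : 𝒢.tgt ((extChartAt 𝓘(ℝ, EG) g₀).symm y) ∈ e.baseSet) :
    ∃ t' : EG →L[ℝ] EX,
      HasFDerivAt (fun y ↦ extChartAt 𝓘(ℝ, EX) x₁ (𝒢.tgt ((extChartAt 𝓘(ℝ, EG) g₀).symm y))) t' y ∧
      ∀ f, t' (𝒢.rightCoord ι e g₀ y f) = A.anchorCoord e x₁
        (extChartAt 𝓘(ℝ, EX) x₁ (𝒢.tgt ((extChartAt 𝓘(ℝ, EG) g₀).symm y))) f := by
  have h1 := (hasModelDerivAt_extChartAt hx).comp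
    ((𝒢.contMDiff_tgt _).hasModelDerivAt.comp (hasModelDerivAt_extChartAt_symm hy) rfl) rfl
  rw [hasModelDerivAt_iff_hasFDerivAt] at h1
  refine ⟨_, h1, fun f ↦ ?_⟩
  have h2 := DFunLike.congr_fun
    (modelDeriv_symm_comp_extChartAt ((extChartAt 𝓘(ℝ, EG) g₀).map_target hy))
    (𝒢.rightTangent ι ((extChartAt 𝓘(ℝ, EG) g₀).symm y)
      (e.symm (𝒢.tgt ((extChartAt 𝓘(ℝ, EG) g₀).symm y)) f))
  rw [(extChartAt 𝓘(ℝ, EG) g₀).right_inv hy, ContinuousLinearMap.comp_apply] at h2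
  simp only [ContinuousLinearMap.comp_apply]
  rw [rightCoord_apply hb, A.anchorCoord_extChartAt hx hb, h2, ContinuousLinearMap.id_apply,
    hι.modelDeriv_tgt_rightTangent]

/-- Right invariant fields are tangent to the s-fibres, which keeps solutions inside one of them. -/
theorem LieGroupoid.Integrates.hasFDerivAt_src (hι : 𝒢.Integrates A ι) {y : EG}
    (hy : y ∈ (extChartAt 𝓘(ℝ, EG) g₀).target) {x₂ : X}
    (hx : 𝒢.src ((extChartAt 𝓘(ℝ, EG) g₀).symm y) ∈ (extChartAt 𝓘(ℝ, EX) x₂).source)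
    (hb : 𝒢.tgt ((extChartAt 𝓘(ℝ, EG) g₀).symm y) ∈ e.baseSet) :
    ∃ s' : EG →L[ℝ] EX,
      HasFDerivAt (fun y ↦ extChartAt 𝓘(ℝ, EX) x₂ (𝒢.src ((extChartAt 𝓘(ℝ, EG) g₀).symm y))) s' y ∧
      ∀ f, s' (𝒢.rightCoord ι e g₀ y f) = 0 := by
  have h1 := (hasModelDerivAt_extChartAt hx).comp
    ((𝒢.contMDiff_src _).hasModelDerivAt.comp (hasModelDerivAt_extChartAt_symm hy) rfl) rfl
  rw [hasModelDerivAt_iff_hasFDerivAt] at h1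
  refine ⟨_, h1, fun f ↦ ?_⟩
  have h2 := DFunLike.congr_fun
    (modelDeriv_symm_comp_extChartAt ((extChartAt 𝓘(ℝ, EG) g₀).map_target hy))
    (𝒢.rightTangent ι ((extChartAt 𝓘(ℝ, EG) g₀).symm y)
      (e.symm (𝒢.tgt ((extChartAt 𝓘(ℝ, EG) g₀).symm y)) f))
  rw [(extChartAt 𝓘(ℝ, EG) g₀).right_inv hy, ContinuousLinearMap.comp_apply] at h2
  simp only [ContinuousLinearMap.comp_apply]
  rw [rightCoord_apply hb, h2, ContinuousLinearMap.id_apply, hι.modelDeriv_src_rightTangent,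
    map_zero]

end Existence

/-! ### Uniqueness and existence of solutions -/

namespace LieGroupoid.Integrates

variable {EX EG EM F : Type*}
  [NormedAddCommGroup EX] [NormedSpace ℝ EX] [FiniteDimensional ℝ EX]
  [NormedAddCommGroup EG] [NormedSpace ℝ EG] [FiniteDimensional ℝ EG]
  [NormedAddCommGroup EM] [NormedSpace ℝ EM] [FiniteDimensional ℝ EM]
  [NormedAddCommGroup F] [NormedSpace ℝ F] [FiniteDimensional ℝ F]
  {X : Type*} [TopologicalSpace X] [ChartedSpace EX X] [IsManifold 𝓘(ℝ, EX) ∞ X] [T2Space X]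
  {G : Type*} [TopologicalSpace G] [ChartedSpace EG G] [IsManifold 𝓘(ℝ, EG) ∞ G]
  {M : Type*} [TopologicalSpace M] [ChartedSpace EM M] [IsManifold 𝓘(ℝ, EM) ∞ M] [T2Space M]
  {V : X → Type*} [∀ x, AddCommGroup (V x)] [∀ x, Module ℝ (V x)]
  [∀ x, TopologicalSpace (V x)] [∀ x, IsTopologicalAddGroup (V x)]
  [∀ x, ContinuousSMul ℝ (V x)] [TopologicalSpace (TotalSpace F V)]
  [FiberBundle F V] [VectorBundle ℝ F V] [ContMDiffVectorBundle ∞ F V 𝓘(ℝ, EX)]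
  {A : LieAlgebroid EX F V} {𝒢 : LieGroupoid EX EG X G}
  {ι : ∀ x : X, V x →L[ℝ] TangentSpace 𝓘(ℝ, EG) (𝒢.unit x)} {h : M → X}
  {θ : A.OneForm (EM := EM) h} {g₀ : G} {p₀ : M}

/-- In charts at `p₀` and at the common value, both maps solve dφ = R(φ) ∘ Θ with the same initial
value, so `eventuallyEq_of_hasFDerivAt_comp` applies. Injectivity of the chart of G carries the
result back. -/
theorem eventuallyEq_of_isSolutionOn (hι : 𝒢.Integrates A ι) {x x' : X} {U U' : Set M}
    {φ φ' : M → G} (hφ : 𝒢.IsSolutionOn θ ι x U φ) (hφ' : 𝒢.IsSolutionOn θ ι x' U' φ')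
    (hU : p₀ ∈ U) (hU' : p₀ ∈ U') (heq : φ' p₀ = φ p₀) : φ' =ᶠ[𝓝 p₀] φ := by
  set g₀ := φ p₀ with hg₀
  set κ := extChartAt 𝓘(ℝ, EG) g₀
  set μ := extChartAt 𝓘(ℝ, EM) p₀
  set e := trivializationAt F V (h p₀)
  have hb : h p₀ ∈ e.baseSet := FiberBundle.mem_baseSet_trivializationAt' _
  have htgt : 𝒢.tgt g₀ = h p₀ := congrArg TotalSpace.proj (hφ.pullback_eq p₀ hU 0)
  have hp₀ : p₀ ∈ μ.source := mem_extChartAt_source p₀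
  have hz₀ : μ p₀ ∈ μ.target := μ.map_source hp₀
  have hμ : Filter.Tendsto μ.symm (𝓝 (μ p₀)) (𝓝 p₀) := by
    have := (contMDiffAt_extChartAt_symm hz₀).continuousAt.tendsto
    rwa [μ.left_inv hp₀] at this
  have key : ∀ {x : X} {U : Set M} {φ : M → G}, 𝒢.IsSolutionOn θ ι x U φ → p₀ ∈ U → φ p₀ = g₀ →
      (∀ᶠ q in 𝓝 p₀, φ q ∈ κ.source) ∧ ∀ᶠ z in 𝓝 (μ p₀),
        HasFDerivAt (fun z ↦ κ (φ (μ.symm z)))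
          ((𝒢.rightCoord ι e g₀ (κ (φ (μ.symm z)))).comp (θ.coord e p₀ z)) z := by
    intro x U φ hφ hU hφ0
    have hUn := hφ.isOpen.mem_nhds hU
    have hc : ContinuousAt φ p₀ := (hφ.contMDiffOn.contMDiffAt hUn).continuousAt
    have h1 : ∀ᶠ q in 𝓝 p₀, φ q ∈ κ.source :=
      hc.eventually (by rw [hφ0]; exact extChartAt_source_mem_nhds (I := 𝓘(ℝ, EG)) g₀)
    refine ⟨h1, ?_⟩
    filter_upwards [hμ.eventually h1, hμ.eventually hUn,
      (isOpen_extChartAt_target p₀).mem_nhds hz₀, hμ.eventually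
        ((θ.contMDiff_base p₀).continuousAt.eventually (e.open_baseSet.mem_nhds hb))]
      with z k1 k2 k3 k4
    exact hι.hasFDerivAt_of_isSolutionOn hφ k3 k2 k1 k4
  obtain ⟨hs, hd⟩ := key hφ hU rfl
  obtain ⟨hs', hd'⟩ := key hφ' hU' heq
  have hR : ContDiffAt ℝ 1 (𝒢.rightCoord ι e g₀) (κ (φ (μ.symm (μ p₀)))) := by
    rw [μ.left_inv hp₀, ← hg₀]
    refine (hι.contDiffAt_rightCoord (mem_extChartAt_target g₀) ?_).of_le (by simp)
    rw [extChartAt_to_inv, htgt]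
    exact hb
  have hΘ : ContinuousAt (θ.coord e p₀) (μ p₀) :=
    (θ.contDiffAt_coord e hz₀ (by rw [μ.left_inv hp₀]; exact hb)).continuousAt
  have h2 := eventuallyEq_of_hasFDerivAt_comp (φ := fun z ↦ κ (φ (μ.symm z)))
    (φ' := fun z ↦ κ (φ' (μ.symm z))) hR hΘ hd hd' (by simp only [μ.left_inv hp₀, heq, ← hg₀])
  have hμ' : Filter.Tendsto μ (𝓝 p₀) (𝓝 (μ p₀)) := (continuousAt_extChartAt p₀).tendsto
  filter_upwards [hs, hs', hμ'.eventually h2, extChartAt_source_mem_nhds (I := 𝓘(ℝ, EM)) p₀]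
    with q k1 k2 k3 k4
  rw [μ.left_inv k4] at k3
  exact κ.injOn k2 k1 k3

/-- The coordinate solution of `exists_hasFDerivAt_comp` is read back through the charts; constancy
of s ∘ φ is then deduced from the equation. -/
theorem exists_isSolutionOn (hι : 𝒢.Integrates A ι) {D : CovariantDerivative 𝓘(ℝ, EX) F V}
    (hθ : θ.MaurerCartanEquation D) (hpg : h p₀ = 𝒢.tgt g₀) :
    ∃ (U : Set M) (φ : M → G), p₀ ∈ U ∧ φ p₀ = g₀ ∧ 𝒢.IsSolutionOn θ ι (𝒢.src g₀) U φ := by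
  have : CompleteSpace EG := FiniteDimensional.complete ℝ EG
  set κ := extChartAt 𝓘(ℝ, EG) g₀ with hκ
  set μ := extChartAt 𝓘(ℝ, EM) p₀ with hμ
  set χ := extChartAt 𝓘(ℝ, EX) (h p₀) with hχ
  set χs := extChartAt 𝓘(ℝ, EX) (𝒢.src g₀) with hχs
  set e := trivializationAt F V (h p₀)
  have hb : h p₀ ∈ e.baseSet := FiberBundle.mem_baseSet_trivializationAt' _
  have hp₀ : p₀ ∈ μ.source := mem_extChartAt_source p₀
  have hg₀ : g₀ ∈ κ.source := mem_extChartAt_source g₀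
  have hx₀ : h p₀ ∈ χ.source := mem_extChartAt_source (h p₀)
  -- `O` and `B` are the coordinate regions on which the targets and the values of h stay in `N`.
  -- There χ is injective, so equal coordinates of t(y) and h(z) mean t(y) = h(z), as the
  -- integrability lemma requires.
  set N : Set X := e.baseSet ∩ χ.source with hN
  have hNo : IsOpen N := e.open_baseSet.inter (isOpen_extChartAt_source _)
  set O : Set EG := κ.target ∩ κ.symm ⁻¹' (𝒢.tgt ⁻¹' N ∩ 𝒢.src ⁻¹' χs.source) with hOdef
  set B : Set EM := μ.target ∩ μ.symm ⁻¹' (h ⁻¹' N) with hBdef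
  have hO : IsOpen O := (continuousOn_extChartAt_symm g₀).isOpen_inter_preimage
    (isOpen_extChartAt_target g₀) ((hNo.preimage 𝒢.contMDiff_tgt.continuous).inter
      ((isOpen_extChartAt_source _).preimage 𝒢.contMDiff_src.continuous))
  have hB : IsOpen B := (continuousOn_extChartAt_symm p₀).isOpen_inter_preimage
    (isOpen_extChartAt_target p₀) (hNo.preimage θ.contMDiff_base.continuous)
  have hyO : κ g₀ ∈ O := by
    refine ⟨κ.map_source hg₀, ?_, ?_⟩
    · show 𝒢.tgt (κ.symm (κ g₀)) ∈ N
      rw [κ.left_inv hg₀, ← hpg]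
      exact ⟨hb, hx₀⟩
    · show 𝒢.src (κ.symm (κ g₀)) ∈ χs.source
      rw [κ.left_inv hg₀]
      exact mem_extChartAt_source _
  have hzB : μ p₀ ∈ B := by
    refine ⟨μ.map_source hp₀, ?_⟩
    show h (μ.symm (μ p₀)) ∈ N
    rw [μ.left_inv hp₀]
    exact ⟨hb, hx₀⟩
  have hR : ContDiffOn ℝ ∞ (𝒢.rightCoord ι e g₀) O := fun y hy ↦
    (hι.contDiffAt_rightCoord hy.1 hy.2.1.1).contDiffWithinAt
  have hΘ : ContDiffOn ℝ ∞ (θ.coord e p₀) B := fun z hz ↦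
    (θ.contDiffAt_coord e hz.1 hz.2.1).contDiffWithinAt
  obtain ⟨U, hUo, hzU, hUB, φ, hφ0, hφ⟩ := exists_hasFDerivAt_comp
    (t := fun y ↦ χ (𝒢.tgt (κ.symm y))) (h := fun z ↦ χ (h (μ.symm z)))
    (ρ := A.anchorCoord e (h p₀)) hO hB hyO hzB (hR.of_le (by simp)) (hΘ.of_le (by simp))
    (by
      refine ContDiffAt.of_le (A.contDiffAt_anchorCoord ?_ ?_) (by simp)
      · exact χ.map_source hyO.2.1.2
      · rw [χ.left_inv hyO.2.1.2]
        exact hyO.2.1.1)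
    (fun y hy ↦ hι.exists_hasFDerivAt_tgt hy.1 hy.2.1.2 hy.2.1.1)
    (fun z hz ↦ θ.hasFDerivAt_base hz.1 hz.2.2 hz.2.1)
    (by simp only [κ.left_inv hg₀, μ.left_inv hp₀, hpg])
    (fun z hz y hy hyz v w ↦ hι.integrability hθ hz.1 hy.1
      (χ.injOn hy.2.1.2 hz.2.2 hyz) hy.2.1.1 v w)
  -- A ball is connected, so on it the vanishing derivative of s ∘ φ makes s ∘ φ constant.
  obtain ⟨r, hr, hrU⟩ := Metric.isOpen_iff.1 hUo _ hzU
  have hφs : ContDiffOn ℝ ∞ φ U := contDiffOn_of_hasFDerivAt_comp hUo hR (hΘ.mono hUB)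
    (fun z hz ↦ (hφ z hz).1) (fun z hz ↦ (hφ z hz).2.2)
  have htgt : ∀ z ∈ U, 𝒢.tgt (κ.symm (φ z)) = h (μ.symm z) := fun z hz ↦
    χ.injOn (hφ z hz).1.2.1.2 (hUB hz).2.2 (hφ z hz).2.1
  have hsrc : ∀ z ∈ Metric.ball (μ p₀) r, 𝒢.src (κ.symm (φ z)) = 𝒢.src g₀ := by
    intro z hz
    have hd : ∀ z ∈ Metric.ball (μ p₀) r,
        HasFDerivAt (fun z ↦ χs (𝒢.src (κ.symm (φ z)))) (0 : EM →L[ℝ] EX) z := by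
      intro z hz
      obtain ⟨hzO, -, hdz⟩ := hφ z (hrU hz)
      obtain ⟨s', hs', hs0⟩ := hι.hasFDerivAt_src (e := e) hzO.1 hzO.2.2 hzO.2.1.1
      refine (hs'.comp z hdz).congr_fderiv (ContinuousLinearMap.ext fun v ↦ ?_)
      exact hs0 _
    have h1 := Metric.isOpen_ball.is_const_of_fderiv_eq_zero
      (convex_ball (μ p₀) r).isPreconnected
      (fun z hz ↦ (hd z hz).differentiableAt.differentiableWithinAt) (fun z hz ↦ (hd z hz).fderiv)
      hz (Metric.mem_ball_self hr)
    have h2 : 𝒢.src (κ.symm (φ (μ p₀))) = 𝒢.src g₀ := by rw [hφ0, κ.left_inv hg₀]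
    rw [← h2]
    exact χs.injOn (hφ z (hrU hz)).1.2.2 (hφ _ hzU).1.2.2 h1
  refine ⟨μ.source ∩ μ ⁻¹' Metric.ball (μ p₀) r, fun q ↦ κ.symm (φ (μ q)),
    ⟨hp₀, Metric.mem_ball_self hr⟩, by simp only [hφ0, κ.left_inv hg₀], ?_, ?_, ?_, ?_⟩
  · exact (continuousOn_extChartAt p₀).isOpen_inter_preimage (isOpen_extChartAt_source p₀)
      Metric.isOpen_ball
  · intro q hq
    have h1 : ContMDiffAt 𝓘(ℝ, EM) 𝓘(ℝ, EM) ∞ μ q := contMDiffAt_extChartAt' (by simpa [hμ] using hq.1)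
    have h2 : ContMDiffAt 𝓘(ℝ, EM) 𝓘(ℝ, EG) ∞ (fun q ↦ φ (μ q)) q :=
      ContMDiffAt.comp (g := φ) q
        (hφs.contDiffAt (hUo.mem_nhds (hrU hq.2))).contMDiffAt h1
    exact (ContMDiffAt.comp (g := κ.symm) q
      (contMDiffAt_extChartAt_symm (hφ _ (hrU hq.2)).1.1) h2).contMDiffWithinAt
  · intro q hq
    exact hsrc _ hq.2
  · intro q hq v
    have hz := hrU hq.2
    have h1 := hι.modelMaurerCartan_eq_of_hasFDerivAt (e := e) (θ := θ) (p₀ := p₀) (g₀ := g₀)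
      (hUB hz).1 (hφ _ hz).1.1 (htgt _ hz) (hUB hz).2.1 (hφ _ hz).2.2 v
    rw [← hμ, μ.left_inv hq.1] at h1
    exact h1

end LieGroupoid.Integrates

/-! ### Local diffeomorphisms onto open subsets of a fibre -/

section Fiber

variable {EX EG EM : Type*}
  [NormedAddCommGroup EX] [NormedSpace ℝ EX] [FiniteDimensional ℝ EX]
  [NormedAddCommGroup EG] [NormedSpace ℝ EG] [FiniteDimensional ℝ EG]
  [NormedAddCommGroup EM] [NormedSpace ℝ EM] [FiniteDimensional ℝ EM]

/-- A smooth map with bijective derivative has a local inverse, which is smooth near the image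
point. -/
theorem ContDiffAt.exists_eventually_contDiffAt_leftInverse {f : EM → EM} {z₀ : EM}
    (hf : ∀ᶠ z in 𝓝 z₀, ContDiffAt ℝ ∞ f z) {L : EM ≃L[ℝ] EM}
    (hL : HasFDerivAt f (L : EM →L[ℝ] EM) z₀) :
    ∃ r : EM → EM, (∀ᶠ w in 𝓝 (f z₀), ContDiffAt ℝ ∞ r w) ∧ (∀ᶠ z in 𝓝 z₀, r (f z) = z) ∧
      ∀ᶠ w in 𝓝 (f z₀), f (r w) = w := by
  have : CompleteSpace EM := FiniteDimensional.complete ℝ EM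
  have hf0 := hf.self_of_nhds
  set Φ := hf0.toOpenPartialHomeomorph f hL (by simp) with hΦ
  have hΦf : ∀ z, Φ z = f z := fun z ↦ rfl
  have hz₀ : z₀ ∈ Φ.source := hf0.mem_toOpenPartialHomeomorph_source hL (by simp)
  have hw₀ : f z₀ ∈ Φ.target := Φ.map_source hz₀
  have hr : Filter.Tendsto Φ.symm (𝓝 (f z₀)) (𝓝 z₀) := by
    have := (Φ.continuousAt_symm hw₀).tendsto
    rwa [← hΦf, Φ.left_inv hz₀] at this
  -- Invertibility of the derivative is an open condition. Hence the local inverse is smooth at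
  -- every point near f(z₀), and not only at f(z₀).
  have hinv : ∀ᶠ z in 𝓝 z₀, fderiv ℝ f z ∈ range ((↑) : (EM ≃L[ℝ] EM) → EM →L[ℝ] EM) := by
    have hc : ContinuousAt (fderiv ℝ f) z₀ :=
      (hf0.fderiv_right (m := 0) (by simp)).continuousAt
    refine hc.eventually ?_
    rw [hL.fderiv]
    exact ContinuousLinearEquiv.nhds L
  refine ⟨Φ.symm, ?_, ?_, ?_⟩
  · filter_upwards [hr.eventually hinv, hr.eventually hf, Φ.open_target.mem_nhds hw₀]
      with w ⟨L', hL'⟩ h2 h3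
    refine Φ.contDiffAt_symm (f₀' := L') h3 ?_ h2
    rw [hL']
    exact (h2.differentiableAt (by simp)).hasFDerivAt
  · filter_upwards [Φ.open_source.mem_nhds hz₀] with z hz using Φ.left_inv hz
  · filter_upwards [Φ.open_target.mem_nhds hw₀] with w hw using Φ.right_inv hw

/-- An immersion into a fibre of a submersion, onto the tangent space of the fibre, has a smooth
left inverse which is also a right inverse on the fibre. -/
theorem ContDiffAt.exists_leftInverse_on_fiber {f : EM → EG} {s : EG → EX} {z₀ : EM}
    (hf : ∀ᶠ z in 𝓝 z₀, ContDiffAt ℝ ∞ f z) (hs : ContDiffAt ℝ ∞ s (f z₀))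
    (hsf : ∀ᶠ z in 𝓝 z₀, s (f z) = s (f z₀))
    {L : EM →L[ℝ] EG} (hL : HasFDerivAt f L z₀) (hinj : Function.Injective L)
    {S : EG →L[ℝ] EX} (hS : HasFDerivAt s S (f z₀)) (hsurj : Function.Surjective S)
    (hker : ∀ ξ, S ξ = 0 → ∃ v, L v = ξ) :
    ∃ r : EG → EM, (∀ᶠ y in 𝓝 (f z₀), ContDiffAt ℝ ∞ r y) ∧ (∀ᶠ z in 𝓝 z₀, r (f z) = z) ∧
      ∀ᶠ y in 𝓝 (f z₀), s y = s (f z₀) → f (r y) = y := by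
  have : CompleteSpace EG := FiniteDimensional.complete ℝ EG
  obtain ⟨P₀, hP₀⟩ := (L : EM →ₗ[ℝ] EG).exists_leftInverse_of_injective
    (LinearMap.ker_eq_bot.2 hinj)
  -- A linear left inverse of the derivative makes P ∘ f a local diffeomorphism. With ρ its local
  -- inverse, ρ ∘ P is a left inverse of `f` defined on the ambient space.
  set P : EG →L[ℝ] EM := LinearMap.toContinuousLinearMap P₀
  have hPL : ∀ v, P (L v) = v := fun v ↦ DFunLike.congr_fun hP₀ v
  have hSL : ∀ v, S (L v) = 0 := by
    have h1 : HasFDerivAt (fun z ↦ s (f z)) (S.comp L) z₀ := hS.comp z₀ hL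
    have h2 := h1.unique ((hasFDerivAt_const (s (f z₀)) z₀).congr_of_eventuallyEq hsf)
    exact fun v ↦ DFunLike.congr_fun h2 v
  have hPf : HasFDerivAt (fun z ↦ P (f z)) ((ContinuousLinearEquiv.refl ℝ EM : EM ≃L[ℝ] EM) :
      EM →L[ℝ] EM) z₀ := by
    refine (P.hasFDerivAt.comp z₀ hL).congr_fderiv ?_
    ext v
    exact hPL v
  obtain ⟨ρ, hρ1, hρ2, hρ3⟩ := ContDiffAt.exists_eventually_contDiffAt_leftInverse
    (f := fun z ↦ P (f z)) (hf.mono fun z hz ↦ P.contDiff.contDiffAt.comp z hz) hPf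
  -- Since ker S is the range of `L` and `P` inverts `L`, the pair (P, S) is bijective, so (P, s)
  -- separates points near f(z₀).
  have hΛinj : Function.Injective (P.prod S) := by
    refine (injective_iff_map_eq_zero _).2 fun ξ hξ ↦ ?_
    obtain ⟨h1, h2⟩ := Prod.mk.inj hξ
    obtain ⟨v, rfl⟩ := hker ξ h2
    have : v = 0 := (hPL v).symm.trans h1
    rw [this, map_zero]
  have hΛsurj : Function.Surjective (P.prod S) := by
    rintro ⟨v, w⟩
    obtain ⟨η, rfl⟩ := hsurj w
    refine ⟨η + L (v - P η), Prod.ext ?_ ?_⟩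
    · show P (η + L (v - P η)) = v
      rw [map_add, hPL, add_sub_cancel]
    · show S (η + L (v - P η)) = S η
      rw [map_add, hSL, add_zero]
  set Λ : EG ≃L[ℝ] EM × EX := (LinearEquiv.ofBijective
    ((P.prod S : EG →L[ℝ] EM × EX) : EG →ₗ[ℝ] EM × EX) ⟨hΛinj, hΛsurj⟩).toContinuousLinearEquiv
  have hΛd : HasFDerivAt (fun y ↦ (P y, s y)) (Λ : EG →L[ℝ] EM × EX) (f z₀) :=
    (P.hasFDerivAt.prodMk hS).congr_fderiv (by ext <;> rfl)
  have hΛc : ContDiffAt ℝ ∞ (fun y ↦ (P y, s y)) (f z₀) := P.contDiff.contDiffAt.prodMk hs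
  set Φ := hΛc.toOpenPartialHomeomorph (fun y ↦ (P y, s y)) hΛd (by simp)
  have hy₀ : Φ.source ∈ 𝓝 (f z₀) :=
    Φ.open_source.mem_nhds (hΛc.mem_toOpenPartialHomeomorph_source hΛd (by simp))
  have hPt : Filter.Tendsto P (𝓝 (f z₀)) (𝓝 (P (f z₀))) := P.continuous.continuousAt
  have hρt : Filter.Tendsto (fun y ↦ ρ (P y)) (𝓝 (f z₀)) (𝓝 z₀) := by
    have h1 := hρ1.self_of_nhds.continuousAt.tendsto
    have h2 : ρ (P (f z₀)) = z₀ := hρ2.self_of_nhds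
    rw [h2] at h1
    exact h1.comp hPt
  have hft : Filter.Tendsto f (𝓝 z₀) (𝓝 (f z₀)) := hL.continuousAt
  refine ⟨fun y ↦ ρ (P y), ?_, hρ2, ?_⟩
  · filter_upwards [hPt.eventually hρ1] with y hy using hy.comp y P.contDiff.contDiffAt
  · filter_upwards [hy₀, hρt.eventually (hft.eventually hy₀), hPt.eventually hρ3,
      hρt.eventually hsf] with y h1 h2 h3 h4 h5
    -- The points f(ρ(P y)) and `y` have the same image under `P`, and the same `s` since both lie
    -- in the fibre.
    exact Φ.injOn h2 h1 (Prod.ext h3 (h4.trans h5.symm))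

variable
  {X : Type*} [TopologicalSpace X] [ChartedSpace EX X] [IsManifold 𝓘(ℝ, EX) ∞ X]
  {G : Type*} [TopologicalSpace G] [ChartedSpace EG G] [IsManifold 𝓘(ℝ, EG) ∞ G]
  {M : Type*} [TopologicalSpace M] [ChartedSpace EM M] [IsManifold 𝓘(ℝ, EM) ∞ M]

/-- In charts, `ContDiffAt.exists_leftInverse_on_fiber` gives a smooth map `r` on the ambient space
that inverts φ. That `r` is a left inverse gives the smooth inverse map; that it is also a right
inverse on the s-fibre makes the image open there. -/
theorem LieGroupoid.exists_isDiffeoOntoOpenOfSrcFiber (𝒢 : LieGroupoid EX EG X G) {x : X}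
    {U : Set M} (hU : IsOpen U) {φ : M → G} (hφ : ContMDiffOn 𝓘(ℝ, EM) 𝓘(ℝ, EG) ∞ φ U)
    (hφx : MapsTo φ U (𝒢.srcFiber x)) {p : M} (hp : p ∈ U) {L : EM →L[ℝ] EG}
    (hL : HasModelDerivAt φ p L) (hinj : Function.Injective L)
    (hker : ∀ ξ, modelDeriv EG EX 𝒢.src (φ p) ξ = 0 → ∃ v, L v = ξ) :
    ∃ U₁ ⊆ U, p ∈ U₁ ∧ 𝒢.IsDiffeoOntoOpenOfSrcFiber EM x U₁ φ := by
  set κ := extChartAt 𝓘(ℝ, EG) (φ p) with hκ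
  set μ := extChartAt 𝓘(ℝ, EM) p with hμ
  set χ := extChartAt 𝓘(ℝ, EX) (𝒢.src (φ p)) with hχ
  have hpμ : p ∈ μ.source := mem_extChartAt_source p
  have hgκ : φ p ∈ κ.source := mem_extChartAt_source (φ p)
  have hxχ : 𝒢.src (φ p) ∈ χ.source := mem_extChartAt_source _
  have hz₀ : μ p ∈ μ.target := μ.map_source hpμ
  have hy₀ : κ (φ p) ∈ κ.target := κ.map_source hgκ
  have hμt : Filter.Tendsto μ.symm (𝓝 (μ p)) (𝓝 p) := by
    have := (contMDiffAt_extChartAt_symm hz₀).continuousAt.tendsto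
    rwa [μ.left_inv hpμ] at this
  set f : EM → EG := fun z ↦ κ (φ (μ.symm z)) with hf
  set s : EG → EX := fun y ↦ χ (𝒢.src (κ.symm y)) with hs
  have hf0 : f (μ p) = κ (φ p) := by simp only [hf, μ.left_inv hpμ]
  have hs0 : s (κ (φ p)) = χ (𝒢.src (φ p)) := by simp only [hs, κ.left_inv hgκ]
  have hφs : ∀ᶠ q in 𝓝 p, φ q ∈ κ.source :=
    hL.continuousAt.eventually (extChartAt_source_mem_nhds (I := 𝓘(ℝ, EG)) (φ p))
  have hUn := hU.mem_nhds hp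
  have hfc : ∀ᶠ z in 𝓝 (μ p), ContDiffAt ℝ ∞ f z := by
    filter_upwards [hμt.eventually hφs, hμt.eventually hUn,
      (isOpen_extChartAt_target p).mem_nhds hz₀] with z h1 h2 h3
    rw [← contMDiffAt_iff_contDiffAt]
    exact ContMDiffAt.comp (g := κ) (f := fun z ↦ φ (μ.symm z)) z
      (contMDiffAt_extChartAt' (by simpa [hκ] using h1))
      (ContMDiffAt.comp (g := φ) z (hφ.contMDiffAt (hU.mem_nhds h2))
        (contMDiffAt_extChartAt_symm h3))
  have hsc : ContDiffAt ℝ ∞ s (f (μ p)) := by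
    rw [hf0, ← contMDiffAt_iff_contDiffAt]
    exact ContMDiffAt.comp_of_eq (g := χ) (f := fun y ↦ 𝒢.src (κ.symm y))
      (contMDiffAt_extChartAt (x := 𝒢.src (φ p)))
      (ContMDiffAt.comp (g := 𝒢.src) _ (𝒢.contMDiff_src _) (contMDiffAt_extChartAt_symm hy₀))
      (by rw [κ.left_inv hgκ])
  have hsf : ∀ᶠ z in 𝓝 (μ p), s (f z) = s (f (μ p)) := by
    filter_upwards [hμt.eventually hφs, hμt.eventually hUn] with z h1 h2
    rw [hf0, hs0]
    simp only [hf, hs, κ.left_inv h1]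
    rw [show 𝒢.src (φ (μ.symm z)) = x from hφx h2, show 𝒢.src (φ p) = x from hφx hp]
  set Dμ := modelDeriv EM EM μ.symm (μ p) with hDμ
  set Dμ' := modelDeriv EM EM μ p with hDμ'
  set Dκ := modelDeriv EG EG κ (φ p) with hDκ
  set Dκ' := modelDeriv EG EG κ.symm (κ (φ p)) with hDκ'
  set Dχ := modelDeriv EX EX χ (𝒢.src (φ p)) with hDχ
  set Ds := modelDeriv EG EX 𝒢.src (φ p) with hDs
  have eμ : ∀ v, Dμ (Dμ' v) = v := fun v ↦
    DFunLike.congr_fun (modelDeriv_symm_comp_extChartAt hpμ) v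
  have eμ' : ∀ v, Dμ' (Dμ v) = v := fun v ↦ by
    have := modelDeriv_extChartAt_comp_symm hz₀
    rw [μ.left_inv hpμ] at this
    exact DFunLike.congr_fun this v
  have eκ : ∀ v, Dκ' (Dκ v) = v := fun v ↦
    DFunLike.congr_fun (modelDeriv_symm_comp_extChartAt hgκ) v
  have eκ' : ∀ v, Dκ (Dκ' v) = v := fun v ↦ by
    have := modelDeriv_extChartAt_comp_symm hy₀
    rw [κ.left_inv hgκ] at this
    exact DFunLike.congr_fun this v
  have eχ : ∀ v, modelDeriv EX EX χ.symm (χ (𝒢.src (φ p))) (Dχ v) = v :=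
    fun v ↦ DFunLike.congr_fun (modelDeriv_symm_comp_extChartAt hxχ) v
  have eχ' : ∀ v, Dχ (modelDeriv EX EX χ.symm (χ (𝒢.src (φ p))) v) = v := fun v ↦ by
    have := modelDeriv_extChartAt_comp_symm (χ.map_source hxχ)
    rw [χ.left_inv hxχ] at this
    exact DFunLike.congr_fun this v
  have hfd : HasFDerivAt f (Dκ.comp (L.comp Dμ)) (μ p) :=
    hasModelDerivAt_iff_hasFDerivAt.1 <|
      (hasModelDerivAt_extChartAt hgκ).comp (hL.comp (hasModelDerivAt_extChartAt_symm hz₀)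
        (μ.left_inv hpμ)) (by rw [μ.left_inv hpμ])
  have hsd : HasFDerivAt s (Dχ.comp (Ds.comp Dκ')) (f (μ p)) := by
    rw [hf0]
    exact hasModelDerivAt_iff_hasFDerivAt.1 <|
      (hasModelDerivAt_extChartAt hxχ).comp ((𝒢.contMDiff_src _).hasModelDerivAt.comp
        (hasModelDerivAt_extChartAt_symm hy₀) (κ.left_inv hgκ)) (by rw [κ.left_inv hgκ])
  obtain ⟨r, hr1, hr2, hr3⟩ := ContDiffAt.exists_leftInverse_on_fiber hfc hsc hsf hfd
    (fun v w hvw ↦ by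
      have h1 : Dμ v = Dμ w := hinj (by
        rw [← eκ (L (Dμ v)), ← eκ (L (Dμ w))]
        exact congrArg Dκ' hvw)
      rw [← eμ' v, h1, eμ'])
    hsd (fun w ↦ by
      obtain ⟨η, hη⟩ : ∃ η : EG, Ds η = modelDeriv EX EX χ.symm (χ (𝒢.src (φ p))) w :=
        𝒢.src_submersion (φ p) _
      refine ⟨Dκ η, ?_⟩
      show Dχ (Ds (Dκ' (Dκ η))) = w
      rw [eκ, hη, eχ'])
    (fun ξ hξ ↦ by
      have h1 : Ds (Dκ' ξ) = 0 := by
        rw [← eχ (Ds (Dκ' ξ)), show Dχ (Ds (Dκ' ξ)) = 0 from hξ, map_zero]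
      obtain ⟨v, hv⟩ := hker _ h1
      refine ⟨Dμ' v, ?_⟩
      show Dκ (L (Dμ (Dμ' v))) = ξ
      rw [eμ, hv, eκ'])
  rw [hf0] at hr1 hr3
  obtain ⟨O, hOsub, hO, hyO⟩ := eventually_nhds_iff.1 (hr1.and hr3)
  have hft : Filter.Tendsto f (𝓝 (μ p)) (𝓝 (κ (φ p))) := by
    have := hfc.self_of_nhds.continuousAt.tendsto
    rwa [hf0] at this
  -- `Z` is chosen so that φ maps its points into the region `O` where `r` is controlled. The image
  -- is then cut out of the s-fibre by the open conditions κ(g) ∈ O and r(κ(g)) ∈ Z.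
  obtain ⟨Z, hZsub, hZ, hzZ⟩ := eventually_nhds_iff.1 (hr2.and ((hμt.eventually hφs).and
    ((hμt.eventually hUn).and (((isOpen_extChartAt_target p).eventually_mem hz₀).and
      (hft.eventually (hO.mem_nhds hyO))))))
  have hU₁ : IsOpen (μ.source ∩ μ ⁻¹' Z) :=
    (continuousOn_extChartAt p).isOpen_inter_preimage (isOpen_extChartAt_source p) hZ
  have hU₁U : μ.source ∩ μ ⁻¹' Z ⊆ U := by
    rintro q ⟨hq, hqZ⟩
    have := (hZsub _ hqZ).2.2.1
    rwa [μ.left_inv hq] at this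
  have hrO : IsOpen (O ∩ r ⁻¹' Z) :=
    ContinuousOn.isOpen_inter_preimage (fun y hy ↦ (hOsub y hy).1.continuousAt.continuousWithinAt)
      hO hZ
  have hW : IsOpen (κ.source ∩ κ ⁻¹' (O ∩ r ⁻¹' Z)) :=
    (continuousOn_extChartAt (φ p)).isOpen_inter_preimage (isOpen_extChartAt_source (φ p)) hrO
  have himg : φ '' (μ.source ∩ μ ⁻¹' Z) =
      𝒢.srcFiber x ∩ (κ.source ∩ κ ⁻¹' (O ∩ r ⁻¹' Z)) := by
    ext g
    constructor
    · rintro ⟨q, ⟨hq, hqZ⟩, rfl⟩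
      obtain ⟨h1, h2, h3, -, h5⟩ := hZsub _ hqZ
      simp only [hf, μ.left_inv hq] at h1 h2 h3 h5
      refine ⟨hφx h3, h2, h5, ?_⟩
      show r (κ (φ q)) ∈ Z
      rw [h1]
      exact hqZ
    · rintro ⟨hgx, hgs, hgO, hgZ⟩
      obtain ⟨h1, h2, h3, h4, h5⟩ := hZsub _ hgZ
      refine ⟨μ.symm (r (κ g)), ⟨μ.map_target h4, ?_⟩, κ.injOn h2 hgs ?_⟩
      · rw [mem_preimage, μ.right_inv h4]
        exact hgZ
      · refine (hOsub _ hgO).2 ?_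
        rw [hs0]
        simp only [hs, κ.left_inv hgs]
        rw [show 𝒢.src g = x from hgx, show 𝒢.src (φ p) = x from hφx hp]
  refine ⟨μ.source ∩ μ ⁻¹' Z, hU₁U, ⟨hpμ, hzZ⟩, hU₁, hφ.mono hU₁U, ⟨_, hW, himg⟩,
    fun g ↦ μ.symm (r (κ g)), ?_, ?_⟩
  · rw [himg]
    rintro g ⟨-, hgs, hgO, hgZ⟩
    refine ContMDiffAt.contMDiffWithinAt ?_
    exact ContMDiffAt.comp (g := μ.symm) (f := fun g ↦ r (κ g)) g
      (contMDiffAt_extChartAt_symm (hZsub _ hgZ).2.2.2.1)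
      (ContMDiffAt.comp (g := r) g (hOsub _ hgO).1.contMDiffAt
        (contMDiffAt_extChartAt' (by simpa [hκ] using hgs)))
  · rintro q ⟨hq, hqZ⟩
    have h1 := (hZsub _ hqZ).1
    simp only [hf, μ.left_inv hq] at h1
    show μ.symm (r (κ (φ q))) = q
    rw [h1, μ.left_inv hq]

end Fiber

/-! ### Solutions at points where θ is an isomorphism, and the main theorem -/

namespace LieGroupoid.Integrates

variable {EX EG EM F : Type*}
  [NormedAddCommGroup EX] [NormedSpace ℝ EX] [FiniteDimensional ℝ EX]
  [NormedAddCommGroup EG] [NormedSpace ℝ EG] [FiniteDimensional ℝ EG]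
  [NormedAddCommGroup EM] [NormedSpace ℝ EM] [FiniteDimensional ℝ EM]
  [NormedAddCommGroup F] [NormedSpace ℝ F] [FiniteDimensional ℝ F]
  {X : Type*} [TopologicalSpace X] [ChartedSpace EX X] [IsManifold 𝓘(ℝ, EX) ∞ X] [T2Space X]
  {G : Type*} [TopologicalSpace G] [ChartedSpace EG G] [IsManifold 𝓘(ℝ, EG) ∞ G]
  {M : Type*} [TopologicalSpace M] [ChartedSpace EM M] [IsManifold 𝓘(ℝ, EM) ∞ M] [T2Space M]
  {V : X → Type*} [∀ x, AddCommGroup (V x)] [∀ x, Module ℝ (V x)]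
  [∀ x, TopologicalSpace (V x)] [∀ x, IsTopologicalAddGroup (V x)]
  [∀ x, ContinuousSMul ℝ (V x)] [TopologicalSpace (TotalSpace F V)]
  [FiberBundle F V] [VectorBundle ℝ F V] [ContMDiffVectorBundle ∞ F V 𝓘(ℝ, EX)]
  {A : LieAlgebroid EX F V} {𝒢 : LieGroupoid EX EG X G}
  {ι : ∀ x : X, V x →L[ℝ] TangentSpace 𝓘(ℝ, EG) (𝒢.unit x)} {h : M → X}
  {θ : A.OneForm (EM := EM) h}

/-- Up to transport between the fibres over h(p) and t(φ(p)), dφ_p is θ_p followed by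
`rightTangent`, which is injective with range ker ds. So bijectivity of θ_p makes dφ_p an
isomorphism onto ker ds. -/
theorem exists_isDiffeoOntoOpenOfSrcFiber (hι : 𝒢.Integrates A ι) {x : X} {U : Set M} {φ : M → G}
    (hφ : 𝒢.IsSolutionOn θ ι x U φ) {p : M} (hp : p ∈ U) (hθp : Function.Bijective (θ.toFun p)) :
    ∃ U₁ ⊆ U, p ∈ U₁ ∧ 𝒢.IsDiffeoOntoOpenOfSrcFiber EM x U₁ φ := by
  set e := trivializationAt F V (h p)
  have hb : h p ∈ e.baseSet := FiberBundle.mem_baseSet_trivializationAt' _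
  have htgt : 𝒢.tgt (φ p) = h p := congrArg TotalSpace.proj (hφ.pullback_eq p hp 0)
  have hb' : 𝒢.tgt (φ p) ∈ e.baseSet := by rwa [htgt]
  refine 𝒢.exists_isDiffeoOntoOpenOfSrcFiber hφ.isOpen hφ.contMDiffOn hφ.mapsTo hp
    (hι.hasModelDerivAt_of_isSolutionOn hφ hp hb) ?_ ?_
  · intro v w hvw
    have h1 : e.symmL ℝ (𝒢.tgt (φ p)) (e.continuousLinearMapAt ℝ (h p) (θ.modelMap p v)) =
        e.symmL ℝ (𝒢.tgt (φ p)) (e.continuousLinearMapAt ℝ (h p) (θ.modelMap p w)) :=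
      (hι.maurerCartan_rightTangent _ _).symm.trans
        ((congrArg (𝒢.modelMaurerCartan ι (φ p)) hvw).trans (hι.maurerCartan_rightTangent _ _))
    have h2 := congrArg (e.continuousLinearMapAt ℝ (𝒢.tgt (φ p))) h1
    rw [e.continuousLinearMapAt_symmL hb', e.continuousLinearMapAt_symmL hb'] at h2
    have h3 := congrArg (e.symmL ℝ (h p)) h2
    rw [e.symmL_continuousLinearMapAt hb, e.symmL_continuousLinearMapAt hb] at h3
    exact hθp.1 h3
  · intro ξ hξ
    obtain ⟨a, rfl⟩ := hι.exists_rightTangent_eq hξ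
    obtain ⟨v, hv⟩ := hθp.2 (e.symmL ℝ (h p) (e.continuousLinearMapAt ℝ (𝒢.tgt (φ p)) a))
    refine ⟨v, ?_⟩
    have hv' : θ.modelMap p v = e.symmL ℝ (h p) (e.continuousLinearMapAt ℝ (𝒢.tgt (φ p)) a) := hv
    show 𝒢.rightTangent ι (φ p) (e.symmL ℝ (𝒢.tgt (φ p)) (e.continuousLinearMapAt ℝ (h p)
      (θ.modelMap p v))) = _
    rw [hv', e.continuousLinearMapAt_symmL hb, e.symmL_continuousLinearMapAt hb']

end LieGroupoid.Integrates

end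

theorem mainTheorem2 {EX EG EM F : Type*}
    [NormedAddCommGroup EX] [NormedSpace ℝ EX] [FiniteDimensional ℝ EX]
    [NormedAddCommGroup EG] [NormedSpace ℝ EG] [FiniteDimensional ℝ EG]
    [NormedAddCommGroup EM] [NormedSpace ℝ EM] [FiniteDimensional ℝ EM]
    [NormedAddCommGroup F] [NormedSpace ℝ F] [FiniteDimensional ℝ F]
    {X : Type*} [TopologicalSpace X] [ChartedSpace EX X] [IsManifold 𝓘(ℝ, EX) ∞ X] [T2Space X]
    {G : Type*} [TopologicalSpace G] [ChartedSpace EG G] [IsManifold 𝓘(ℝ, EG) ∞ G]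
    {M : Type*} [TopologicalSpace M] [ChartedSpace EM M] [IsManifold 𝓘(ℝ, EM) ∞ M] [T2Space M]
    {V : X → Type*} [∀ x, AddCommGroup (V x)] [∀ x, Module ℝ (V x)]
    [∀ x, TopologicalSpace (V x)] [∀ x, IsTopologicalAddGroup (V x)]
    [∀ x, ContinuousSMul ℝ (V x)] [TopologicalSpace (TotalSpace F V)]
    [FiberBundle F V] [VectorBundle ℝ F V] [ContMDiffVectorBundle ∞ F V 𝓘(ℝ, EX)]
    (A : LieAlgebroid EX F V) (𝒢 : LieGroupoid EX EG X G)
    (ι : ∀ x : X, V x →L[ℝ] TangentSpace 𝓘(ℝ, EG) (𝒢.unit x)) (hι : 𝒢.Integrates A ι)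
    (D : CovariantDerivative 𝓘(ℝ, EX) F V)
    (h : M → X) (θ : A.OneForm (EM := EM) h) (hθ : θ.MaurerCartanEquation D)
    (p₀ : M) (g₀ : G) (hpg : h p₀ = 𝒢.tgt g₀) :
    ∃ (U : Set M) (φ : M → G), p₀ ∈ U ∧ φ p₀ = g₀ ∧ 𝒢.IsSolutionOn θ ι (𝒢.src g₀) U φ ∧
      (∀ (U' : Set M) (φ' : M → G), p₀ ∈ U' → φ' p₀ = g₀ →
        𝒢.IsSolutionOn θ ι (𝒢.src g₀) U' φ' → φ' =ᶠ[𝓝 p₀] φ) ∧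
      (∀ p ∈ U, Function.Bijective (θ.toFun p) →
        ∃ U₁ ⊆ U, p ∈ U₁ ∧ 𝒢.IsDiffeoOntoOpenOfSrcFiber EM (𝒢.src g₀) U₁ φ) := by
  obtain ⟨U, φ, hU, hφ0, hφ⟩ := hι.exists_isSolutionOn hθ hpg
  exact ⟨U, φ, hU, hφ0, hφ, fun U' φ' hU' h0 hs ↦
    hι.eventuallyEq_of_isSolutionOn hφ hs hU hU' (h0.trans hφ0.symm),
    fun p hp hb ↦ hι.exists_isDiffeoOntoOpenOfSrcFiber hφ hp hb⟩
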